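/- Let $L$ be a fixed integer, let $(M(N))_{N\ge 1}$ be integers such that $c_N = M(N)L/N \to c_* > 0$ as $N\to\infty$ (so that $M=M(N)\to\infty$), and let $R_N$ be Hermitian $M\times M$ matrices with $aI \le R_N < bI$ for all $N\ge1$, where $a,b>0$ do not depend on $N$. Let $\lambda_{1,N}\ge\dots\ge\lambda_{M,N}$ be the eigenvalues of $R_N$. For $z\in\mathbb{C}^+$ let $t_N(z)$ be the solution of $$t_N(z)=\frac1M\mathrm{Tr}\,R_N T_N(z),\qquad T_N(z)=\Big(-zI-\frac{z c_N t_N(z)}{1-z c_N^2 t_N(z)^2}R_N\Big)^{-1},$$ such that $t_N(z)\in\mathbb{C}^+$ and $z t_N(z)\in\mathbb{C}^+$. Let $\mu_N$ be the finite positive measure carried by $[0,\infty)$ with Stieltjes transform $\int\frac{d\mu_N(x)}{x-z}=t_N(z)$, and let $\nu_N$ be the one with Stieltjes transform $\frac1M\mathrm{Tr}\,T_N(z)$. Put $$\phi_N(w)=c_N w^2\,\frac1M\mathrm{Tr}R_N(R_N-wI)^{-1}\Big(c_N\frac1M\mathrm{Tr}R_N(R_N-wI)^{-1}-1\Big).$$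 Assume that there is $\kappa>0$ such that for all $N$ large enough $$|\lambda_{k,N}-\lambda_{l,N}|\le\kappa\Big(\frac{|k-l|}{M}\Big)^{1/2}\qquad\text{for all }1\le k\le l\le M.$$ Then, for all $N$ (equivalently, all $M$) large enough, $\phi_N'$ has a unique zero $w_{+,N}$ in $(\lambda_{1,N},\infty)$ and, with $x_{+,N}=\phi_N(w_{+,N})$: - if $c_N\le 1$, then the supports of $\mu_N$ and of $\nu_N$ are both equal to $\mathcal S_N=[0,x_{+,N}]$; - if $c_N>1$, then $\frac1M\mathrm{Tr}R_N(R_N-\omega I)^{-1}=1/c_N$ has a smallest real root $\omega_{1,N}<0$, $\phi_N'$ has a unique zero $w_{-,N}$ in $(\omega_{1,N},0)$, the point $x_{-,N}=\phi_N(w_{-,N})$ satisfies $0<x_{-,N}<x_{+,N}$, and the supports of $\mu_N$ and of $\nu_N$ are both equal to $\mathcal S_N=\{0\}\cup[x_{-,N},x_{+,N}]$. -/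

import Mathlib

open MeasureTheory Filter Topology
open scoped ComplexOrder

noncomputable section

namespace AutocovSupport

/-- The Stieltjes transform `z ↦ ∫ dμ(x) / (x - z)` of a measure on the real line. -/
def stieltjes (μ : Measure ℝ) (z : ℂ) : ℂ := resolventTransform μ z

theorem stieltjes_eq_integral (μ : Measure ℝ) (z : ℂ) :
    stieltjes μ z = ∫ x : ℝ, ((x : ℂ) - z)⁻¹ ∂μ := by
  simp [stieltjes, resolventTransform_apply, resolvent]

/-- The normalized trace `(1/m) Tr A` of an `m × m` matrix. -/
def ntr {m : ℕ} (A : Matrix (Fin m) (Fin m) ℂ) : ℂ := (1 / (m : ℂ)) * A.trace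

/-- The matrix `(-z I - (z c t / (1 - z c² t²)) R)⁻¹`. -/
def resolventT {m : ℕ} (R : Matrix (Fin m) (Fin m) ℂ) (c : ℝ) (z t : ℂ) :
    Matrix (Fin m) (Fin m) ℂ :=
  (-(z • (1 : Matrix (Fin m) (Fin m) ℂ))
    - ((z * (c : ℂ) * t) / (1 - z * (c : ℂ) ^ 2 * t ^ 2)) • R)⁻¹

/-- `t` is an admissible solution at `z` of the canonical equation
`t = (1/m) Tr R (-z I - (z c t / (1 - z c² t²)) R)⁻¹`, that is, one for which
both `t` and `z t` lie in the open upper half-plane. -/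
def IsCanonicalSolution {m : ℕ} (R : Matrix (Fin m) (Fin m) ℂ) (c : ℝ) (z t : ℂ) : Prop :=
  0 < t.im ∧ 0 < (z * t).im ∧ t = ntr (R * resolventT R c z t)

/-- `μ` is a finite positive measure carried by `[0, ∞)` whose Stieltjes transform is, at every
point of the open upper half-plane, the admissible solution of the canonical equation. -/
def IsMu {m : ℕ} (R : Matrix (Fin m) (Fin m) ℂ) (c : ℝ) (μ : Measure ℝ) : Prop :=
  IsFiniteMeasure μ ∧ μ (Set.Iio 0) = 0 ∧
    ∀ z : ℂ, 0 < z.im → IsCanonicalSolution R c z (stieltjes μ z)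

open Classical in
/-- The measure whose Stieltjes transform is the admissible solution of the canonical equation
(the zero measure if there were none). -/
def mu {m : ℕ} (R : Matrix (Fin m) (Fin m) ℂ) (c : ℝ) : Measure ℝ :=
  if h : ∃ μ : Measure ℝ, IsMu R c μ then h.choose else 0

/-- The function `t(z)`, the Stieltjes transform of `mu R c`. -/
def tfun {m : ℕ} (R : Matrix (Fin m) (Fin m) ℂ) (c : ℝ) (z : ℂ) : ℂ := stieltjes (mu R c) z

/-- `ν` is a finite positive measure carried by `[0, ∞)` with Stieltjes transform
`(1/m) Tr T(z)`, where `T(z) = (-z I - (z c t(z) / (1 - z c² t(z)²)) R)⁻¹`. -/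
def IsNu {m : ℕ} (R : Matrix (Fin m) (Fin m) ℂ) (c : ℝ) (ν : Measure ℝ) : Prop :=
  IsFiniteMeasure ν ∧ ν (Set.Iio 0) = 0 ∧
    ∀ z : ℂ, 0 < z.im → stieltjes ν z = ntr (resolventT R c z (tfun R c z))

open Classical in
/-- The deterministic equivalent: the measure with Stieltjes transform `(1/m) Tr T(z)`
(the zero measure if there were none). -/
def nu {m : ℕ} (R : Matrix (Fin m) (Fin m) ℂ) (c : ℝ) : Measure ℝ :=
  if h : ∃ ν : Measure ℝ, IsNu R c ν then h.choose else 0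

/-- The real number `(1/m) Tr R (R - w I)⁻¹`, for Hermitian `R` and real `w`. -/
def rtr {m : ℕ} (R : Matrix (Fin m) (Fin m) ℂ) (w : ℝ) : ℝ :=
  (ntr (R * (R - (w : ℂ) • (1 : Matrix (Fin m) (Fin m) ℂ))⁻¹)).re

/-- `φ(w) = c w² · (1/m) Tr R (R - w I)⁻¹ · (c (1/m) Tr R (R - w I)⁻¹ - 1)`. -/
def phi {m : ℕ} (R : Matrix (Fin m) (Fin m) ℂ) (c : ℝ) (w : ℝ) : ℝ :=
  c * w ^ 2 * rtr R w * (c * rtr R w - 1)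

/-- `w` is a zero of `φ'` to the right of all the eigenvalues of `R`. -/
def IsWPlus {m : ℕ} {R : Matrix (Fin m) (Fin m) ℂ} (hR : R.IsHermitian) (c : ℝ) (w : ℝ) : Prop :=
  (∀ k, hR.eigenvalues₀ k < w) ∧ deriv (phi R c) w = 0

/-- `w` is a zero of `φ'` in `(ω₁, 0)`, where `ω₁` is the smallest real root of
`(1/m) Tr R (R - ω I)⁻¹ = 1 / c`. -/
def IsWMinus {m : ℕ} (R : Matrix (Fin m) (Fin m) ℂ) (c : ℝ) (w : ℝ) : Prop :=
  (∃ ω₁ : ℝ, IsLeast {ω : ℝ | rtr R ω = 1 / c} ω₁ ∧ ω₁ < w) ∧ w < 0 ∧ deriv (phi R c) w = 0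

/-- `x` is the point `x₊ = φ(w₊)`, with `w₊` the unique zero of `φ'` to the right of all the
eigenvalues of `R`. -/
def IsXPlus {m : ℕ} {R : Matrix (Fin m) (Fin m) ℂ} (hR : R.IsHermitian) (c : ℝ) (x : ℝ) : Prop :=
  ∃ w : ℝ, IsWPlus hR c w ∧ (∀ w' : ℝ, IsWPlus hR c w' → w' = w) ∧ x = phi R c w

/-- `x` is the point `x₋ = φ(w₋)`, with `w₋` the unique zero of `φ'` in `(ω₁, 0)`. -/
def IsXMinus {m : ℕ} (R : Matrix (Fin m) (Fin m) ℂ) (c : ℝ) (x : ℝ) : Prop :=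
  ∃ w : ℝ, IsWMinus R c w ∧ (∀ w' : ℝ, IsWMinus R c w' → w' = w) ∧ x = phi R c w

end AutocovSupport

end

/-! Let `l k` be the eigenvalues of `R` and `𝔼 k` their average. In the variables `ζ = √z` and
`m = ζ c t` the canonical equation is the fixed-point equation
`m = c 𝔼 k, l k / (-ζ - l k m / (1 - m²))`. Its right-hand side maps Stieltjes transforms of
discrete measures to transforms of the same kind and contracts where `Im ζ` is large, so a limit of
its iterates gives a solution there, and analytic continuation gives one on the whole upper
half-plane; undoing the square root produces the measures `μ` and `ν`.

With `w = z c t - 1 / (c t)` the canonical equation becomes `φ(w) = z`, and `w` is the only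
preimage of `z` in the upper half-plane with `c 𝔼 k, (l k / |l k - w|)² < 1`. Letting `z` descend to
the real axis, a real `x` outside the support comes from a real `w` with `φ(w) = x` and
`c 𝔼 k, (l k / (l k - w))² ≤ 1`; conversely, real points `w` with `φ(w) ≠ 0`, `φ'(w) > 0` and the
strict inequality are mapped outside the support.

No such `w` lies between two eigenvalues: the spacing condition bounds `𝔼 k, (l k / (l k - w))²`
from below there by a multiple of the harmonic sum `1 + 1/2 + ⋯ + 2/M`, hence makes it exceed
`1 / c` for large `M`. Moreover `φ ≤ 0` at such `w` between `0` and the smallest eigenvalue, so only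
`w` beyond the largest eigenvalue and `w < 0` remain. On the first range `φ` has its minimum at
`w₊`. On the second it has its maximum at `w₋` if `c > 1` and is negative if `c ≤ 1`. So the
positive part of the support is `[x₋, x₊]` or `(0, x₊]`. For `c > 1` the point `0` belongs to the
support as well: otherwise `z` times the Stieltjes transform would tend to `0` with `z`, but its
limit is the value at a real `w` of an explicit function that does not vanish there.
-/

noncomputable section

namespace AutocovSupport

open scoped BigOperators

theorem ofReal_sub_ne_zero (x : ℝ) {ζ : ℂ} (hζ : 0 < ζ.im) : (x : ℂ) - ζ ≠ 0 := by
  intro h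
  have him := congrArg Complex.im h
  rw [Complex.sub_im, Complex.ofReal_im, Complex.zero_im] at him
  linarith

theorem im_inv_ofReal_sub_pos (x : ℝ) {ζ : ℂ} (hζ : 0 < ζ.im) : 0 < ((x : ℂ) - ζ)⁻¹.im := by
  rw [Complex.inv_im, Complex.sub_im, Complex.ofReal_im, zero_sub, neg_neg]
  exact div_pos hζ (Complex.normSq_pos.2 (ofReal_sub_ne_zero x hζ))

/-- On the upper half-plane, `g` is the Stieltjes transform of a positive measure of total mass `P`
supported by finitely many real points. -/
def IsAtomicTransform (P : ℝ) (g : ℂ → ℂ) : Prop :=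
  ∃ (d : ℕ) (p x : Fin d → ℝ), (∀ i, 0 ≤ p i) ∧ ∑ i, p i = P ∧
    ∀ ζ : ℂ, 0 < ζ.im → g ζ = ∑ i, (p i : ℂ) * ((x i : ℂ) - ζ)⁻¹

theorem isAtomicTransform_of_fintype {ι : Type*} [Fintype ι] {P : ℝ} {g : ℂ → ℂ} (p x : ι → ℝ)
    (hp : ∀ i, 0 ≤ p i) (hP : ∑ i, p i = P)
    (hg : ∀ ζ : ℂ, 0 < ζ.im → g ζ = ∑ i, (p i : ℂ) * ((x i : ℂ) - ζ)⁻¹) :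
    IsAtomicTransform P g := by
  let ε := (Fintype.equivFin ι).symm
  refine ⟨Fintype.card ι, p ∘ ε, x ∘ ε, fun i => hp _, ?_, fun ζ hζ => ?_⟩
  · exact (Equiv.sum_comp ε p).trans hP
  · exact (hg ζ hζ).trans (Equiv.sum_comp ε fun i => (p i : ℂ) * ((x i : ℂ) - ζ)⁻¹).symm

namespace IsAtomicTransform

variable {P Q : ℝ} {f g : ℂ → ℂ}

theorem congr (hf : IsAtomicTransform P f) (hfg : ∀ ζ : ℂ, 0 < ζ.im → g ζ = f ζ) :
    IsAtomicTransform P g := by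
  obtain ⟨d, p, x, hp, hP, hf⟩ := hf
  exact ⟨d, p, x, hp, hP, fun ζ hζ => (hfg ζ hζ).trans (hf ζ hζ)⟩

theorem zero : IsAtomicTransform 0 (fun _ => 0) :=
  ⟨0, Fin.elim0, Fin.elim0, Fin.rec0, Fin.sum_univ_zero _, fun _ _ => (Fin.sum_univ_zero _).symm⟩

theorem add (hf : IsAtomicTransform P f) (hg : IsAtomicTransform Q g) :
    IsAtomicTransform (P + Q) (fun ζ => f ζ + g ζ) := by
  obtain ⟨d, p, x, hp, hP, hf⟩ := hf
  obtain ⟨e, q, y, hq, hQ, hg⟩ := hg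
  refine isAtomicTransform_of_fintype (Sum.elim p q) (Sum.elim x y) (Sum.forall.2 ⟨hp, hq⟩) ?_
    fun ζ hζ => ?_
  · simp only [Fintype.sum_sum_type, Sum.elim_inl, Sum.elim_inr, hP, hQ]
  · simp only [Fintype.sum_sum_type, Sum.elim_inl, Sum.elim_inr, hf ζ hζ, hg ζ hζ]

theorem const_mul (hf : IsAtomicTransform P f) {r : ℝ} (hr : 0 ≤ r) :
    IsAtomicTransform (r * P) (fun ζ => r * f ζ) := by
  obtain ⟨d, p, x, hp, hP, hf⟩ := hf
  refine ⟨d, fun i => r * p i, x, fun i => mul_nonneg hr (hp i), ?_, fun ζ hζ => ?_⟩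
  · rw [← Finset.mul_sum, hP]
  · simp only [hf ζ hζ, Finset.mul_sum, Complex.ofReal_mul, mul_assoc]

theorem sum {ι : Type*} (s : Finset ι) {P : ι → ℝ} {f : ι → ℂ → ℂ}
    (h : ∀ i ∈ s, IsAtomicTransform (P i) (f i)) :
    IsAtomicTransform (∑ i ∈ s, P i) (fun ζ => ∑ i ∈ s, f i ζ) := by
  classical
  induction s using Finset.induction_on with
  | empty => simpa only [Finset.sum_empty] using zero
  | insert a s ha ih =>
    simp only [Finset.sum_insert ha]
    exact (h a (Finset.mem_insert_self a s)).add
      (ih fun i hi => h i (Finset.mem_insert_of_mem hi))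

theorem im_pos_or_eq_zero (hf : IsAtomicTransform P f) {ζ : ℂ} (hζ : 0 < ζ.im) :
    0 < (f ζ).im ∨ f ζ = 0 := by
  obtain ⟨d, p, x, hp, -, hf⟩ := hf
  rw [hf ζ hζ]
  by_cases h : ∀ i, p i = 0
  · exact .inr (Finset.sum_eq_zero fun i _ => by rw [h i, Complex.ofReal_zero, zero_mul])
  · obtain ⟨i, hi⟩ := not_forall.1 h
    simp only [Complex.im_sum, Complex.im_ofReal_mul]
    exact .inl <| Finset.sum_pos'
      (fun j _ => mul_nonneg (hp j) (im_inv_ofReal_sub_pos _ hζ).le)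
      ⟨i, Finset.mem_univ i,
        mul_pos ((hp i).lt_of_ne' hi) (im_inv_ofReal_sub_pos _ hζ)⟩

theorem im_nonneg (hf : IsAtomicTransform P f) {ζ : ℂ} (hζ : 0 < ζ.im) : 0 ≤ (f ζ).im := by
  rcases hf.im_pos_or_eq_zero hζ with h | h
  · exact h.le
  · rw [h, Complex.zero_im]

end IsAtomicTransform

/-- Diagonalizing `T`, the vector `y ζ = (T - ζ)⁻¹ e` pairs with `e` to the Stieltjes transform of
the spectral measure of `T` at `e`. -/
theorem isAtomicTransform_of_isSymmetric {E : Type*} [NormedAddCommGroup E] [InnerProductSpace ℂ E]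
    [FiniteDimensional ℂ E] {T : E →ₗ[ℂ] E} (hT : T.IsSymmetric) (e : E) (y : ℂ → E)
    (hy : ∀ ζ : ℂ, 0 < ζ.im → T (y ζ) - ζ • y ζ = e) :
    IsAtomicTransform (‖e‖ ^ 2) (fun ζ => inner ℂ e (y ζ)) := by
  set b := hT.eigenvectorBasis rfl with hb
  set d := hT.eigenvalues rfl with hd
  refine ⟨_, fun i => ‖inner ℂ (b i) e‖ ^ 2, d, fun i => sq_nonneg _,
    b.sum_sq_norm_inner_right e, fun ζ hζ => ?_⟩
  have coord (i) : inner ℂ (b i) (y ζ) = inner ℂ (b i) e * ((d i : ℂ) - ζ)⁻¹ := by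
    rw [eq_mul_inv_iff_mul_eq₀ (ofReal_sub_ne_zero (d i) hζ), mul_comm]
    symm
    conv_lhs => rw [← hy ζ hζ]
    rw [inner_sub_right, ← hT, hb, hT.apply_eigenvectorBasis, ← hd, inner_smul_left,
      inner_smul_right, RCLike.conj_ofReal, sub_mul]
    rfl
  refine (b.sum_inner_mul_inner e (y ζ)).symm.trans ?_
  refine Finset.sum_congr rfl fun i _ => ?_
  rw [Complex.ofReal_pow, ← Complex.conj_mul', inner_conj_symm, mul_assoc, coord i]

theorem IsAtomicTransform.exists_isSymmetric {P : ℝ} {m : ℂ → ℂ} (hm : IsAtomicTransform P m) :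
    ∃ (d : ℕ) (T : EuclideanSpace ℂ (Fin d) →ₗ[ℂ] EuclideanSpace ℂ (Fin d))
      (e : EuclideanSpace ℂ (Fin d)) (y : ℂ → EuclideanSpace ℂ (Fin d)),
      T.IsSymmetric ∧ ‖e‖ ^ 2 = P ∧
        ∀ ζ : ℂ, 0 < ζ.im → T (y ζ) - ζ • y ζ = e ∧ inner ℂ e (y ζ) = m ζ := by
  obtain ⟨d, p, x, hp, rfl, hm⟩ := hm
  let D : Matrix (Fin d) (Fin d) ℂ := Matrix.diagonal fun i => (x i : ℂ)
  have hD : D.IsHermitian := Matrix.isHermitian_diagonal_iff.2 fun i => Complex.conj_ofReal (x i)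
  refine ⟨d, D.toEuclideanLin, WithLp.toLp 2 fun i => (√(p i) : ℂ),
    fun ζ => WithLp.toLp 2 fun i => √(p i) * ((x i : ℂ) - ζ)⁻¹,
    Matrix.isSymmetric_toEuclideanLin_iff.2 hD, ?_, fun ζ hζ => ⟨?_, ?_⟩⟩
  · simp only [EuclideanSpace.norm_sq_eq, Complex.norm_real, Real.norm_eq_abs, sq_abs,
      Real.sq_sqrt (hp _)]
  · ext i
    have := ofReal_sub_ne_zero (x i) hζ
    simp only [D, Matrix.toLpLin_apply, Matrix.mulVec_diagonal, PiLp.sub_apply, PiLp.smul_apply,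
      smul_eq_mul]
    field_simp
  · rw [hm ζ hζ, PiLp.inner_apply]
    refine Finset.sum_congr rfl fun i _ => ?_
    have : (√(p i) : ℂ) * √(p i) = p i := by rw [← Complex.ofReal_mul, Real.mul_self_sqrt (hp i)]
    rw [RCLike.inner_apply, Complex.conj_ofReal, ← this]
    ring

/-- If `m ζ = ⟪e, (T - ζ)⁻¹ e⟫`, then `m / (1 + s m)` is the same matrix element for the rank-one
perturbation `T + s ⟪e, ·⟫ e`. -/
theorem IsAtomicTransform.div_one_add {P : ℝ} {m : ℂ → ℂ} (hm : IsAtomicTransform P m) (s : ℝ) :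
    IsAtomicTransform P (fun ζ => m ζ / (1 + s * m ζ)) := by
  have hne (ζ : ℂ) (hζ : 0 < ζ.im) : 1 + (s : ℂ) * m ζ ≠ 0 := by
    intro h
    rcases hm.im_pos_or_eq_zero hζ with hpos | h0
    · have hs : s * (m ζ).im = 0 := by simpa using congrArg Complex.im h
      rcases mul_eq_zero.1 hs with rfl | h0
      · rw [Complex.ofReal_zero, zero_mul, add_zero] at h
        exact one_ne_zero h
      · exact hpos.ne' h0
    · rw [h0, mul_zero, add_zero] at h
      exact one_ne_zero h
  obtain ⟨d, T, e, y, hT, rfl, hy⟩ := hm.exists_isSymmetric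
  have hS : (T + (s : ℂ) • (InnerProductSpace.rankOne ℂ e e).toLinearMap).IsSymmetric :=
    hT.add ((InnerProductSpace.isSymmetric_rankOne_self e).smul (Complex.conj_ofReal s))
  refine (isAtomicTransform_of_isSymmetric hS e (fun ζ => (1 + s * m ζ)⁻¹ • y ζ)
    fun ζ hζ => ?_).congr fun ζ hζ => ?_
  · obtain ⟨hTy, hmy⟩ := hy ζ hζ
    have hTy' : T (y ζ) = e + ζ • y ζ := eq_add_of_sub_eq hTy
    simp only [map_smul, LinearMap.add_apply, LinearMap.smul_apply, ContinuousLinearMap.coe_coe,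
      InnerProductSpace.rankOne_apply, hmy, hTy']
    have := hne ζ hζ
    match_scalars
    · field_simp
    · field_simp
      ring
  · rw [inner_smul_right, (hy ζ hζ).2, div_eq_inv_mul]

/-- If `m ζ = ⟪e, (T - ζ)⁻¹ e⟫`, then by the Schur complement `1 / (-ζ - m)` is the corner matrix
element of the resolvent of the bordered operator `(a, u) ↦ (⟪e, u⟫, a e + T u)`. -/
theorem IsAtomicTransform.inv_neg_sub {P : ℝ} {m : ℂ → ℂ} (hm : IsAtomicTransform P m) :
    IsAtomicTransform 1 (fun ζ => (-ζ - m ζ)⁻¹) := by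
  have hne (ζ : ℂ) (hζ : 0 < ζ.im) : -ζ - m ζ ≠ 0 := by
    intro h
    have him := congrArg Complex.im h
    rw [Complex.sub_im, Complex.neg_im, Complex.zero_im] at him
    linarith [hm.im_nonneg hζ]
  obtain ⟨d, T, e, y, hT, -, hy⟩ := hm.exists_isSymmetric
  let E := EuclideanSpace ℂ (Fin d)
  let B : ℂ × E →ₗ[ℂ] ℂ × E := (innerₛₗ ℂ e ∘ₗ LinearMap.snd ℂ ℂ E).prod
    ((LinearMap.fst ℂ ℂ E).smulRight e + T ∘ₗ LinearMap.snd ℂ ℂ E)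
  let S : WithLp 2 (ℂ × E) →ₗ[ℂ] WithLp 2 (ℂ × E) := (WithLp.linearEquiv 2 ℂ (ℂ × E)).symm.conj B
  have hSapply (a : ℂ) (u : E) :
      S (WithLp.toLp 2 (a, u)) = WithLp.toLp 2 (inner ℂ e u, a • e + T u) := rfl
  have hS : S.IsSymmetric := by
    rintro ⟨a, u⟩ ⟨b, v⟩
    simp only [hSapply, WithLp.prod_inner_apply, inner_add_left, inner_add_right, inner_smul_left,
      inner_smul_right, hT u v, RCLike.inner_apply, inner_conj_symm]
    ring
  have hcorner : ‖WithLp.toLp 2 ((1 : ℂ), (0 : E))‖ ^ 2 = 1 := by simp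
  rw [← hcorner]
  refine (isAtomicTransform_of_isSymmetric hS (WithLp.toLp 2 (1, 0))
    (fun ζ => (-ζ - m ζ)⁻¹ • WithLp.toLp 2 (1, -y ζ)) fun ζ hζ => ?_).congr fun ζ _ => ?_
  · obtain ⟨hTy, hmy⟩ := hy ζ hζ
    have hTy' : T (y ζ) = e + ζ • y ζ := eq_add_of_sub_eq hTy
    rw [map_smul, hSapply, smul_comm ζ, ← smul_sub, inv_smul_eq_iff₀ (hne ζ hζ), ← WithLp.toLp_smul,
      ← WithLp.toLp_smul, ← WithLp.toLp_sub, inner_neg_right, hmy, map_neg, hTy']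
    congr 1
    refine Prod.ext ?_ ?_
    · simp only [Prod.smul_mk, smul_eq_mul, Prod.mk_sub_mk, Equiv.toFun_as_coe,
        WithLp.equiv_apply]
      ring
    · simp
  · simp [WithLp.prod_inner_apply]

theorem continuous_inv_ofReal_sub {ζ : ℂ} (hζ : 0 < ζ.im) :
    Continuous fun x : ℝ => ((x : ℂ) - ζ)⁻¹ :=
  (Complex.continuous_ofReal.sub continuous_const).inv₀ fun x => ofReal_sub_ne_zero x hζ

theorem norm_inv_ofReal_sub_le (x : ℝ) {ζ : ℂ} (hζ : 0 < ζ.im) :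
    ‖((x : ℂ) - ζ)⁻¹‖ ≤ ζ.im⁻¹ := by
  rw [norm_inv]
  refine inv_anti₀ hζ ?_
  have him := Complex.abs_im_le_norm ((x : ℂ) - ζ)
  rwa [Complex.sub_im, Complex.ofReal_im, zero_sub, abs_neg, abs_of_pos hζ] at him

theorem integrable_inv_ofReal_sub (σ : Measure ℝ) [IsFiniteMeasure σ] {ζ : ℂ} (hζ : 0 < ζ.im) :
    Integrable (fun x : ℝ => ((x : ℂ) - ζ)⁻¹) σ :=
  .of_bound (continuous_inv_ofReal_sub hζ).aestronglyMeasurable ζ.im⁻¹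
    (ae_of_all _ fun x => norm_inv_ofReal_sub_le x hζ)

theorem tendsto_inv_ofReal_sub_cocompact (ζ : ℂ) :
    Tendsto (fun x : ℝ => ((x : ℂ) - ζ)⁻¹) (cocompact ℝ) (𝓝 0) := by
  refine tendsto_inv₀_cobounded.comp (tendsto_norm_atTop_iff_cobounded.1 ?_)
  refine tendsto_atTop_mono (fun x : ℝ => ?_)
    (tendsto_atTop_add_const_right _ (-‖ζ‖) (tendsto_norm_cocompact_atTop (E := ℝ)))
  rw [← sub_eq_add_neg, ← Complex.norm_real x]
  exact norm_sub_norm_le (x : ℂ) ζ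

theorem IsAtomicTransform.exists_probabilityMeasure {g : ℂ → ℂ} (hg : IsAtomicTransform 1 g) :
    ∃ μ : ProbabilityMeasure ℝ, ∀ ζ : ℂ, 0 < ζ.im → stieltjes μ ζ = g ζ := by
  obtain ⟨d, p, x, hp, hP, hg⟩ := hg
  let μ : Measure ℝ := ∑ i, ENNReal.ofReal (p i) • Measure.dirac (x i)
  have hμ : IsProbabilityMeasure μ := ⟨by
    simp only [μ, Measure.finsetSum_apply, Measure.smul_apply, measure_univ, smul_eq_mul, mul_one]
    rw [← ENNReal.ofReal_sum_of_nonneg fun i _ => hp i, hP, ENNReal.ofReal_one]⟩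
  refine ⟨⟨μ, hμ⟩, fun ζ hζ => ?_⟩
  have hint (i) : Integrable (fun y : ℝ => ((y : ℂ) - ζ)⁻¹)
      (ENNReal.ofReal (p i) • Measure.dirac (x i)) :=
    (integrable_inv_ofReal_sub _ hζ).smul_measure ENNReal.ofReal_ne_top
  rw [stieltjes_eq_integral, hg ζ hζ, ProbabilityMeasure.coe_mk,
    integral_finsetSum_measure fun i _ => hint i]
  simp only [integral_smul_measure, integral_dirac, ENNReal.toReal_ofReal (hp _),
    Complex.real_smul]

/-- In the compact space of probability measures on the one-point compactification of `ℝ` some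
limit exists; restricting it to `ℝ` loses no part of the Stieltjes transform, whose kernel vanishes
at infinity. -/
theorem exists_tendsto_stieltjes {ι : Type*} (F : Ultrafilter ι) (μ : ι → ProbabilityMeasure ℝ) :
    ∃ σ : Measure ℝ, IsFiniteMeasure σ ∧ ∀ ζ : ℂ, 0 < ζ.im →
      Tendsto (fun i => stieltjes (μ i) ζ) F (𝓝 (stieltjes σ ζ)) := by
  let _ : MeasurableSpace (OnePoint ℝ) := borel _
  have : BorelSpace (OnePoint ℝ) := ⟨rfl⟩
  have hcoe : MeasurableEmbedding ((↑) : ℝ → OnePoint ℝ) :=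
    OnePoint.isOpenEmbedding_coe.measurableEmbedding
  let μ' (i : ι) : ProbabilityMeasure (OnePoint ℝ) := (μ i).map hcoe.measurable.aemeasurable
  obtain ⟨τ, -, hτ⟩ := isCompact_univ.ultrafilter_le_nhds (F.map μ') (by simp)
  refine ⟨(τ : Measure (OnePoint ℝ)).comap (↑), ⟨?_⟩, fun ζ hζ => ?_⟩
  · rw [hcoe.comap_apply]
    exact measure_lt_top _ _
  let K : C(OnePoint ℝ, ℂ) := OnePoint.continuousMapMk ⟨_, continuous_inv_ofReal_sub hζ⟩ 0
    ((coclosedCompact_eq_cocompact (X := ℝ)).symm ▸ tendsto_inv_ofReal_sub_cocompact ζ)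
  have hK (ρ : Measure ℝ) : stieltjes ρ ζ = ∫ x, K x ∂(ρ.map (↑)) :=
    (stieltjes_eq_integral ρ ζ).trans (hcoe.integral_map K).symm
  have hlim : stieltjes ((τ : Measure (OnePoint ℝ)).comap (↑)) ζ = ∫ x, K x ∂(τ : Measure _) := by
    rw [hK, hcoe.map_comap]
    refine setIntegral_eq_integral_of_forall_compl_eq_zero fun x hx => ?_
    rw [OnePoint.notMem_range_coe_iff.1 hx]
    rfl
  rw [hlim]
  simp only [hK]
  exact (ProbabilityMeasure.tendsto_iff_forall_integral_rclike_tendsto ℂ (μs := μ')).1 hτ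
    (BoundedContinuousFunction.mkOfCompact K)

/-- The rational function `m / (1 - m²)` through which the unknown of the canonical equation enters
the resolvent: with `m = √z c t` one has `z c t / (1 - z c² t²) = √z * ratioMap m`. -/
def ratioMap (m : ℂ) : ℂ := m / (1 - m ^ 2)

/-- The factor by which `ratioMap` dilates imaginary parts. -/
def ratioGain (m : ℂ) : ℝ := (‖(1 - m)⁻¹‖ ^ 2 + ‖(1 + m)⁻¹‖ ^ 2) / 2

theorem one_sub_ne_zero_of_im_pos {m : ℂ} (hm : 0 < m.im) : 1 - m ≠ 0 := by
  simpa using ofReal_sub_ne_zero 1 hm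

theorem one_add_ne_zero_of_im_pos {m : ℂ} (hm : 0 < m.im) : 1 + m ≠ 0 := by
  intro h
  have him := congrArg Complex.im h
  rw [Complex.add_im, Complex.one_im, Complex.zero_im] at him
  linarith

theorem one_sub_sq_ne_zero_of_im_pos {m : ℂ} (hm : 0 < m.im) : 1 - m ^ 2 ≠ 0 := by
  rw [← one_pow 2, sq_sub_sq]
  exact mul_ne_zero (one_add_ne_zero_of_im_pos hm) (one_sub_ne_zero_of_im_pos hm)

theorem ratioMap_eq {m : ℂ} (h₁ : 1 - m ≠ 0) (h₂ : 1 + m ≠ 0) :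
    ratioMap m = (m / (1 - m) + m / (1 + m)) / 2 := by
  rw [ratioMap, ← one_pow 2, sq_sub_sq]
  field_simp
  ring

theorem ratioMap_sub {m n : ℂ} (hm₁ : 1 - m ≠ 0) (hm₂ : 1 + m ≠ 0) (hn₁ : 1 - n ≠ 0)
    (hn₂ : 1 + n ≠ 0) :
    ratioMap m - ratioMap n =
      (m - n) * (((1 - m)⁻¹ * (1 - n)⁻¹ + (1 + m)⁻¹ * (1 + n)⁻¹) / 2) := by
  rw [ratioMap_eq hm₁ hm₂, ratioMap_eq hn₁ hn₂]
  field_simp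
  ring

theorem im_inv (z : ℂ) : z⁻¹.im = -z.im * ‖z⁻¹‖ ^ 2 := by
  rw [Complex.inv_im, norm_inv, inv_pow, ← Complex.normSq_eq_norm_sq, div_eq_mul_inv]

theorem im_ratioMap (m : ℂ) : (ratioMap m).im = m.im * ratioGain m := by
  by_cases h : 1 - m ^ 2 = 0
  · have hm : m = 1 ∨ m = -1 := sq_eq_one_iff.1 (sub_eq_zero.1 h).symm
    rcases hm with rfl | rfl <;> simp [ratioMap]
  · have h' : (1 - m) * (1 + m) ≠ 0 := fun h0 => h (by linear_combination h0)
    obtain ⟨h₁, h₂⟩ := mul_ne_zero_iff.1 h'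
    have key : ratioMap m = ((1 / 2 : ℝ) : ℂ) * ((1 - m)⁻¹ - (1 + m)⁻¹) := by
      rw [ratioMap_eq h₁ h₂]
      push_cast
      field_simp
      ring
    rw [key, Complex.im_ofReal_mul, Complex.sub_im, im_inv, im_inv, ratioGain, Complex.sub_im,
      Complex.add_im, Complex.one_im]
    ring

theorem ratioGain_nonneg (m : ℂ) : 0 ≤ ratioGain m := by
  rw [ratioGain]
  positivity

theorem im_ratioMap_nonneg {m : ℂ} (hm : 0 ≤ m.im) : 0 ≤ (ratioMap m).im := by
  rw [im_ratioMap]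
  exact mul_nonneg hm (ratioGain_nonneg m)

theorem norm_ratioMap_slope_sq_le (m n : ℂ) :
    ‖((1 - m)⁻¹ * (1 - n)⁻¹ + (1 + m)⁻¹ * (1 + n)⁻¹) / 2‖ ^ 2 ≤ ratioGain m * ratioGain n := by
  have htri : ‖((1 - m)⁻¹ * (1 - n)⁻¹ + (1 + m)⁻¹ * (1 + n)⁻¹) / 2‖ ≤
      (‖(1 - m)⁻¹‖ * ‖(1 - n)⁻¹‖ + ‖(1 + m)⁻¹‖ * ‖(1 + n)⁻¹‖) / 2 := by
    rw [norm_div, RCLike.norm_ofNat, ← norm_mul, ← norm_mul]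
    gcongr
    exact norm_add_le _ _
  refine (pow_le_pow_left₀ (norm_nonneg _) htri 2).trans ?_
  rw [ratioGain, ratioGain]
  nlinarith [sq_nonneg (‖(1 - m)⁻¹‖ * ‖(1 + n)⁻¹‖ - ‖(1 + m)⁻¹‖ * ‖(1 - n)⁻¹‖)]

theorem differentiableAt_ratioMap {m : ℂ} (hm : 1 - m ^ 2 ≠ 0) : DifferentiableAt ℂ ratioMap m :=
  differentiableAt_id.div ((differentiableAt_const 1).sub (differentiableAt_pow 2)) hm

theorem ratioMap_neg_conj (m : ℂ) :
    ratioMap (-(starRingEnd ℂ) m) = -(starRingEnd ℂ) (ratioMap m) := by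
  simp only [ratioMap, neg_sq, map_div₀, map_sub, map_one, map_pow, neg_div]

theorem IsAtomicTransform.ratioMap {P : ℝ} {m : ℂ → ℂ} (hm : IsAtomicTransform P m) :
    IsAtomicTransform P (fun ζ => ratioMap (m ζ)) := by
  have hmean := ((hm.div_one_add (-1)).add (hm.div_one_add 1)).const_mul one_half_pos.le
  rw [show 1 / 2 * (P + P) = P by ring] at hmean
  refine hmean.congr fun ζ hζ => ?_
  rcases hm.im_pos_or_eq_zero hζ with h | h
  · rw [ratioMap_eq (one_sub_ne_zero_of_im_pos h) (one_add_ne_zero_of_im_pos h)]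
    push_cast
    ring
  · simp [AutocovSupport.ratioMap, h]

/-- The eigenvalue `√z * (-z - (z c t / (1 - z c² t²)) l)⁻¹` of the rescaled resolvent, in the
variables `ζ = √z` and `m = ζ c t`. -/
def sqrtKernel (l : ℝ) (ζ m : ℂ) : ℂ := (-ζ - l * ratioMap m)⁻¹

section sqrtKernel

variable {l : ℝ} {ζ m n : ℂ}

theorem im_le_norm_sqrtKernel_denom (hl : 0 ≤ l) (hm : 0 ≤ m.im) :
    ζ.im ≤ ‖-ζ - l * ratioMap m‖ := by
  have him : (-ζ - l * ratioMap m).im = -(ζ.im + l * (ratioMap m).im) := by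
    rw [Complex.sub_im, Complex.neg_im, Complex.im_ofReal_mul]
    ring
  have hle := Complex.abs_im_le_norm (-ζ - l * ratioMap m)
  rw [him, abs_neg] at hle
  linarith [le_abs_self (ζ.im + l * (ratioMap m).im), mul_nonneg hl (im_ratioMap_nonneg hm)]

theorem sqrtKernel_denom_ne_zero (hl : 0 ≤ l) (hζ : 0 < ζ.im) (hm : 0 ≤ m.im) :
    -ζ - l * ratioMap m ≠ 0 :=
  norm_pos_iff.1 (hζ.trans_le (im_le_norm_sqrtKernel_denom hl hm))

theorem sqrtKernel_ne_zero (hl : 0 ≤ l) (hζ : 0 < ζ.im) (hm : 0 ≤ m.im) : sqrtKernel l ζ m ≠ 0 :=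
  inv_ne_zero (sqrtKernel_denom_ne_zero hl hζ hm)

theorem norm_sqrtKernel_le (hl : 0 ≤ l) (hζ : 0 < ζ.im) (hm : 0 ≤ m.im) :
    ‖sqrtKernel l ζ m‖ ≤ ζ.im⁻¹ := by
  rw [sqrtKernel, norm_inv]
  exact inv_anti₀ hζ (im_le_norm_sqrtKernel_denom hl hm)

theorem im_sqrtKernel (l : ℝ) (ζ m : ℂ) :
    (sqrtKernel l ζ m).im = (ζ.im + l * (ratioMap m).im) * ‖sqrtKernel l ζ m‖ ^ 2 := by
  rw [sqrtKernel, im_inv, Complex.sub_im, Complex.neg_im, Complex.im_ofReal_mul]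
  ring

theorem sqrtKernel_sub (hl : 0 ≤ l) (hζ : 0 < ζ.im) (hm : 0 ≤ m.im) (hn : 0 ≤ n.im) :
    sqrtKernel l ζ m - sqrtKernel l ζ n =
      (ratioMap m - ratioMap n) * (l * sqrtKernel l ζ m * sqrtKernel l ζ n) := by
  rw [sqrtKernel, sqrtKernel, inv_sub_inv (sqrtKernel_denom_ne_zero hl hζ hm)
    (sqrtKernel_denom_ne_zero hl hζ hn), div_eq_mul_inv, mul_inv]
  ring

theorem sqrtKernel_neg_conj (l : ℝ) (ζ m : ℂ) :
    sqrtKernel l (-(starRingEnd ℂ) ζ) (-(starRingEnd ℂ) m) =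
      -(starRingEnd ℂ) (sqrtKernel l ζ m) := by
  rw [sqrtKernel, sqrtKernel, ratioMap_neg_conj, map_inv₀, map_sub, map_neg, map_mul,
    Complex.conj_ofReal, ← inv_neg]
  ring

theorem differentiableOn_sqrtKernel {f : ℂ → ℂ} (hf : DifferentiableOn ℂ f {ζ | 0 < ζ.im})
    (hl : 0 ≤ l) (hpos : ∀ ζ : ℂ, 0 < ζ.im → 0 < (f ζ).im) :
    DifferentiableOn ℂ (fun ζ => sqrtKernel l ζ (f ζ)) {ζ | 0 < ζ.im} := fun ζ hζ =>
  (differentiableWithinAt_id.neg.sub <| (differentiableWithinAt_const (l : ℂ)).mul <|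
    (differentiableAt_ratioMap <| one_sub_sq_ne_zero_of_im_pos <|
      hpos ζ hζ).comp_differentiableWithinAt ζ (hf ζ hζ)).inv
    (sqrtKernel_denom_ne_zero hl hζ (hpos ζ hζ).le)

theorem continuousAt_sqrtKernel (hl : 0 ≤ l) (hζ : 0 < ζ.im) (hm : 0 ≤ m.im)
    (hm' : 1 - m ^ 2 ≠ 0) : ContinuousAt (sqrtKernel l ζ) m :=
  (continuousAt_const.sub
    (continuousAt_const.mul (differentiableAt_ratioMap hm').continuousAt)).inv₀
    (sqrtKernel_denom_ne_zero hl hζ hm)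

theorem IsAtomicTransform.sqrtKernel {P : ℝ} {m : ℂ → ℂ} (hm : IsAtomicTransform P m)
    (hl : 0 ≤ l) : IsAtomicTransform 1 (fun ζ => sqrtKernel l ζ (m ζ)) :=
  (hm.ratioMap.const_mul hl).inv_neg_sub

end sqrtKernel

section sqrtMap

variable {ι : Type*} [Fintype ι] {l : ι → ℝ} {c : ℝ} {ζ m n : ℂ}

/-- The canonical equation in the variables `ζ = √z` and `m = ζ c t` reads `m = sqrtMap l c ζ m`,
where `l` lists the eigenvalues of the matrix. -/
def sqrtMap (l : ι → ℝ) (c : ℝ) (ζ m : ℂ) : ℂ := c * 𝔼 k, l k * sqrtKernel (l k) ζ m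

/-- The factor by which `sqrtMap` dilates the imaginary part of `ratioMap m`, up to the
contribution of `ζ`. -/
def sqrtGain (l : ι → ℝ) (c : ℝ) (ζ m : ℂ) : ℝ := c * 𝔼 k, (l k * ‖sqrtKernel (l k) ζ m‖) ^ 2

theorem sqrtGain_nonneg (hc : 0 ≤ c) (l : ι → ℝ) (ζ m : ℂ) : 0 ≤ sqrtGain l c ζ m :=
  mul_nonneg hc (Finset.expect_nonneg fun _ _ => sq_nonneg _)

theorem im_sqrtMap (l : ι → ℝ) (c : ℝ) (ζ m : ℂ) :
    (sqrtMap l c ζ m).im = c * 𝔼 k, l k * ‖sqrtKernel (l k) ζ m‖ ^ 2 * ζ.im +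
      sqrtGain l c ζ m * (ratioMap m).im := by
  rw [sqrtMap, sqrtGain, Complex.im_ofReal_mul, Complex.im_expect, mul_assoc, Finset.expect_mul,
    ← mul_add, ← Finset.expect_add_distrib]
  congr 1
  refine Finset.expect_congr rfl fun k _ => ?_
  rw [Complex.im_ofReal_mul, im_sqrtKernel]
  ring

theorem sqrtMap_sub (c : ℝ) (hl : ∀ k, 0 ≤ l k) (hζ : 0 < ζ.im) (hm : 0 ≤ m.im) (hn : 0 ≤ n.im) :
    sqrtMap l c ζ m - sqrtMap l c ζ n = (ratioMap m - ratioMap n) *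
      (c * 𝔼 k, (l k : ℂ) ^ 2 * sqrtKernel (l k) ζ m * sqrtKernel (l k) ζ n) := by
  rw [sqrtMap, sqrtMap, ← mul_sub, ← Finset.expect_sub_distrib, mul_left_comm]
  congr 1
  rw [Finset.mul_expect]
  refine Finset.expect_congr rfl fun k _ => ?_
  rw [← mul_sub, sqrtKernel_sub (hl k) hζ hm hn]
  ring

theorem sqrtMap_neg_conj (l : ι → ℝ) (c : ℝ) (ζ m : ℂ) :
    sqrtMap l c (-(starRingEnd ℂ) ζ) (-(starRingEnd ℂ) m) = -(starRingEnd ℂ) (sqrtMap l c ζ m) := by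
  simp only [sqrtMap, sqrtKernel_neg_conj, map_mul, map_expect, Complex.conj_ofReal, mul_neg,
    Finset.expect_neg_distrib]

theorem norm_expect_sq_le_sqrtGain_mul (hc : 0 ≤ c) (hl : ∀ k, 0 ≤ l k) (ζ m n : ℂ) :
    ‖(c : ℂ) * 𝔼 k, (l k : ℂ) ^ 2 * sqrtKernel (l k) ζ m * sqrtKernel (l k) ζ n‖ ^ 2 ≤
      sqrtGain l c ζ m * sqrtGain l c ζ n := by
  have htri : ‖(c : ℂ) * 𝔼 k, (l k : ℂ) ^ 2 * sqrtKernel (l k) ζ m * sqrtKernel (l k) ζ n‖ ≤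
      c * 𝔼 k, (l k * ‖sqrtKernel (l k) ζ m‖) * (l k * ‖sqrtKernel (l k) ζ n‖) := by
    rw [norm_mul, Complex.norm_of_nonneg hc]
    refine mul_le_mul_of_nonneg_left ((RCLike.norm_expect_le (K := ℂ)).trans_eq <|
      Finset.expect_congr rfl fun k _ => ?_) hc
    rw [norm_mul, norm_mul, norm_pow, Complex.norm_of_nonneg (hl k)]
    ring
  refine (pow_le_pow_left₀ (norm_nonneg _) htri 2).trans ?_
  rw [sqrtGain, sqrtGain, mul_pow, mul_mul_mul_comm, ← sq]
  exact mul_le_mul_of_nonneg_left (Finset.expect_mul_sq_le_sq_mul_sq _ _ _) (sq_nonneg c)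

theorem norm_sqrtMap_le [Nonempty ι] (hc : 0 ≤ c) (hl : ∀ k, 0 ≤ l k) (hζ : 0 < ζ.im)
    (hm : 0 ≤ m.im) : ‖sqrtMap l c ζ m‖ ≤ (c * 𝔼 k, l k) / ζ.im := by
  rw [sqrtMap, norm_mul, Complex.norm_of_nonneg hc, mul_div_assoc, Finset.expect_div]
  refine mul_le_mul_of_nonneg_left ((RCLike.norm_expect_le (K := ℂ)).trans ?_) hc
  refine Finset.expect_le_expect fun k _ => ?_
  rw [norm_mul, Complex.norm_of_nonneg (hl k), div_eq_mul_inv]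
  exact mul_le_mul_of_nonneg_left (norm_sqrtKernel_le (hl k) hζ hm) (hl k)

theorem im_sqrtMap_nonneg (hc : 0 ≤ c) (hl : ∀ k, 0 ≤ l k) (hζ : 0 < ζ.im) (hm : 0 ≤ m.im) :
    0 ≤ (sqrtMap l c ζ m).im := by
  rw [im_sqrtMap]
  refine add_nonneg (mul_nonneg hc (Finset.expect_nonneg fun k _ => ?_))
    (mul_nonneg (sqrtGain_nonneg hc l ζ m) (im_ratioMap_nonneg hm))
  have := hl k
  positivity

theorem sqrtGain_mul_ratioGain_lt_one [Nonempty ι] (hc : 0 < c) (hl : ∀ k, 0 < l k) (hζ : 0 < ζ.im)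
    (hm : 0 < m.im) (h : m = sqrtMap l c ζ m) : sqrtGain l c ζ m * ratioGain m < 1 := by
  have hpos : 0 < c * 𝔼 k, l k * ‖sqrtKernel (l k) ζ m‖ ^ 2 * ζ.im := by
    refine mul_pos hc (Finset.expect_pos (fun k _ => ?_) Finset.univ_nonempty)
    have := norm_pos_iff.2 (sqrtKernel_ne_zero (hl k).le hζ hm.le)
    have := hl k
    positivity
  have him := im_sqrtMap l c ζ m
  rw [← h, im_ratioMap] at him
  refine lt_of_mul_lt_mul_left ?_ hm.le
  linarith

theorem sqrtMap_unique [Nonempty ι] (hc : 0 < c) (hl : ∀ k, 0 < l k) (hζ : 0 < ζ.im)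
    (hm : 0 < m.im) (hn : 0 < n.im) (h : m = sqrtMap l c ζ m) (h' : n = sqrtMap l c ζ n) :
    m = n := by
  by_contra hne
  have hsub := sqrtMap_sub c (fun k => (hl k).le) hζ hm.le hn.le
  rw [← h, ← h', ratioMap_sub (one_sub_ne_zero_of_im_pos hm) (one_add_ne_zero_of_im_pos hm)
    (one_sub_ne_zero_of_im_pos hn) (one_add_ne_zero_of_im_pos hn), mul_assoc] at hsub
  have hone := (mul_eq_left₀ (sub_ne_zero.2 hne)).1 hsub.symm
  have hgain := mul_lt_one_of_nonneg_of_lt_one_left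
    (mul_nonneg (sqrtGain_nonneg hc.le l ζ m) (ratioGain_nonneg m))
    (sqrtGain_mul_ratioGain_lt_one hc hl hζ hm h)
    (sqrtGain_mul_ratioGain_lt_one hc hl hζ hn h').le
  have hprod := mul_le_mul (norm_ratioMap_slope_sq_le m n)
    (norm_expect_sq_le_sqrtGain_mul hc.le (fun k => (hl k).le) ζ m n) (sq_nonneg _)
    (mul_nonneg (ratioGain_nonneg m) (ratioGain_nonneg n))
  rw [← mul_pow, ← norm_mul, hone, norm_one] at hprod
  linarith

theorem IsAtomicTransform.exists_sqrtMap {P : ℝ} {m : ℂ → ℂ} (hm : IsAtomicTransform P m)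
    (hc : 0 ≤ c) (hl : ∀ k, 0 ≤ l k) : ∃ Q, IsAtomicTransform Q fun ζ => sqrtMap l c ζ (m ζ) := by
  have hsum := IsAtomicTransform.sum Finset.univ fun k (_ : k ∈ Finset.univ) =>
    (hm.sqrtKernel (hl k)).const_mul (hl k)
  refine ⟨_, (hsum.const_mul (r := c / Fintype.card ι) (by positivity)).congr fun ζ _ => ?_⟩
  rw [sqrtMap, Fintype.expect_eq_sum_div_card]
  push_cast
  ring

theorem exists_isAtomicTransform_iterate_sqrtMap (hc : 0 ≤ c) (hl : ∀ k, 0 ≤ l k) (j : ℕ) :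
    ∃ P, IsAtomicTransform P fun ζ => (sqrtMap l c ζ)^[j] 0 := by
  induction j with
  | zero => exact ⟨0, IsAtomicTransform.zero⟩
  | succ j ih =>
    obtain ⟨P, hP⟩ := ih
    simpa only [Function.iterate_succ_apply'] using hP.exists_sqrtMap hc hl

theorem norm_inv_le_two {z : ℂ} (hz : 1 / 2 ≤ ‖z‖) : ‖z⁻¹‖ ≤ 2 := by
  rw [norm_inv]
  exact (inv_anti₀ one_half_pos hz).trans_eq (by norm_num)

theorem half_le_norm_one_sub (hm : ‖m‖ ≤ 1 / 2) : 1 / 2 ≤ ‖1 - m‖ := by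
  have := norm_sub_norm_le 1 m
  rw [norm_one] at this
  linarith

theorem half_le_norm_one_add (hm : ‖m‖ ≤ 1 / 2) : 1 / 2 ≤ ‖1 + m‖ := by
  rw [← sub_neg_eq_add]
  exact half_le_norm_one_sub (by rwa [norm_neg])

theorem ratioGain_le_four (hm : ‖m‖ ≤ 1 / 2) : ratioGain m ≤ 4 := by
  have h₁ := pow_le_pow_left₀ (norm_nonneg _) (norm_inv_le_two (half_le_norm_one_sub hm)) 2
  have h₂ := pow_le_pow_left₀ (norm_nonneg _) (norm_inv_le_two (half_le_norm_one_add hm)) 2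
  rw [ratioGain]
  linarith

theorem sqrtGain_le (hc : 0 ≤ c) (hl : ∀ k, 0 ≤ l k) (hζ : 0 < ζ.im) (hm : 0 ≤ m.im) :
    sqrtGain l c ζ m ≤ (c * 𝔼 k, l k ^ 2) / ζ.im ^ 2 := by
  rw [sqrtGain, mul_div_assoc, Finset.expect_div]
  refine mul_le_mul_of_nonneg_left (Finset.expect_le_expect fun k _ => ?_) hc
  rw [div_eq_mul_inv, ← inv_pow, ← mul_pow]
  have := norm_sqrtKernel_le (hl k) hζ hm
  have := hl k
  gcongr

theorem norm_sqrtMap_sub_le (hc : 0 ≤ c) (hl : ∀ k, 0 ≤ l k) (hζ : 0 < ζ.im)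
    (hm : 0 ≤ m.im) (hn : 0 ≤ n.im) (hm₂ : ‖m‖ ≤ 1 / 2) (hn₂ : ‖n‖ ≤ 1 / 2) :
    ‖sqrtMap l c ζ m - sqrtMap l c ζ n‖ ≤ 4 * ((c * 𝔼 k, l k ^ 2) / ζ.im ^ 2) * ‖m - n‖ := by
  have hE : 0 ≤ (c * 𝔼 k, l k ^ 2) / ζ.im ^ 2 :=
    (sqrtGain_nonneg hc l ζ m).trans (sqrtGain_le hc hl hζ hm)
  have ne {z : ℂ} (hz : 1 / 2 ≤ ‖z‖) : z ≠ 0 := norm_pos_iff.1 (one_half_pos.trans_le hz)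
  have hslope := (norm_ratioMap_slope_sq_le m n).trans <|
    mul_le_mul (ratioGain_le_four hm₂) (ratioGain_le_four hn₂) (ratioGain_nonneg n) (by norm_num)
  have hkernel := (norm_expect_sq_le_sqrtGain_mul hc hl ζ m n).trans <|
    mul_le_mul (sqrtGain_le hc hl hζ hm) (sqrtGain_le hc hl hζ hn) (sqrtGain_nonneg hc l ζ n) hE
  rw [← sq] at hslope hkernel
  rw [sqrtMap_sub c hl hζ hm hn, ratioMap_sub (ne (half_le_norm_one_sub hm₂))
    (ne (half_le_norm_one_add hm₂)) (ne (half_le_norm_one_sub hn₂))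
    (ne (half_le_norm_one_add hn₂)), mul_assoc, norm_mul, norm_mul, mul_comm]
  exact mul_le_mul_of_nonneg_right (mul_le_mul (le_of_sq_le_sq hslope (by norm_num))
    (le_of_sq_le_sq hkernel hE) (norm_nonneg _) (by norm_num)) (norm_nonneg _)

theorem exists_tendsto_iterate_sqrtMap [Nonempty ι] (hc : 0 ≤ c) (hl : ∀ k, 0 ≤ l k) :
    ∃ Y : ℝ, 0 < Y ∧ ∀ ζ : ℂ, Y < ζ.im → ∃ m : ℂ, 0 ≤ m.im ∧ ‖m‖ ≤ 1 / 2 ∧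
      m = sqrtMap l c ζ m ∧ Tendsto (fun j => (sqrtMap l c ζ)^[j] 0) atTop (𝓝 m) := by
  have hC₁ : 0 ≤ c * 𝔼 k, l k := mul_nonneg hc (Finset.expect_nonneg fun k _ => hl k)
  have hC₂ : 0 ≤ c * 𝔼 k, l k ^ 2 := mul_nonneg hc (Finset.expect_nonneg fun k _ => sq_nonneg _)
  refine ⟨1 + 2 * (c * 𝔼 k, l k) + 8 * (c * 𝔼 k, l k ^ 2), by positivity, fun ζ hY => ?_⟩
  have hζ : 0 < ζ.im := by linarith
  let s : Set ℂ := {m | 0 ≤ m.im ∧ ‖m‖ ≤ 1 / 2}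
  have hs : IsComplete s := ((isClosed_le continuous_const Complex.continuous_im).inter
    (isClosed_le continuous_norm continuous_const)).isComplete
  have hmaps : Set.MapsTo (sqrtMap l c ζ) s s := fun m hm =>
    ⟨im_sqrtMap_nonneg hc hl hζ hm.1, (norm_sqrtMap_le hc hl hζ hm.1).trans <| by
      rw [div_le_iff₀ hζ]
      linarith⟩
  have hcontr : ContractingWith (1 / 2) (hmaps.restrict (sqrtMap l c ζ) s s) := by
    refine ⟨by norm_num, LipschitzWith.of_dist_le_mul fun m n => ?_⟩
    rw [Subtype.dist_eq, Subtype.dist_eq, dist_eq_norm, dist_eq_norm]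
    refine (norm_sqrtMap_sub_le hc hl hζ m.2.1 n.2.1 m.2.2 n.2.2).trans ?_
    refine mul_le_mul_of_nonneg_right ?_ (norm_nonneg _)
    rw [← mul_div_assoc, div_le_iff₀ (by positivity)]
    push_cast
    nlinarith
  obtain ⟨m, hm, hfix, hlim, -⟩ :=
    hcontr.exists_fixedPoint' hs hmaps (x := 0) ⟨le_rfl, by norm_num⟩ (edist_ne_top _ _)
  exact ⟨m, hm.1, hm.2, hfix.symm, hlim⟩

end sqrtMap

theorem im_stieltjes (σ : Measure ℝ) [IsFiniteMeasure σ] {ζ : ℂ} (hζ : 0 < ζ.im) :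
    (stieltjes σ ζ).im = ∫ y : ℝ, (((y : ℂ) - ζ)⁻¹).im ∂σ := by
  rw [stieltjes_eq_integral]
  exact (integral_im (integrable_inv_ofReal_sub σ hζ)).symm

theorem im_stieltjes_pos (σ : Measure ℝ) [IsFiniteMeasure σ] (hσ : σ ≠ 0) {ζ : ℂ}
    (hζ : 0 < ζ.im) : 0 < (stieltjes σ ζ).im := by
  have hpos (y : ℝ) : 0 < (((y : ℂ) - ζ)⁻¹).im := im_inv_ofReal_sub_pos y hζ
  rw [im_stieltjes σ hζ]
  refine (integral_pos_iff_support_of_nonneg (fun y => (hpos y).le)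
    (integrable_inv_ofReal_sub σ hζ).im).2 ?_
  rw [Set.eq_univ_of_forall fun y => Function.mem_support.2 (hpos y).ne']
  exact Measure.measure_univ_pos.2 hσ

theorem differentiableOn_stieltjes (σ : Measure ℝ) [IsFiniteMeasure σ] :
    DifferentiableOn ℂ (stieltjes σ) {ζ : ℂ | 0 < ζ.im} := by
  intro ζ hζ
  refine (hasDerivAt_resolventTransform ζ ?_).differentiableAt.differentiableWithinAt
  rintro ⟨x, -, rfl⟩
  exact lt_irrefl (0 : ℝ) hζ

section sqrtMeasures

variable {ι : Type*} [Fintype ι] [Nonempty ι] {l : ι → ℝ} {c : ℝ}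

theorem exists_measures_stieltjes_eq_sqrtKernel_high (hc : 0 < c) (hl : ∀ k, 0 < l k) :
    ∃ σ : ι → Measure ℝ, (∀ k, IsFiniteMeasure (σ k)) ∧ ∃ Y : ℝ, 0 < Y ∧ ∀ ζ : ℂ, Y < ζ.im →
      ∃ m : ℂ, 0 ≤ m.im ∧ m = sqrtMap l c ζ m ∧
        ∀ k, stieltjes (σ k) ζ = sqrtKernel (l k) ζ m := by
  have hiter (j : ℕ) : ∃ P, IsAtomicTransform P fun ζ => (sqrtMap l c ζ)^[j] 0 :=
    exists_isAtomicTransform_iterate_sqrtMap hc.le (fun k => (hl k).le) j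
  choose P hP using hiter
  choose μ hμ using fun k j => ((hP j).sqrtKernel (hl k).le).exists_probabilityMeasure
  choose σ hσ hlimσ using fun k => exists_tendsto_stieltjes (hyperfilter ℕ) (μ k)
  obtain ⟨Y, hY, hhigh⟩ := exists_tendsto_iterate_sqrtMap hc.le fun k => (hl k).le
  refine ⟨σ, hσ, Y, hY, fun ζ hYζ => ?_⟩
  have hζ : 0 < ζ.im := hY.trans hYζ
  obtain ⟨m, hm, hm₂, hfix, hlim⟩ := hhigh ζ hYζ
  have hm' : 1 - m ^ 2 ≠ 0 := by
    intro h
    have hnorm := congrArg (‖·‖) (sub_eq_zero.1 h).symm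
    simp only [norm_pow, norm_one] at hnorm
    nlinarith [norm_nonneg m]
  refine ⟨m, hm, hfix, fun k => ?_⟩
  have hlimK := (continuousAt_sqrtKernel (hl k).le hζ hm hm').tendsto.comp hlim
  refine tendsto_nhds_unique (hlimσ k ζ hζ) ?_
  simp only [hμ _ _ ζ hζ]
  exact hlimK.mono_left Nat.hyperfilter_le_atTop

theorem eqOn_im_pos_of_eqOn_im_gt {f g : ℂ → ℂ} {Y : ℝ} (hY : 0 ≤ Y)
    (hf : DifferentiableOn ℂ f {ζ | 0 < ζ.im}) (hg : DifferentiableOn ℂ g {ζ | 0 < ζ.im})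
    (hfg : Set.EqOn f g {ζ | Y < ζ.im}) : Set.EqOn f g {ζ | 0 < ζ.im} := by
  have hopen := UpperHalfPlane.isOpen_upperHalfPlaneSet
  have hmem : Y < ((Y + 1 : ℝ) * Complex.I).im := by
    rw [Complex.im_ofReal_mul, Complex.I_im]
    linarith
  exact (hf.analyticOnNhd hopen).eqOn_of_preconnected_of_eventuallyEq (hg.analyticOnNhd hopen)
    (convex_halfSpace_im_gt 0).isPreconnected (hY.trans_lt hmem)
    (hfg.eventuallyEq_of_mem ((isOpen_lt continuous_const Complex.continuous_im).mem_nhds hmem))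

theorem exists_measures_stieltjes_eq_sqrtKernel (hc : 0 < c) (hl : ∀ k, 0 < l k) :
    ∃ σ : ι → Measure ℝ, (∀ k, IsFiniteMeasure (σ k)) ∧ ∀ ζ : ℂ, 0 < ζ.im →
      ∃ m : ℂ, 0 < m.im ∧ m = sqrtMap l c ζ m ∧
        ∀ k, stieltjes (σ k) ζ = sqrtKernel (l k) ζ m := by
  obtain ⟨σ, hσ, Y, hY, hhigh⟩ := exists_measures_stieltjes_eq_sqrtKernel_high hc hl
  let m (ζ : ℂ) : ℂ := c * 𝔼 k, l k * stieltjes (σ k) ζ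
  have hhigh' (ζ : ℂ) (hζ : Y < ζ.im) :
      0 ≤ (m ζ).im ∧ ∀ k, stieltjes (σ k) ζ = sqrtKernel (l k) ζ (m ζ) := by
    obtain ⟨m₀, hm₀, hfix, hS⟩ := hhigh ζ hζ
    have hm : m ζ = m₀ := by simpa only [m, hS, sqrtMap] using hfix.symm
    rw [hm]
    exact ⟨hm₀, hS⟩
  let ζ₀ : ℂ := (Y + 1 : ℝ) * Complex.I
  have hζ₀ : Y < ζ₀.im := by
    rw [Complex.im_ofReal_mul, Complex.I_im]
    linarith
  have hσ₀ (k) : σ k ≠ 0 := by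
    intro h
    obtain ⟨hm, hS⟩ := hhigh' ζ₀ hζ₀
    refine sqrtKernel_ne_zero (hl k).le (hY.trans hζ₀) hm ?_
    rw [← hS k, h, stieltjes_eq_integral, integral_zero_measure]
  have hmpos (ζ : ℂ) (hζ : 0 < ζ.im) : 0 < (m ζ).im := by
    rw [Complex.im_ofReal_mul, Complex.im_expect]
    refine mul_pos hc (Finset.expect_pos (fun k _ => ?_) Finset.univ_nonempty)
    rw [Complex.im_ofReal_mul]
    exact mul_pos (hl k) (im_stieltjes_pos _ (hσ₀ k) hζ)
  have hdm : DifferentiableOn ℂ m {ζ | 0 < ζ.im} := by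
    simp only [m, Fintype.expect_eq_sum_div_card]
    exact ((DifferentiableOn.fun_sum fun k _ =>
      (differentiableOn_stieltjes (σ k)).const_mul _).div_const _).const_mul _
  have hS (k) : Set.EqOn (stieltjes (σ k)) (fun ζ => sqrtKernel (l k) ζ (m ζ))
      {ζ | 0 < ζ.im} :=
    eqOn_im_pos_of_eqOn_im_gt hY.le (differentiableOn_stieltjes (σ k))
      (differentiableOn_sqrtKernel hdm (hl k).le hmpos) fun ζ hζ => (hhigh' ζ hζ).2 k
  refine ⟨σ, hσ, fun ζ hζ => ⟨m ζ, hmpos ζ hζ, ?_, fun k => hS k hζ⟩⟩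
  rw [sqrtMap]
  simp only [← hS _ hζ, m]

end sqrtMeasures

/-- The eigenvalue of `resolventT R c z t` attached to the eigenvalue `l` of `R`. -/
def resolventEigenvalue (l c : ℝ) (z t : ℂ) : ℂ :=
  (-z - z * c * t / (1 - z * c ^ 2 * t ^ 2) * l)⁻¹

/-- The canonical equation `IsCanonicalSolution` expressed through the eigenvalues `l` of the
matrix. -/
def IsScalarSolution {ι : Type*} [Fintype ι] (l : ι → ℝ) (c : ℝ) (z t : ℂ) : Prop :=
  0 < t.im ∧ 0 < (z * t).im ∧ t = 𝔼 k, l k * resolventEigenvalue (l k) c z t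

theorem exists_sqrt_mem_quadrant {z : ℂ} (hz : 0 < z.im) :
    ∃ ζ : ℂ, ζ ^ 2 = z ∧ 0 < ζ.im ∧ 0 < ζ.re := by
  obtain ⟨w, rfl⟩ := IsAlgClosed.exists_pow_nat_eq z two_pos
  have hmul : 0 < w.re * w.im := by
    rw [sq, Complex.mul_im] at hz
    linarith
  rcases pos_and_pos_or_neg_and_neg_of_mul_pos hmul with ⟨hre, him⟩ | ⟨hre, him⟩
  · exact ⟨w, rfl, him, hre⟩
  · exact ⟨-w, neg_sq w, by simpa using him, by simpa using hre⟩

section Stieltjes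

theorem stieltjes_map_sq (σ : Measure ℝ) [IsFiniteMeasure σ] {ζ : ℂ} (hζ : 0 < ζ.im)
    (hre : 0 < ζ.re)
    (hsymm : stieltjes σ (-(starRingEnd ℂ) ζ) = -(starRingEnd ℂ) (stieltjes σ ζ)) :
    stieltjes (σ.map (· ^ 2)) (ζ ^ 2) = stieltjes σ ζ / ζ := by
  have hζ₀ : ζ ≠ 0 := fun h => hζ.ne' (by rw [h, Complex.zero_im])
  have hsq : 0 < (ζ ^ 2).im := by
    rw [sq, Complex.mul_im]
    positivity
  have hζ' : 0 < (-(starRingEnd ℂ) ζ).im := by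
    rwa [Complex.neg_im, Complex.conj_im, neg_neg]
  have hconj (y : ℝ) :
      ((y : ℂ) + ζ)⁻¹ = (starRingEnd ℂ) (((y : ℂ) - -(starRingEnd ℂ) ζ)⁻¹) := by
    rw [map_inv₀, map_sub, map_neg, Complex.conj_conj, Complex.conj_ofReal, sub_neg_eq_add]
  have hplus : ∫ y : ℝ, ((y : ℂ) + ζ)⁻¹ ∂σ = -stieltjes σ ζ := by
    simp only [hconj]
    rw [integral_conj, ← stieltjes_eq_integral, hsymm, map_neg, Complex.conj_conj]
  have hint : Integrable (fun y : ℝ => ((y : ℂ) + ζ)⁻¹) σ := by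
    simp only [hconj]
    exact Complex.conjCLE.integrable_comp_iff.2 (integrable_inv_ofReal_sub σ hζ')
  have hsplit (y : ℝ) : (((y ^ 2 : ℝ) : ℂ) - ζ ^ 2)⁻¹ =
      (2 * ζ)⁻¹ * (((y : ℂ) - ζ)⁻¹ - ((y : ℂ) + ζ)⁻¹) := by
    have h₁ := ofReal_sub_ne_zero y hζ
    have h₂ : (y : ℂ) + ζ ≠ 0 := by
      rw [← sub_neg_eq_add, ← neg_ne_zero, neg_sub', ← Complex.ofReal_neg]
      simpa using ofReal_sub_ne_zero (-y) hζ
    rw [Complex.ofReal_pow, sq_sub_sq]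
    field_simp
    ring
  rw [stieltjes_eq_integral, integral_map (by fun_prop)
    (continuous_inv_ofReal_sub hsq).aestronglyMeasurable]
  simp only [hsplit]
  rw [integral_const_mul, integral_sub (integrable_inv_ofReal_sub σ hζ) hint, hplus,
    ← stieltjes_eq_integral]
  field_simp
  ring

theorem im_mul_stieltjes_nonneg (τ : Measure ℝ) [IsFiniteMeasure τ] (hτ : τ (Set.Iio 0) = 0)
    {z : ℂ} (hz : 0 < z.im) : 0 ≤ (z * stieltjes τ z).im := by
  rw [stieltjes_eq_integral, ← integral_const_mul]
  refine le_of_le_of_eq ?_ (integral_im ((integrable_inv_ofReal_sub τ hz).const_mul z))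
  have hnonneg : ∀ᵐ y ∂τ, (0 : ℝ) ≤ y := by
    rwa [ae_iff, show {y : ℝ | ¬0 ≤ y} = Set.Iio 0 from Set.ext fun _ => not_le]
  refine integral_nonneg_of_ae (hnonneg.mono fun y hy => ?_)
  have hkernel : z * ((y : ℂ) - z)⁻¹ = y * ((y : ℂ) - z)⁻¹ - 1 := by
    have := ofReal_sub_ne_zero y hz
    field_simp
    ring
  change 0 ≤ (z * ((y : ℂ) - z)⁻¹).im
  rw [hkernel, Complex.sub_im, Complex.im_ofReal_mul, Complex.one_im, sub_zero]
  exact mul_nonneg hy (im_inv_ofReal_sub_pos y hz).le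

theorem exists_measure_stieltjes_eq_expect {ι : Type*} [Fintype ι] (τ : ι → Measure ℝ)
    [∀ k, IsFiniteMeasure (τ k)] (hτ : ∀ k, τ k (Set.Iio 0) = 0) {r : ι → ℝ} (hr : ∀ k, 0 ≤ r k) :
    ∃ ρ : Measure ℝ, IsFiniteMeasure ρ ∧ ρ (Set.Iio 0) = 0 ∧
      ∀ z : ℂ, 0 < z.im → stieltjes ρ z = 𝔼 k, r k * stieltjes (τ k) z := by
  let s (k : ι) : NNReal := ⟨r k / Fintype.card ι, div_nonneg (hr k) (Nat.cast_nonneg _)⟩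
  refine ⟨∑ k, s k • τ k, inferInstance, ?_, fun z hz => ?_⟩
  · simp [Measure.finsetSum_apply, hτ]
  rw [stieltjes_eq_integral, integral_finsetSum_measure fun k _ => integrable_inv_ofReal_sub _ hz,
    Fintype.expect_eq_sum_div_card, Finset.sum_div]
  refine Finset.sum_congr rfl fun k _ => ?_
  rw [integral_smul_nnreal_measure, NNReal.smul_def, Complex.real_smul, ← stieltjes_eq_integral]
  rw [show (s k : ℝ) = r k / Fintype.card ι from rfl, Complex.ofReal_div, Complex.ofReal_natCast]
  ring

end Stieltjes

section IsScalarSolution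

variable {ι : Type*} [Fintype ι] {l : ι → ℝ} {c : ℝ}

theorem resolventEigenvalue_sq (l c : ℝ) (ζ t : ℂ) :
    resolventEigenvalue l c (ζ ^ 2) t = sqrtKernel l ζ (ζ * c * t) / ζ := by
  have h : ζ ^ 2 * c ^ 2 * t ^ 2 = (ζ * c * t) ^ 2 := by ring
  rw [resolventEigenvalue, sqrtKernel, ratioMap, h, div_eq_mul_inv _ ζ, ← mul_inv]
  congr 1
  ring

theorem mul_expect_resolventEigenvalue_sq (l : ι → ℝ) (c : ℝ) {ζ : ℂ} (hζ : ζ ≠ 0) (t : ℂ) :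
    ζ * c * 𝔼 k, l k * resolventEigenvalue (l k) c (ζ ^ 2) t = sqrtMap l c ζ (ζ * c * t) := by
  rw [sqrtMap, Finset.mul_expect, Finset.mul_expect]
  refine Finset.expect_congr rfl fun k _ => ?_
  rw [resolventEigenvalue_sq]
  field_simp

theorem im_mul_pos_of_im_sq_mul_pos {ζ t : ℂ} (hre : 0 < ζ.re) (ht : 0 < t.im)
    (hzt : 0 < (ζ ^ 2 * t).im) : 0 < (ζ * t).im := by
  have hid : (ζ ^ 2 * t).im + Complex.normSq ζ * t.im = 2 * ζ.re * (ζ * t).im := by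
    simp only [sq, Complex.normSq_apply, Complex.mul_im, Complex.mul_re]
    ring
  have hnonneg := mul_nonneg (Complex.normSq_nonneg ζ) ht.le
  have hpos : 0 < 2 * ζ.re * (ζ * t).im := by linarith
  exact pos_of_mul_pos_right hpos (by positivity)

theorem IsScalarSolution.unique [Nonempty ι] (hc : 0 < c) (hl : ∀ k, 0 < l k) {z t s : ℂ}
    (hz : 0 < z.im) (ht : IsScalarSolution l c z t) (hs : IsScalarSolution l c z s) : t = s := by
  obtain ⟨ζ, rfl, hζ, hre⟩ := exists_sqrt_mem_quadrant hz
  have hζ₀ : ζ ≠ 0 := fun h => hζ.ne' (by rw [h, Complex.zero_im])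
  have hc₀ : (c : ℂ) ≠ 0 := Complex.ofReal_ne_zero.2 hc.ne'
  have him {u : ℂ} (hu : IsScalarSolution l c (ζ ^ 2) u) : 0 < (ζ * c * u).im := by
    rw [mul_right_comm, mul_comm, Complex.im_ofReal_mul]
    exact mul_pos hc (im_mul_pos_of_im_sq_mul_pos hre hu.1 hu.2.1)
  have hfix {u : ℂ} (hu : IsScalarSolution l c (ζ ^ 2) u) :
      ζ * c * u = sqrtMap l c ζ (ζ * c * u) := by
    rw [← mul_expect_resolventEigenvalue_sq l c hζ₀, ← hu.2.2]
  exact mul_left_cancel₀ (mul_ne_zero hζ₀ hc₀)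
    (sqrtMap_unique hc hl hζ (him ht) (him hs) (hfix ht) (hfix hs))

theorem im_mul_sqrtKernel (l : ℝ) {ζ : ℂ} (hζ : ζ ≠ 0) (m : ℂ) :
    (ζ * sqrtKernel l ζ m).im = l * (ratioMap m / ζ).im * ‖ζ * sqrtKernel l ζ m‖ ^ 2 := by
  have h : ζ * sqrtKernel l ζ m = (-1 - l * (ratioMap m / ζ))⁻¹ := by
    rw [sqrtKernel, ← inv_inj, mul_inv, inv_inv, inv_inv]
    field_simp
  rw [h, im_inv, Complex.sub_im, Complex.neg_im, Complex.one_im, Complex.im_ofReal_mul]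
  ring

theorem im_mul_sqrtMap (l : ι → ℝ) (c : ℝ) {ζ : ℂ} (hζ : ζ ≠ 0) (m : ℂ) :
    (ζ * sqrtMap l c ζ m).im =
      (ratioMap m / ζ).im * (c * 𝔼 k, l k ^ 2 * ‖ζ * sqrtKernel (l k) ζ m‖ ^ 2) := by
  rw [sqrtMap, mul_left_comm, Complex.im_ofReal_mul, mul_left_comm _ c]
  congr 1
  rw [Finset.mul_expect, Complex.im_expect, Finset.mul_expect]
  refine Finset.expect_congr rfl fun k _ => ?_
  rw [mul_left_comm, Complex.im_ofReal_mul, im_mul_sqrtKernel _ hζ]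
  ring

theorem ratioMap_div_eq {ζ m : ℂ} (hζ : ζ ≠ 0) (hm : 0 < m.im) :
    ratioMap m / ζ = -(ζ * m) * ((ζ * m) ^ 2 - ζ ^ 2)⁻¹ := by
  have hden : 1 - m ^ 2 ≠ 0 := one_sub_sq_ne_zero_of_im_pos hm
  have hden' : (ζ * m) ^ 2 - ζ ^ 2 = -(ζ ^ 2 * (1 - m ^ 2)) := by ring
  rw [hden', ratioMap, inv_neg, neg_mul_neg, div_div, ← div_eq_mul_inv,
    div_eq_div_iff (mul_ne_zero hden hζ) (mul_ne_zero (pow_ne_zero 2 hζ) hden)]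
  ring

/-- If `ζ * m` were real, then so would be `ratioMap m / ζ`, although `ratioMap m / ζ` is a nonzero
real multiple of the Cauchy kernel of `(ζ * m) ^ 2` at `ζ ^ 2`. -/
theorem im_mul_ne_zero_of_eq_sqrtMap [Nonempty ι] (hc : 0 < c) (hl : ∀ k, 0 < l k) {ζ m : ℂ}
    (hζ : 0 < ζ.im) (hsq : 0 < (ζ ^ 2).im) (hm : 0 < m.im) (hfix : m = sqrtMap l c ζ m) :
    (ζ * m).im ≠ 0 := by
  have hζ₀ : ζ ≠ 0 := fun h => hζ.ne' (by rw [h, Complex.zero_im])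
  have hm₀ : m ≠ 0 := fun h => hm.ne' (by rw [h, Complex.zero_im])
  have hpos : 0 < c * 𝔼 k, l k ^ 2 * ‖ζ * sqrtKernel (l k) ζ m‖ ^ 2 := by
    refine mul_pos hc (Finset.expect_pos (fun k _ => ?_) Finset.univ_nonempty)
    have := norm_pos_iff.2 (mul_ne_zero hζ₀ (sqrtKernel_ne_zero (hl k).le hζ hm.le))
    have := hl k
    positivity
  intro h₀
  have hreal : ζ * m = ((ζ * m).re : ℂ) := Complex.ext rfl (by rw [h₀, Complex.ofReal_im])
  have him := im_mul_sqrtMap l c hζ₀ m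
  rw [← hfix, h₀, eq_comm] at him
  have hratio := (mul_eq_zero.1 him).resolve_right hpos.ne'
  rw [ratioMap_div_eq hζ₀ hm, hreal, ← Complex.ofReal_neg, Complex.im_ofReal_mul,
    ← Complex.ofReal_pow] at hratio
  have hre := (mul_eq_zero.1 hratio).resolve_right (im_inv_ofReal_sub_pos _ hsq).ne'
  rw [neg_eq_zero.1 hre, Complex.ofReal_zero] at hreal
  exact mul_ne_zero hζ₀ hm₀ hreal

theorem exists_measures_stieltjes_eq_sqrtKernel_div [Nonempty ι] (hc : 0 < c) (hl : ∀ k, 0 < l k) :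
    ∃ τ : ι → Measure ℝ, (∀ k, IsFiniteMeasure (τ k)) ∧ (∀ k, τ k (Set.Iio 0) = 0) ∧
      ∀ z : ℂ, 0 < z.im → ∃ ζ m : ℂ, ζ ^ 2 = z ∧ 0 < ζ.im ∧ 0 < m.im ∧ m = sqrtMap l c ζ m ∧
        ∀ k, stieltjes (τ k) z = sqrtKernel (l k) ζ m / ζ := by
  obtain ⟨σ, hσ, hS⟩ := exists_measures_stieltjes_eq_sqrtKernel hc hl
  refine ⟨fun k => (σ k).map (· ^ 2), fun k => Measure.isFiniteMeasure_map _ _, fun k => ?_,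
    fun z hz => ?_⟩
  · have hempty : (fun y : ℝ => y ^ 2) ⁻¹' Set.Iio 0 = ∅ :=
      Set.eq_empty_of_forall_notMem fun y hy => (sq_nonneg y).not_gt hy
    rw [Measure.map_apply (by fun_prop) measurableSet_Iio, hempty, measure_empty]
  obtain ⟨ζ, rfl, hζ, hre⟩ := exists_sqrt_mem_quadrant hz
  have him_neg_conj (w : ℂ) : (-(starRingEnd ℂ) w).im = w.im := by
    rw [Complex.neg_im, Complex.conj_im, neg_neg]
  have hζ' : 0 < (-(starRingEnd ℂ) ζ).im := (him_neg_conj ζ).symm ▸ hζ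
  obtain ⟨m, hm, hfix, hSm⟩ := hS ζ hζ
  obtain ⟨n, hn, hfixn, hSn⟩ := hS _ hζ'
  have hmn : n = -(starRingEnd ℂ) m :=
    sqrtMap_unique hc hl hζ' hn ((him_neg_conj m).symm ▸ hm) hfixn
      (by rw [sqrtMap_neg_conj, ← hfix])
  refine ⟨ζ, m, rfl, hζ, hm, hfix, fun k => ?_⟩
  rw [← hSm k]
  refine stieltjes_map_sq (σ k) hζ hre ?_
  rw [hSn k, hSm k, hmn, sqrtKernel_neg_conj]

theorem exists_scalar_measures [Nonempty ι] (hc : 0 < c) (hl : ∀ k, 0 < l k) :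
    ∃ μ ν : Measure ℝ, (IsFiniteMeasure μ ∧ μ (Set.Iio 0) = 0) ∧
      (IsFiniteMeasure ν ∧ ν (Set.Iio 0) = 0) ∧ ∀ z : ℂ, 0 < z.im →
        IsScalarSolution l c z (stieltjes μ z) ∧
        stieltjes ν z = 𝔼 k, resolventEigenvalue (l k) c z (stieltjes μ z) := by
  obtain ⟨τ, hτ, hτ₀, hS⟩ := exists_measures_stieltjes_eq_sqrtKernel_div hc hl
  obtain ⟨μ, hμ, hμ₀, hSμ⟩ := exists_measure_stieltjes_eq_expect τ hτ₀ fun k => (hl k).le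
  obtain ⟨ν, hν, hν₀, hSν⟩ :=
    exists_measure_stieltjes_eq_expect τ hτ₀ (r := fun _ => 1) fun _ => zero_le_one
  refine ⟨μ, ν, ⟨hμ, hμ₀⟩, ⟨hν, hν₀⟩, fun z hz => ?_⟩
  obtain ⟨ζ, m, rfl, hζ, hm, hfix, hSτ⟩ := hS z hz
  have hζ₀ : ζ ≠ 0 := fun h => hζ.ne' (by rw [h, Complex.zero_im])
  set t := stieltjes μ (ζ ^ 2) with ht
  have hmt : m = ζ * c * t := by
    rw [ht, hSμ _ hz, Finset.mul_expect]
    conv_lhs => rw [hfix, sqrtMap, Finset.mul_expect]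
    refine Finset.expect_congr rfl fun k _ => ?_
    rw [hSτ]
    field_simp
  have hτt (k) : stieltjes (τ k) (ζ ^ 2) = resolventEigenvalue (l k) c (ζ ^ 2) t := by
    rw [hSτ, resolventEigenvalue_sq, ← hmt]
  refine ⟨⟨?_, ?_, ?_⟩, ?_⟩
  · refine im_stieltjes_pos μ ?_ hz
    rintro rfl
    rw [ht, stieltjes_eq_integral, integral_zero_measure, mul_zero] at hmt
    exact hm.ne' (by rw [hmt, Complex.zero_im])
  · refine (im_mul_stieltjes_nonneg μ hμ₀ hz).lt_of_ne' fun h => ?_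
    refine im_mul_ne_zero_of_eq_sqrtMap hc hl hζ hz hm hfix ?_
    rw [hmt, show ζ * (ζ * c * t) = c * (ζ ^ 2 * t) by ring, Complex.im_ofReal_mul, ht, h, mul_zero]
  · exact (hSμ _ hz).trans (by simp only [hτt])
  · exact (hSν _ hz).trans (by simp only [hτt, Complex.ofReal_one, one_mul])

end IsScalarSolution

section ResolventPoint

variable {c : ℝ} {z t : ℂ}

/-- The point `w = z c t - 1 / (c t)` at which the resolvent of the matrix is evaluated: the
coefficient of the matrix in `resolventT R c z t` is `-z / w`. -/
def resolventPoint (c : ℝ) (z t : ℂ) : ℂ :=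
  z * c * t - (c * t)⁻¹

theorem im_resolventPoint_pos (hc : 0 < c) (ht : 0 < t.im) (hzt : 0 < (z * t).im) :
    0 < (resolventPoint c z t).im := by
  have ht₀ : t⁻¹ ≠ 0 := inv_ne_zero fun h => ht.ne' (by rw [h, Complex.zero_im])
  have him : (resolventPoint c z t).im = c * (z * t).im + c⁻¹ * (t.im * ‖t⁻¹‖ ^ 2) := by
    rw [resolventPoint, mul_right_comm, mul_comm _ (c : ℂ), mul_inv, ← Complex.ofReal_inv,
      Complex.sub_im, Complex.im_ofReal_mul, Complex.im_ofReal_mul, im_inv]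
    ring
  have := norm_pos_iff.2 ht₀
  rw [him]
  positivity

theorem resolvent_coeff_eq_neg_div_resolventPoint (hc : c ≠ 0) (ht : t ≠ 0) :
    z * c * t / (1 - z * c ^ 2 * t ^ 2) = -z / resolventPoint c z t := by
  have hc₀ : (c : ℂ) ≠ 0 := Complex.ofReal_ne_zero.2 hc
  have hw : resolventPoint c z t = -((1 - z * c ^ 2 * t ^ 2) / (c * t)) := by
    rw [resolventPoint]
    field_simp
    ring
  rw [hw, neg_div_neg_eq, div_div_eq_mul_div, mul_assoc]

theorem resolventEigenvalue_eq (l : ℝ) (hc : c ≠ 0) (ht : t ≠ 0) (hw : resolventPoint c z t ≠ 0) :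
    resolventEigenvalue l c z t =
      resolventPoint c z t / z * ((l : ℂ) - resolventPoint c z t)⁻¹ := by
  have hlin : -z - -z / resolventPoint c z t * l =
      z / resolventPoint c z t * ((l : ℂ) - resolventPoint c z t) := by
    field_simp
    ring
  rw [resolventEigenvalue, resolvent_coeff_eq_neg_div_resolventPoint hc ht, hlin, mul_inv, inv_div]

end ResolventPoint

section PhiComplex

variable {ι : Type*} [Fintype ι] {l : ι → ℝ} {c : ℝ}

/-- The normalized trace `(1/M) Tr R (R - w)⁻¹`, expressed through the eigenvalues `l` of `R`. -/
def trResC (l : ι → ℝ) (w : ℂ) : ℂ :=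
  𝔼 k, (l k : ℂ) / (l k - w)

/-- The factor by which `w ↦ c w (1/M) Tr R (R - w)⁻¹` scales imaginary parts. It is less than `1`
exactly where `phiComplex` inverts `resolventPoint`. -/
def contractionRatio (l : ι → ℝ) (c : ℝ) (w : ℂ) : ℝ :=
  c * 𝔼 k, (l k / ‖(l k : ℂ) - w‖) ^ 2

/-- The function `φ` of the complex variable `w`, expressed through the eigenvalues `l`. -/
def phiComplex (l : ι → ℝ) (c : ℝ) (w : ℂ) : ℂ :=
  c * w ^ 2 * trResC l w * (c * trResC l w - 1)

theorem phiComplex_eq (l : ι → ℝ) (c : ℝ) (w : ℂ) :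
    phiComplex l c w = c * (w * trResC l w) * (c * (w * trResC l w) - w) := by
  rw [phiComplex]
  ring

theorem im_ofReal_div_sub (x y : ℝ) (w : ℂ) :
    ((x : ℂ) / (y - w)).im = w.im * (x / ‖(y : ℂ) - w‖ ^ 2) := by
  rw [div_eq_mul_inv, Complex.im_ofReal_mul, im_inv, Complex.sub_im, Complex.ofReal_im, norm_inv,
    inv_pow]
  ring

theorem im_trResC (l : ι → ℝ) (w : ℂ) :
    (trResC l w).im = w.im * 𝔼 k, l k / ‖(l k : ℂ) - w‖ ^ 2 := by
  rw [trResC, Complex.im_expect, Finset.mul_expect]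
  exact Finset.expect_congr rfl fun k _ => im_ofReal_div_sub _ _ _

theorem mul_trResC {w : ℂ} (hw : ∀ k, (l k : ℂ) - w ≠ 0) :
    w * trResC l w = 𝔼 k, (((l k ^ 2 : ℝ) : ℂ) / (l k - w) - l k) := by
  rw [trResC, Finset.mul_expect]
  refine Finset.expect_congr rfl fun k _ => ?_
  have := hw k
  push_cast
  field_simp
  ring

theorem im_mul_trResC (c : ℝ) {w : ℂ} (hw : ∀ k, (l k : ℂ) - w ≠ 0) :
    c * (w * trResC l w).im = w.im * contractionRatio l c w := by
  rw [mul_trResC hw, contractionRatio, mul_left_comm w.im]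
  congr 1
  rw [Complex.im_expect, Finset.mul_expect]
  refine Finset.expect_congr rfl fun k _ => ?_
  rw [Complex.sub_im, im_ofReal_div_sub, Complex.ofReal_im, sub_zero, div_pow]

theorem contractionRatio_pos [Nonempty ι] (hc : 0 < c) (hl : ∀ k, 0 < l k) {w : ℂ}
    (hw : ∀ k, (l k : ℂ) - w ≠ 0) : 0 < contractionRatio l c w := by
  refine mul_pos hc (Finset.expect_pos (fun k _ => ?_) Finset.univ_nonempty)
  exact pow_pos (div_pos (hl k) (norm_pos_iff.2 (hw k))) 2

namespace IsScalarSolution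

variable {z t : ℂ}

theorem resolventEigenvalue_eq (hc : 0 < c) (h : IsScalarSolution l c z t) (x : ℝ) :
    resolventEigenvalue x c z t = resolventPoint c z t / z * ((x : ℂ) - resolventPoint c z t)⁻¹ :=
  AutocovSupport.resolventEigenvalue_eq x hc.ne'
    (fun h₀ => h.1.ne' (by rw [h₀, Complex.zero_im]))
    fun h₀ => (im_resolventPoint_pos hc h.1 h.2.1).ne' (by rw [h₀, Complex.zero_im])

theorem mul_eq (hc : 0 < c) (hz : z ≠ 0) (h : IsScalarSolution l c z t) :
    z * t = resolventPoint c z t * trResC l (resolventPoint c z t) := by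
  conv_lhs => rw [h.2.2]
  rw [trResC, Finset.mul_expect, Finset.mul_expect]
  refine Finset.expect_congr rfl fun k _ => ?_
  rw [h.resolventEigenvalue_eq hc]
  field_simp

theorem phiComplex_resolventPoint (hc : 0 < c) (hz : z ≠ 0) (h : IsScalarSolution l c z t) :
    phiComplex l c (resolventPoint c z t) = z := by
  have hc₀ : (c : ℂ) ≠ 0 := Complex.ofReal_ne_zero.2 hc.ne'
  have ht₀ : t ≠ 0 := fun h₀ => h.1.ne' (by rw [h₀, Complex.zero_im])
  rw [phiComplex_eq, ← h.mul_eq hc hz, resolventPoint]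
  field_simp
  ring

theorem contractionRatio_lt_one (hc : 0 < c) (hz : z ≠ 0) (h : IsScalarSolution l c z t) :
    contractionRatio l c (resolventPoint c z t) < 1 := by
  have hw := im_resolventPoint_pos hc h.1 h.2.1
  have hsub : resolventPoint c z t - c * (z * t) = -((c⁻¹ : ℝ) * t⁻¹) := by
    rw [resolventPoint, mul_inv, Complex.ofReal_inv]
    ring
  have ht₀ : t⁻¹ ≠ 0 := inv_ne_zero fun h₀ => h.1.ne' (by rw [h₀, Complex.zero_im])
  have him : 0 < (resolventPoint c z t - c * (z * t)).im := by
    have := norm_pos_iff.2 ht₀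
    have := h.1
    rw [hsub, Complex.neg_im, Complex.im_ofReal_mul, im_inv, neg_mul, mul_neg, neg_neg]
    positivity
  rw [Complex.sub_im, Complex.im_ofReal_mul, h.mul_eq hc hz,
    im_mul_trResC c fun k => ofReal_sub_ne_zero _ hw, sub_pos] at him
  exact (mul_lt_iff_lt_one_right hw).1 him

theorem mul_expect_resolventEigenvalue [Nonempty ι] (hc : 0 < c) (hz : z ≠ 0)
    (h : IsScalarSolution l c z t) :
    z * 𝔼 k, resolventEigenvalue (l k) c z t = trResC l (resolventPoint c z t) - 1 := by
  rw [trResC, ← Fintype.expect_const (ι := ι) (1 : ℂ), ← Finset.expect_sub_distrib,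
    Finset.mul_expect]
  refine Finset.expect_congr rfl fun k _ => ?_
  have := ofReal_sub_ne_zero (l k) (im_resolventPoint_pos hc h.1 h.2.1)
  rw [h.resolventEigenvalue_eq hc]
  field_simp
  ring

end IsScalarSolution

theorem exists_isScalarSolution_of_contractionRatio_lt_one [Nonempty ι] (hc : 0 < c)
    (hl : ∀ k, 0 < l k) {w : ℂ} (hw : 0 < w.im) (hratio : contractionRatio l c w < 1) :
    ∃ t, IsScalarSolution l c (phiComplex l c w) t ∧ resolventPoint c (phiComplex l c w) t = w := by
  have hc₀ : (c : ℂ) ≠ 0 := Complex.ofReal_ne_zero.2 hc.ne'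
  have hne (k) : (l k : ℂ) - w ≠ 0 := ofReal_sub_ne_zero (l k) hw
  have hGim := im_mul_trResC c hne
  have hG : 0 < (w * trResC l w).im := by
    refine pos_of_mul_pos_right (hGim.symm ▸ ?_) hc.le
    exact mul_pos hw (contractionRatio_pos hc hl hne)
  have hv : 0 < (w - c * (w * trResC l w)).im := by
    rw [Complex.sub_im, Complex.im_ofReal_mul, hGim, sub_pos]
    exact mul_lt_of_lt_one_right hw hratio
  have hphi := phiComplex_eq l c w
  set z := phiComplex l c w
  set G := w * trResC l w with hGdef
  set v := w - c * G with hvdef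
  have hw₀ : w ≠ 0 := fun h => hw.ne' (by rw [h, Complex.zero_im])
  have hG₀ : G ≠ 0 := fun h => hG.ne' (by rw [h, Complex.zero_im])
  have hv₀ : v ≠ 0 := fun h => hv.ne' (by rw [h, Complex.zero_im])
  have hz : z = -(c * G * v) := by rw [hphi, hvdef]; ring
  have ht₀ : -((c⁻¹ : ℝ) * v⁻¹ : ℂ) ≠ 0 := by
    rw [Complex.ofReal_inv]
    exact neg_ne_zero.2 (mul_ne_zero (inv_ne_zero hc₀) (inv_ne_zero hv₀))
  have hpoint : resolventPoint c z (-((c⁻¹ : ℝ) * v⁻¹)) = w := by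
    rw [resolventPoint, hz, Complex.ofReal_inv]
    field_simp
    rw [hvdef]
    ring
  have hzt : z * -((c⁻¹ : ℝ) * v⁻¹) = G := by
    rw [hz, Complex.ofReal_inv]
    field_simp
  refine ⟨-((c⁻¹ : ℝ) * v⁻¹), ⟨?_, hzt.symm ▸ hG, ?_⟩, hpoint⟩
  · have := norm_pos_iff.2 (inv_ne_zero hv₀)
    rw [Complex.neg_im, Complex.im_ofReal_mul, im_inv, neg_mul, mul_neg, neg_neg]
    positivity
  · have hz₀ : z ≠ 0 := hz ▸ neg_ne_zero.2 (mul_ne_zero (mul_ne_zero hc₀ hG₀) hv₀)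
    refine mul_left_cancel₀ hz₀ (hzt.trans ?_)
    rw [hGdef, trResC, Finset.mul_expect, Finset.mul_expect]
    refine Finset.expect_congr rfl fun k _ => ?_
    rw [resolventEigenvalue_eq _ hc.ne' ht₀ (hpoint.symm ▸ hw₀), hpoint]
    field_simp

theorem phiComplex_injOn [Nonempty ι] (hc : 0 < c) (hl : ∀ k, 0 < l k) {w v : ℂ} (hw : 0 < w.im)
    (hv : 0 < v.im) (hwr : contractionRatio l c w < 1) (hvr : contractionRatio l c v < 1)
    (h : phiComplex l c w = phiComplex l c v) (hz : 0 < (phiComplex l c w).im) : w = v := by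
  obtain ⟨t, ht, hwt⟩ := exists_isScalarSolution_of_contractionRatio_lt_one hc hl hw hwr
  obtain ⟨s, hs, hvs⟩ := exists_isScalarSolution_of_contractionRatio_lt_one hc hl hv hvr
  rw [h] at ht hwt hz
  rw [ht.unique hc hl hz hs] at hwt
  exact hwt.symm.trans hvs

end PhiComplex

section Boundary

theorem stieltjes_ofReal_im (τ : Measure ℝ) (x : ℝ) : (stieltjes τ (x : ℂ)).im = 0 := by
  simp only [stieltjes_eq_integral, ← Complex.ofReal_sub, ← Complex.ofReal_inv,
    integral_complex_ofReal, Complex.ofReal_im]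

theorem continuousAt_stieltjes (τ : Measure ℝ) [IsFiniteMeasure τ] {x : ℝ} (hx : x ∉ τ.support) :
    ContinuousAt (stieltjes τ) (x : ℂ) := by
  refine (hasDerivAt_resolventTransform (x : ℂ) ?_).continuousAt
  rintro ⟨y, hy, hxy⟩
  exact hx (Complex.ofReal_injective hxy ▸ hy)

theorem measureReal_Ioc_le_mul_im_stieltjes (τ : Measure ℝ) [IsFiniteMeasure τ] (x : ℝ) {ε : ℝ}
    (hε : 0 < ε) : τ.real (Set.Ioc x (x + ε)) ≤ 2 * ε * (stieltjes τ ⟨x, ε⟩).im := by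
  have hz : 0 < (⟨x, ε⟩ : ℂ).im := hε
  have hker (y : ℝ) : (((y : ℂ) - ⟨x, ε⟩)⁻¹).im = ε / ((y - x) ^ 2 + ε ^ 2) := by
    simp only [Complex.inv_im, Complex.normSq_apply, Complex.sub_re, Complex.sub_im,
      Complex.ofReal_re, Complex.ofReal_im, zero_sub, neg_neg]
    ring
  have hint : ∫ _ in Set.Ioc x (x + ε), (2 * ε)⁻¹ ∂τ ≤ (stieltjes τ ⟨x, ε⟩).im := by
    rw [im_stieltjes τ hz, ← integral_indicator measurableSet_Ioc]
    refine integral_mono ((integrable_const _).indicator measurableSet_Ioc)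
      (integrable_inv_ofReal_sub τ hz).im (Set.indicator_le' (fun y hy => ?_) fun y _ => ?_)
    · have hsq : (y - x) ^ 2 ≤ ε ^ 2 :=
        pow_le_pow_left₀ (by linarith [hy.1]) (by linarith [hy.2]) 2
      rw [hker, inv_eq_one_div,
        div_le_div_iff₀ (by positivity) (by positivity)]
      nlinarith
    · rw [hker]
      positivity
  rw [setIntegral_const, smul_eq_mul, ← div_eq_mul_inv, div_le_iff₀ (by positivity)] at hint
  linarith

theorem measure_Ioc_eq_zero_of_le_mul_sq (τ : Measure ℝ) [IsFiniteMeasure τ] {a b K : ℝ}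
    (hab : a ≤ b)
    (h : ∀ x y, a ≤ x → x ≤ y → y ≤ b → τ.real (Set.Ioc x y) ≤ K * (y - x) ^ 2) :
    τ (Set.Ioc a b) = 0 := by
  have hhalf (n : ℕ) : ∀ x y, a ≤ x → x ≤ y → y ≤ b →
      τ.real (Set.Ioc x y) ≤ K * (y - x) ^ 2 * (1 / 2) ^ n := by
    induction n with
    | zero => simpa using h
    | succ n ih =>
      intro x y hax hxy hyb
      have hunion : Set.Ioc x y = Set.Ioc x ((x + y) / 2) ∪ Set.Ioc ((x + y) / 2) y :=
        (Set.Ioc_union_Ioc_eq_Ioc (by linarith) (by linarith)).symm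
      have hleft := ih x ((x + y) / 2) hax (by linarith) (by linarith)
      have hright := ih ((x + y) / 2) y (by linarith) (by linarith) hyb
      rw [hunion]
      refine (measureReal_union_le _ _).trans ((add_le_add hleft hright).trans_eq ?_)
      ring
  have hlim : Tendsto (fun n : ℕ => K * (b - a) ^ 2 * (1 / 2 : ℝ) ^ n) atTop (𝓝 0) := by
    simpa using (tendsto_pow_atTop_nhds_zero_of_lt_one (by norm_num : (0 : ℝ) ≤ 1 / 2)
      (by norm_num)).const_mul (K * (b - a) ^ 2)
  rw [← measureReal_eq_zero_iff]
  exact le_antisymm (ge_of_tendsto' hlim fun n => hhalf n a b le_rfl hab le_rfl) measureReal_nonneg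

theorem notMem_support_of_eventually_im_stieltjes_le (τ : Measure ℝ) [IsFiniteMeasure τ]
    {x₀ K : ℝ} (h : ∀ᶠ z in 𝓝 (x₀ : ℂ), 0 < z.im → (stieltjes τ z).im ≤ K * z.im) :
    x₀ ∉ τ.support := by
  obtain ⟨r, hr, hball⟩ := Metric.eventually_nhds_iff.1 h
  rw [Measure.notMem_support_iff_exists]
  refine ⟨Set.Ioc (x₀ - r / 4) (x₀ + r / 4), Ioc_mem_nhds (by linarith) (by linarith),
    measure_Ioc_eq_zero_of_le_mul_sq τ (K := 2 * K) (by linarith) fun x y hx hxy hy => ?_⟩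
  rcases hxy.eq_or_lt with rfl | hlt
  · simp
  have hdist : dist (⟨x, y - x⟩ : ℂ) x₀ < r := by
    rw [dist_eq_norm]
    refine (Complex.norm_le_abs_re_add_abs_im _).trans_lt ?_
    simp only [Complex.sub_re, Complex.sub_im, Complex.ofReal_re, Complex.ofReal_im, sub_zero,
      abs_of_pos (sub_pos.2 hlt)]
    have := abs_le.2 ⟨(by linarith : -(r / 4) ≤ x - x₀), by linarith⟩
    linarith
  have hmass := measureReal_Ioc_le_mul_im_stieltjes τ x (sub_pos.2 hlt)
  rw [add_sub_cancel] at hmass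
  refine hmass.trans ((mul_le_mul_of_nonneg_left (hball hdist (sub_pos.2 hlt))
    (by linarith)).trans_eq ?_)
  ring

open ComplexConjugate in
theorem eventually_norm_im_sub_le {f : ℂ → ℂ} {d : ℂ} {x₀ : ℝ}
    (hf : HasStrictDerivAt f d (x₀ : ℂ)) (hconj : ∀ z, f (conj z) = conj (f z)) {ε : ℝ}
    (hε : 0 < ε) : ∀ᶠ z in 𝓝 (x₀ : ℂ), ‖((f z).im : ℂ) - d * z.im‖ ≤ ε * |z.im| := by
  have hpair : Tendsto (fun z : ℂ => (z, conj z)) (𝓝 (x₀ : ℂ)) (𝓝 ((x₀ : ℂ), (x₀ : ℂ))) := by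
    have := (continuous_id.prodMk Complex.continuous_conj).tendsto (x₀ : ℂ)
    simpa only [id, Complex.conj_ofReal] using this
  filter_upwards [hpair.eventually (hf.hasStrictFDerivAt.isLittleO.bound hε)] with z hz
  have hdiff : f z - conj (f z) - d * (z - conj z) =
      2 * Complex.I * ((f z).im - d * z.im) := by
    rw [Complex.sub_conj, Complex.sub_conj]
    push_cast
    ring
  simp only [hconj, ContinuousLinearMap.toSpanSingleton_apply, smul_eq_mul,
    mul_comm (z - _) d, hdiff] at hz
  rw [Complex.sub_conj, norm_mul, norm_mul, norm_mul] at hz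
  simp only [Complex.norm_I, Complex.norm_real, Real.norm_eq_abs, abs_mul, Complex.norm_ofNat,
    abs_two, mul_one] at hz
  linarith

end Boundary

section WTransform

open Bornology
open scoped ComplexConjugate

theorem tendsto_expect {ι α 𝕜 : Type*} [Fintype ι] [RCLike 𝕜] {F : Filter α} {f : ι → α → 𝕜}
    {a : ι → 𝕜} (h : ∀ k, Tendsto (f k) F (𝓝 (a k))) :
    Tendsto (fun x => 𝔼 k, f k x) F (𝓝 (𝔼 k, a k)) := by
  simp only [Fintype.expect_eq_sum_div_card]
  exact (tendsto_finsetSum _ fun k _ => h k).div_const _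

variable {ι : Type*} [Fintype ι] {l : ι → ℝ} {c : ℝ}

theorem analyticAt_trResC {w : ℂ} (hw : ∀ k, (l k : ℂ) - w ≠ 0) : AnalyticAt ℂ (trResC l) w := by
  unfold trResC
  simp only [Fintype.expect_eq_sum_div_card, div_eq_mul_inv]
  exact (Finset.analyticAt_fun_sum _ fun k _ => analyticAt_const.mul
    ((analyticAt_const.sub analyticAt_id).inv (hw k))).mul analyticAt_const

theorem analyticAt_phiComplex {w : ℂ} (hw : ∀ k, (l k : ℂ) - w ≠ 0) :
    AnalyticAt ℂ (phiComplex l c) w := by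
  have h := analyticAt_trResC hw
  exact ((analyticAt_const.mul (analyticAt_id.pow 2)).mul h).mul
    ((analyticAt_const.mul h).sub analyticAt_const)

theorem continuousAt_contractionRatio {w : ℂ} (hw : ∀ k, (l k : ℂ) - w ≠ 0) :
    ContinuousAt (contractionRatio l c) w :=
  (tendsto_expect fun k => ((continuousAt_const.div (continuousAt_const.sub continuousAt_id).norm
    (norm_ne_zero_iff.2 (hw k))).pow 2).tendsto).const_mul c

theorem trResC_conj (l : ι → ℝ) (w : ℂ) : trResC l (conj w) = conj (trResC l w) := by
  simp only [trResC, Fintype.expect_eq_sum_div_card, map_div₀, map_sum, map_sub,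
    Complex.conj_ofReal, map_natCast]

theorem phiComplex_conj (l : ι → ℝ) (c : ℝ) (w : ℂ) :
    phiComplex l c (conj w) = conj (phiComplex l c w) := by
  simp only [phiComplex, trResC_conj, map_mul, map_sub, map_pow, map_one, Complex.conj_ofReal]

theorem mul_sq_le_of_contractionRatio_le_one [Nonempty ι] (hc : 0 ≤ c) {w : ℂ}
    (h : contractionRatio l c w ≤ 1) {k : ι} (hk : (l k : ℂ) - w ≠ 0) :
    c * l k ^ 2 ≤ Fintype.card ι * ‖(l k : ℂ) - w‖ ^ 2 := by
  have hterm : c * (l k / ‖(l k : ℂ) - w‖) ^ 2 ≤ Fintype.card ι := by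
    have hsum := Finset.single_le_sum (f := fun k => (l k / ‖(l k : ℂ) - w‖) ^ 2)
      (fun k _ => sq_nonneg _) (Finset.mem_univ k)
    rw [contractionRatio, Fintype.expect_eq_sum_div_card, ← mul_div_assoc,
      div_le_one (by positivity)] at h
    exact (mul_le_mul_of_nonneg_left hsum hc).trans h
  rwa [div_pow, ← mul_div_assoc, div_le_iff₀ (by have := norm_pos_iff.2 hk; positivity)] at hterm

theorem tendsto_phiComplex_cobounded [Nonempty ι] (hc : 0 < c) (hl : ∀ k, 0 < l k) :
    Tendsto (phiComplex l c) (cobounded ℂ) (cobounded ℂ) := by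
  have hmean : 0 < 𝔼 k, l k := Finset.expect_pos (fun k _ => hl k) Finset.univ_nonempty
  have hG : Tendsto (fun w => c * (w * trResC l w)) (cobounded ℂ)
      (𝓝 (c * 𝔼 k, (((l k ^ 2 : ℝ) : ℂ) * 0 - l k))) := by
    refine (tendsto_expect fun k => ((tendsto_inv₀_cobounded.comp
      (tendsto_const_sub_cobounded (l k : ℂ))).const_mul _).sub_const _).const_mul _ |>.congr' ?_
    filter_upwards [eventually_all.2 fun k => eventually_ne_cobounded (l k : ℂ)] with w hw
    rw [mul_trResC fun k => sub_ne_zero.2 (hw k).symm]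
    rfl
  have hnorm : 0 < ‖c * 𝔼 k, (((l k ^ 2 : ℝ) : ℂ) * 0 - l k)‖ := by
    have : c * 𝔼 k, (((l k ^ 2 : ℝ) : ℂ) * 0 - l k) = -((c * 𝔼 k, l k : ℝ) : ℂ) := by
      simp only [mul_zero, zero_sub, Finset.expect_neg_distrib, mul_neg]
      push_cast
      rfl
    rw [this, norm_neg, Complex.norm_real]
    exact norm_pos_iff.2 (mul_pos hc hmean).ne'
  have hsub : Tendsto (fun w => ‖c * (w * trResC l w) - w‖) (cobounded ℂ) atTop := by
    have hlow := tendsto_atTop_add_left_of_le' _ _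
      (hG.norm.neg.eventually_const_lt (sub_one_lt _) |>.mono fun _ => le_of_lt)
      tendsto_norm_cobounded_atTop
    refine tendsto_atTop_mono (fun w => ?_) hlow
    rw [neg_add_eq_sub, norm_sub_rev]
    exact norm_sub_norm_le _ _
  rw [← tendsto_norm_atTop_iff_cobounded]
  simpa only [phiComplex_eq, norm_mul] using hG.norm.pos_mul_atTop hnorm hsub

theorem exists_tendsto_subseq_of_tendsto_phiComplex [Nonempty ι] (hc : 0 < c) (hl : ∀ k, 0 < l k)
    {w : ℕ → ℂ} (hw : ∀ n, 0 < (w n).im) (hratio : ∀ n, contractionRatio l c (w n) ≤ 1) {x : ℂ}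
    (hlim : Tendsto (fun n => phiComplex l c (w n)) atTop (𝓝 x)) :
    ∃ w₀, (∀ k, (l k : ℂ) - w₀ ≠ 0) ∧ contractionRatio l c w₀ ≤ 1 ∧ 0 ≤ w₀.im ∧
      ∃ θ : ℕ → ℕ, StrictMono θ ∧ Tendsto (w ∘ θ) atTop (𝓝 w₀) := by
  have hbdd : IsBounded (phiComplex l c ⁻¹' Set.range fun n => phiComplex l c (w n)) :=
    isBounded_def.2 (tendsto_phiComplex_cobounded hc hl
      (isBounded_def.1 (Metric.isBounded_range_of_tendsto _ hlim)))
  obtain ⟨w₀, -, θ, hθ, hw₀⟩ := tendsto_subseq_of_bounded hbdd fun n => Set.mem_range_self n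
  have hne (k) : (l k : ℂ) - w₀ ≠ 0 := by
    have hle : c * l k ^ 2 ≤ Fintype.card ι * ‖(l k : ℂ) - w₀‖ ^ 2 :=
      ge_of_tendsto' (((hw₀.const_sub (l k : ℂ)).norm.pow 2).const_mul _) fun n =>
        mul_sq_le_of_contractionRatio_le_one hc.le (hratio _) (ofReal_sub_ne_zero _ (hw _))
    intro h₀
    rw [h₀, norm_zero, zero_pow two_ne_zero, mul_zero] at hle
    exact hle.not_gt (mul_pos hc (pow_pos (hl k) 2))
  exact ⟨w₀, hne, le_of_tendsto' ((continuousAt_contractionRatio hne).tendsto.comp hw₀)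
    fun n => hratio _, ge_of_tendsto' ((Complex.continuous_im.tendsto _).comp hw₀)
    fun n => (hw _).le, θ, hθ, hw₀⟩

/-- The Stieltjes transform of the measure `τ` is read off the equation `φ(w) = z`: on the open
upper half-plane, `z` times the transform is an explicit analytic function `F` of the solution `w`.
The two measures of the theorem are of this form, and their supports are computed simultaneously. -/
structure IsWTransform (l : ι → ℝ) (c : ℝ) (τ : Measure ℝ) (F : ℂ → ℂ) : Prop where
  exists_eq : ∀ z : ℂ, 0 < z.im → ∃ w : ℂ, 0 < w.im ∧ contractionRatio l c w < 1 ∧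
    phiComplex l c w = z ∧ z * stieltjes τ z = F w
  analyticAt : ∀ w : ℂ, (∀ k, (l k : ℂ) - w ≠ 0) → AnalyticAt ℂ F w
  map_conj : ∀ w : ℂ, F (conj w) = conj (F w)
  im_pos : ∀ w : ℂ, 0 < w.im → 0 < (F w).im

namespace IsWTransform

variable [Nonempty ι] {τ : Measure ℝ} [IsFiniteMeasure τ] {F : ℂ → ℂ}

theorem exists_ofReal (hc : 0 < c) (hl : ∀ k, 0 < l k) (h : IsWTransform l c τ F) {x : ℝ}
    (hx : x ∉ τ.support) :
    ∃ w : ℝ, (∀ k, l k ≠ w) ∧ contractionRatio l c w ≤ 1 ∧ phiComplex l c w = x ∧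
      F w = x * stieltjes τ x := by
  let z (n : ℕ) : ℂ := x + (1 / ((n : ℝ) + 1) : ℝ) * Complex.I
  have hzim (n : ℕ) : 0 < (z n).im := by
    simp only [z, Complex.add_im, Complex.ofReal_im, Complex.im_ofReal_mul, Complex.I_im]
    positivity
  have hz : Tendsto z atTop (𝓝 (x : ℂ)) := by
    have := ((Complex.continuous_ofReal.tendsto 0).comp
      tendsto_one_div_add_atTop_nhds_zero_nat).mul_const Complex.I
    simpa only [z, Function.comp_def, Complex.ofReal_zero, zero_mul, add_zero] using
      this.const_add (x : ℂ)
  choose w hw hratio hphi hF using fun n => h.exists_eq (z n) (hzim n)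
  obtain ⟨w₀, hne, hratio₀, him, θ, hθ, hw₀⟩ := exists_tendsto_subseq_of_tendsto_phiComplex hc hl
    hw (fun n => (hratio n).le) (by simpa only [hphi] using hz)
  have hzθ := hz.comp hθ.tendsto_atTop
  have hphi₀ : phiComplex l c w₀ = x :=
    tendsto_nhds_unique ((analyticAt_phiComplex hne).continuousAt.tendsto.comp hw₀)
      (hzθ.congr fun n => (hphi _).symm)
  have hF₀ : F w₀ = x * stieltjes τ x :=
    tendsto_nhds_unique ((h.analyticAt _ hne).continuousAt.tendsto.comp hw₀)
      ((hzθ.mul ((continuousAt_stieltjes τ hx).tendsto.comp hzθ)).congr fun n => hF (θ n))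
  have him₀ : w₀.im = 0 := by
    refine him.eq_of_not_lt' fun hpos => (h.im_pos _ hpos).ne' ?_
    rw [hF₀, Complex.im_ofReal_mul, stieltjes_ofReal_im, mul_zero]
  obtain ⟨u, rfl⟩ : ∃ u : ℝ, w₀ = u := ⟨w₀.re, Complex.ext rfl him₀⟩
  exact ⟨u, fun k hk => hne k (by rw [hk, sub_self]), hratio₀, hphi₀, hF₀⟩

theorem notMem_support (hc : 0 < c) (hl : ∀ k, 0 < l k) (h : IsWTransform l c τ F)
    {w₀ x₀ d : ℝ} (hne : ∀ k, l k ≠ w₀) (hratio : contractionRatio l c w₀ < 1)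
    (hphi : phiComplex l c w₀ = x₀) (hx₀ : x₀ ≠ 0) (hd : 0 < d)
    (hderiv : HasDerivAt (phiComplex l c) (d : ℂ) (w₀ : ℂ)) : x₀ ∉ τ.support := by
  have hneC (k) : (l k : ℂ) - (w₀ : ℂ) ≠ 0 := by
    rw [← Complex.ofReal_sub, Complex.ofReal_ne_zero]
    exact sub_ne_zero.2 (hne k)
  have hphiA : AnalyticAt ℂ (phiComplex l c) (w₀ : ℂ) := analyticAt_phiComplex hneC
  have hstrict : HasStrictDerivAt (phiComplex l c) (d : ℂ) (w₀ : ℂ) :=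
    hderiv.deriv ▸ hphiA.hasStrictDerivAt
  have hquot : AnalyticAt ℂ (fun w => F w / phiComplex l c w) (w₀ : ℂ) :=
    (h.analyticAt _ hneC).fun_div hphiA (hphi ▸ Complex.ofReal_ne_zero.2 hx₀)
  set D := deriv (fun w => F w / phiComplex l c w) (w₀ : ℂ)
  refine notMem_support_of_eventually_im_stieltjes_le τ (K := (‖D‖ + 1) * (2 / d)) ?_
  rw [← hphi, ← hstrict.map_nhds_eq (Complex.ofReal_ne_zero.2 hd.ne'), eventually_map]
  filter_upwards [eventually_norm_im_sub_le hstrict (phiComplex_conj l c) (half_pos hd),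
    eventually_norm_im_sub_le hquot.hasStrictDerivAt
      (fun w => by rw [h.map_conj, phiComplex_conj, map_div₀]) one_pos,
    (continuousAt_contractionRatio hneC).eventually_lt_const hratio]
    with w himphi himquot hratio_w hz
  rw [← Complex.ofReal_mul, ← Complex.ofReal_sub, Complex.norm_real, Real.norm_eq_abs,
    abs_le] at himphi
  have hw : 0 < w.im := by
    by_contra! hneg
    rw [abs_of_nonpos hneg] at himphi
    nlinarith [himphi.2]
  have hw_le : w.im ≤ 2 / d * (phiComplex l c w).im := by
    rw [abs_of_pos hw] at himphi
    rw [div_mul_eq_mul_div, le_div_iff₀ hd]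
    linarith [himphi.1]
  obtain ⟨v, hv, hratio_v, hphi_v, hF_v⟩ := h.exists_eq _ hz
  obtain rfl : v = w :=
    phiComplex_injOn hc hl hv hw hratio_v hratio_w hphi_v (hphi_v.symm ▸ hz)
  have hS : stieltjes τ (phiComplex l c v) = F v / phiComplex l c v := by
    rw [← hF_v, mul_div_cancel_left₀]
    exact fun h₀ => hz.ne' (by rw [h₀, Complex.zero_im])
  rw [abs_of_pos hw, one_mul, ← hS] at himquot
  have hbound : (stieltjes τ (phiComplex l c v)).im ≤ (‖D‖ + 1) * v.im := by
    have htri := norm_le_norm_add_norm_sub' ((stieltjes τ (phiComplex l c v)).im : ℂ) (D * v.im)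
    rw [norm_mul, Complex.norm_real, Complex.norm_real, Real.norm_of_nonneg hw.le] at htri
    linarith [Real.le_norm_self (stieltjes τ (phiComplex l c v)).im]
  rw [mul_assoc]
  exact hbound.trans (mul_le_mul_of_nonneg_left hw_le (by positivity))

end IsWTransform

end WTransform

section RealAxis

variable {ι : Type*} [Fintype ι] {l : ι → ℝ} {c w : ℝ}

/-- The normalized trace `(1/M) Tr R (R - w)⁻¹` for real `w`, expressed through the eigenvalues `l`
of `R`. -/
def trRes (l : ι → ℝ) (w : ℝ) : ℝ :=
  𝔼 k, l k / (l k - w)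

/-- The normalized trace `(1/M) Tr (R (R - w)⁻¹)²` for real `w`. -/
def trResSq (l : ι → ℝ) (w : ℝ) : ℝ :=
  𝔼 k, (l k / (l k - w)) ^ 2

/-- The function `φ` of the real variable `w`, expressed through the eigenvalues `l`. -/
def phiReal (l : ι → ℝ) (c w : ℝ) : ℝ :=
  c * w ^ 2 * trRes l w * (c * trRes l w - 1)

/-- The derivative of `phiReal l c`; the formula is valid away from the eigenvalues. -/
def phiRealDeriv (l : ι → ℝ) (c w : ℝ) : ℝ :=
  c * w * (2 * c * trRes l w * trResSq l w - trRes l w - trResSq l w)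

theorem trResC_ofReal (l : ι → ℝ) (w : ℝ) : trResC l w = trRes l w := by
  simp only [trResC, trRes, Fintype.expect_eq_sum_div_card]
  push_cast
  rfl

theorem phiComplex_ofReal (l : ι → ℝ) (c w : ℝ) : phiComplex l c w = phiReal l c w := by
  rw [phiComplex, phiReal, trResC_ofReal]
  push_cast
  rfl

theorem contractionRatio_ofReal (l : ι → ℝ) (c w : ℝ) :
    contractionRatio l c w = c * trResSq l w := by
  simp only [contractionRatio, trResSq, ← Complex.ofReal_sub, Complex.norm_real,
    Real.norm_eq_abs, div_pow, sq_abs]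

theorem phiReal_eq (l : ι → ℝ) (c w : ℝ) :
    phiReal l c w = c * (w * trRes l w) * (c * (w * trRes l w) - w) := by
  rw [phiReal]
  ring

theorem mul_trRes_eq (h : ∀ k, l k ≠ w) :
    w * trRes l w = 𝔼 k, (l k ^ 2 / (l k - w) - l k) := by
  rw [trRes, Finset.mul_expect]
  refine Finset.expect_congr rfl fun k _ => ?_
  have := sub_ne_zero.2 (h k)
  field_simp
  ring

theorem hasDerivAt_mul_trRes (h : ∀ k, l k ≠ w) :
    HasDerivAt (fun w => w * trRes l w) (trResSq l w) w := by
  have hloc : (fun w => w * trRes l w) =ᶠ[𝓝 w]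
      fun w => (∑ k, (l k ^ 2 / (l k - w) - l k)) / Fintype.card ι := by
    filter_upwards [eventually_all.2 fun k => eventually_ne_nhds (h k).symm] with v hv
    rw [mul_trRes_eq fun k => (hv k).symm, Fintype.expect_eq_sum_div_card]
  rw [trResSq, Fintype.expect_eq_sum_div_card]
  refine (HasDerivAt.div_const (.fun_sum fun k _ => ?_) _).congr_of_eventuallyEq hloc
  refine (((hasDerivAt_const w (l k ^ 2)).fun_div ((hasDerivAt_id w).const_sub (l k))
    (sub_ne_zero.2 (h k))).sub_const (l k)).congr_deriv ?_
  rw [div_pow, zero_mul, zero_sub, mul_neg_one, neg_neg, id]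

theorem hasDerivAt_phiReal (h : ∀ k, l k ≠ w) :
    HasDerivAt (phiReal l c) (phiRealDeriv l c w) w := by
  have hG := (hasDerivAt_mul_trRes h).const_mul c
  refine ((hG.fun_mul (hG.fun_sub (hasDerivAt_id w))).congr_of_eventuallyEq
    (.of_forall (phiReal_eq l c))).congr_deriv ?_
  rw [phiRealDeriv, id]
  ring

theorem hasDerivAt_phiComplex (h : ∀ k, l k ≠ w) :
    HasDerivAt (phiComplex l c) (phiRealDeriv l c w : ℂ) (w : ℂ) := by
  have hne (k) : (l k : ℂ) - w ≠ 0 := sub_ne_zero.2 (Complex.ofReal_injective.ne (h k))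
  have hderiv := (analyticAt_phiComplex (c := c) hne).differentiableAt.hasDerivAt
  have hreal := hderiv.comp_ofReal
  simp only [phiComplex_ofReal] at hreal
  rwa [hreal.unique (hasDerivAt_phiReal h).ofReal_comp] at hderiv

theorem continuousAt_trRes (h : ∀ k, l k ≠ w) : ContinuousAt (trRes l) w :=
  tendsto_expect fun k => (continuousAt_const.div (continuousAt_const.sub continuousAt_id)
    (sub_ne_zero.2 (h k))).tendsto

theorem continuousAt_trResSq (h : ∀ k, l k ≠ w) : ContinuousAt (trResSq l) w :=
  tendsto_expect fun k => ((continuousAt_const.div (continuousAt_const.sub continuousAt_id)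
    (sub_ne_zero.2 (h k))).pow 2).tendsto

theorem continuousAt_phiRealDeriv (h : ∀ k, l k ≠ w) : ContinuousAt (phiRealDeriv l c) w := by
  have := continuousAt_trRes h
  have := continuousAt_trResSq h
  unfold phiRealDeriv
  fun_prop

theorem expect_lt_expect_of_forall_lt [Nonempty ι] {f g : ι → ℝ} (h : ∀ k, f k < g k) :
    𝔼 k, f k < 𝔼 k, g k :=
  Finset.expect_lt_expect (fun k _ => (h k).le) ⟨Classical.arbitrary ι, Finset.mem_univ _, h _⟩

theorem expect_pos_of_forall_pos [Nonempty ι] {f : ι → ℝ} (h : ∀ k, 0 < f k) : 0 < 𝔼 k, f k :=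
  Finset.expect_pos (fun k _ => h k) Finset.univ_nonempty

theorem trResSq_pos [Nonempty ι] (hl : ∀ k, 0 < l k) (h : ∀ k, l k ≠ w) : 0 < trResSq l w :=
  expect_pos_of_forall_pos fun k =>
    sq_pos_iff.2 (div_ne_zero (hl k).ne' (sub_ne_zero.2 (h k)))

theorem le_of_hasDerivAt_of_mul_sub_nonneg {f f' : ℝ → ℝ} {p w : ℝ}
    (hf : ∀ v ∈ Set.uIcc p w, HasDerivAt f (f' v) v)
    (hsign : ∀ v ∈ Set.uIcc p w, 0 ≤ f' v * (v - p)) : f p ≤ f w := by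
  have hcont : ContinuousOn f (Set.uIcc p w) := fun v hv =>
    (hf v hv).continuousAt.continuousWithinAt
  rcases lt_trichotomy p w with hlt | rfl | hlt
  · rw [Set.uIcc_of_lt hlt] at hf hsign hcont
    obtain ⟨ξ, hξ, hslope⟩ := exists_hasDerivAt_eq_slope f f' hlt hcont
      fun v hv => hf v (Set.Ioo_subset_Icc_self hv)
    have hnonneg := nonneg_of_mul_nonneg_left (hsign ξ (Set.Ioo_subset_Icc_self hξ))
      (sub_pos.2 hξ.1)
    rw [hslope, le_div_iff₀ (sub_pos.2 hlt), zero_mul] at hnonneg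
    exact sub_nonneg.1 hnonneg
  · exact le_rfl
  · rw [Set.uIcc_of_gt hlt] at hf hsign hcont
    obtain ⟨ξ, hξ, hslope⟩ := exists_hasDerivAt_eq_slope f f' hlt hcont
      fun v hv => hf v (Set.Ioo_subset_Icc_self hv)
    have hnonpos := nonpos_of_mul_nonneg_left (hsign ξ (Set.Ioo_subset_Icc_self hξ))
      (sub_neg.2 hξ.2)
    rw [hslope, div_le_iff₀ (sub_pos.2 hlt), zero_mul] at hnonpos
    exact sub_nonpos.1 hnonpos

end RealAxis

section RightOfSpectrum

variable {ι : Type*} [Fintype ι] {l : ι → ℝ} {c w : ℝ}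

/-- The decreasing part of `φ'`: to the right of the eigenvalues, `φ' = c (𝔼 l - rightSlope)`. -/
def rightSlope (l : ι → ℝ) (c w : ℝ) : ℝ :=
  2 * c * -(w * trRes l w) * trResSq l w + 𝔼 k, l k ^ 3 / (l k - w) ^ 2

theorem mul_trRes_add_trResSq (h : ∀ k, l k ≠ w) :
    w * (trRes l w + trResSq l w) = 𝔼 k, l k ^ 3 / (l k - w) ^ 2 - 𝔼 k, l k := by
  rw [trRes, trResSq, ← Finset.expect_add_distrib, ← Finset.expect_sub_distrib, Finset.mul_expect]
  refine Finset.expect_congr rfl fun k _ => ?_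
  have := sub_ne_zero.2 (h k)
  field_simp
  ring

theorem phiRealDeriv_eq_rightSlope (h : ∀ k, l k ≠ w) :
    phiRealDeriv l c w = c * (𝔼 k, l k - rightSlope l c w) := by
  rw [phiRealDeriv, rightSlope]
  linear_combination -c * mul_trRes_add_trResSq h

theorem trRes_neg_right [Nonempty ι] (hl : ∀ k, 0 < l k) (h : ∀ k, l k < w) : trRes l w < 0 := by
  rw [← neg_pos, trRes, ← Finset.expect_neg_distrib]
  exact expect_pos_of_forall_pos fun k => neg_pos.2 (div_neg_of_pos_of_neg (hl k) (sub_neg.2 (h k)))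

theorem neg_mul_trRes_right (h : ∀ k, l k < w) :
    -(w * trRes l w) = 𝔼 k, (l k + l k ^ 2 / (w - l k)) := by
  rw [mul_trRes_eq fun k => (h k).ne, ← Finset.expect_neg_distrib]
  refine Finset.expect_congr rfl fun k _ => ?_
  rw [neg_sub, ← neg_sub w, div_neg, sub_neg_eq_add]

theorem expect_lt_neg_mul_trRes_right [Nonempty ι] (hl : ∀ k, 0 < l k) (h : ∀ k, l k < w) :
    𝔼 k, l k < -(w * trRes l w) := by
  rw [neg_mul_trRes_right h]
  exact expect_lt_expect_of_forall_lt fun k =>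
    lt_add_of_pos_right _ (div_pos (pow_pos (hl k) 2) (sub_pos.2 (h k)))

theorem sub_sq_lt_sub_sq_right {x v : ℝ} (hv : x < v) (hvw : v < w) :
    (x - v) ^ 2 < (x - w) ^ 2 := by
  nlinarith

theorem trResSq_lt_trResSq_right [Nonempty ι] (hl : ∀ k, 0 < l k) {v : ℝ} (hv : ∀ k, l k < v)
    (hvw : v < w) : trResSq l w < trResSq l v := by
  refine expect_lt_expect_of_forall_lt fun k => ?_
  rw [div_pow, div_pow]
  exact div_lt_div_of_pos_left (pow_pos (hl k) 2) (sq_pos_iff.2 (sub_ne_zero.2 (hv k).ne))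
    (sub_sq_lt_sub_sq_right (hv k) hvw)

theorem rightSlope_strictAntiOn [Nonempty ι] (hc : 0 < c) (hl : ∀ k, 0 < l k) :
    StrictAntiOn (rightSlope l c) {w | ∀ k, l k < w} := by
  intro v (hv : ∀ k, l k < v) w (hw : ∀ k, l k < w) hvw
  have hG : -(w * trRes l w) < -(v * trRes l v) := by
    rw [neg_mul_trRes_right hv, neg_mul_trRes_right hw]
    exact expect_lt_expect_of_forall_lt fun k => by
      have := div_lt_div_of_pos_left (pow_pos (hl k) 2) (sub_pos.2 (hv k))
        (sub_lt_sub_right hvw (l k))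
      gcongr
  have hmean : 0 < 𝔼 k, l k := expect_pos_of_forall_pos hl
  have hcube : 𝔼 k, l k ^ 3 / (l k - w) ^ 2 < 𝔼 k, l k ^ 3 / (l k - v) ^ 2 :=
    expect_lt_expect_of_forall_lt fun k => div_lt_div_of_pos_left (pow_pos (hl k) 3)
      (sq_pos_iff.2 (sub_ne_zero.2 (hv k).ne)) (sub_sq_lt_sub_sq_right (hv k) hvw)
  have hprod := mul_lt_mul hG (trResSq_lt_trResSq_right hl hv hvw).le
    (trResSq_pos hl fun k => (hw k).ne)
    ((hmean.trans (expect_lt_neg_mul_trRes_right hl hv)).le)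
  rw [rightSlope, rightSlope, mul_assoc, mul_assoc (2 * c)]
  gcongr

theorem phiRealDeriv_strictMonoOn_right [Nonempty ι] (hc : 0 < c) (hl : ∀ k, 0 < l k) :
    StrictMonoOn (phiRealDeriv l c) {w | ∀ k, l k < w} := by
  intro v (hv : ∀ k, l k < v) w (hw : ∀ k, l k < w) hvw
  rw [phiRealDeriv_eq_rightSlope fun k => (hv k).ne, phiRealDeriv_eq_rightSlope fun k => (hw k).ne]
  exact mul_lt_mul_of_pos_left (sub_lt_sub_left (rightSlope_strictAntiOn hc hl hv hw hvw) _) hc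

theorem tendsto_phiRealDeriv_atTop (l : ι → ℝ) (c : ℝ) :
    Tendsto (phiRealDeriv l c) atTop (𝓝 (c * 𝔼 k, l k)) := by
  have hsub (k : ι) : Tendsto (fun w => l k - w) atTop atBot :=
    tendsto_const_nhds.add_atBot tendsto_neg_atTop_atBot
  have hG : Tendsto (fun w => 𝔼 k, (l k ^ 2 / (l k - w) - l k)) atTop (𝓝 (𝔼 k, (0 - l k))) :=
    tendsto_expect fun k => (tendsto_const_nhds.div_atBot (hsub k)).sub_const _
  have hSq : Tendsto (trResSq l) atTop (𝓝 (𝔼 _k : ι, 0 ^ 2)) :=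
    tendsto_expect fun k => (tendsto_const_nhds.div_atBot (hsub k)).pow 2
  have hCube : Tendsto (fun w => 𝔼 k, l k ^ 3 / (l k - w) ^ 2) atTop (𝓝 (𝔼 _k : ι, 0)) :=
    tendsto_expect fun k => tendsto_const_nhds.div_atTop <| by
      simpa only [sq] using (hsub k).atBot_mul_atBot₀ (hsub k)
  have hlim := ((((hG.neg.const_mul (2 * c)).mul hSq).add hCube).const_sub
    (𝔼 k, l k)).const_mul c
  simp only [zero_pow two_ne_zero, Finset.expect_const_zero, mul_zero, add_zero, sub_zero] at hlim
  refine hlim.congr' ?_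
  filter_upwards [eventually_all.2 fun k => eventually_gt_atTop (l k)] with w hw
  rw [phiRealDeriv_eq_rightSlope fun k => (hw k).ne, rightSlope,
    mul_trRes_eq fun k => (hw k).ne]

theorem tendsto_phiRealDeriv_nhdsGT [Nonempty ι] (hc : 0 < c) (hl : ∀ k, 0 < l k) {j : ι}
    (hj : ∀ k, l k ≤ l j) : Tendsto (phiRealDeriv l c) (𝓝[>] l j) atBot := by
  have hsq : Tendsto (fun w => (l j - w) ^ 2) (𝓝[>] l j) (𝓝[>] 0) := by
    refine tendsto_nhdsWithin_iff.2 ⟨?_, ?_⟩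
    · refine (Continuous.tendsto' (by fun_prop) _ _ ?_).mono_left nhdsWithin_le_nhds
      rw [sub_self, zero_pow two_ne_zero]
    · filter_upwards [self_mem_nhdsWithin] with w (hw : l j < w)
      exact sq_pos_iff.2 (sub_neg.2 hw).ne
  have hlow : Tendsto (fun w => l j ^ 3 / Fintype.card ι * ((l j - w) ^ 2)⁻¹) (𝓝[>] l j) atTop :=
    (tendsto_inv_nhdsGT_zero.comp hsq).const_mul_atTop
      (div_pos (pow_pos (hl j) 3) (Nat.cast_pos.2 Fintype.card_pos))
  have hslope : Tendsto (rightSlope l c) (𝓝[>] l j) atTop := by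
    refine tendsto_atTop_mono' _ ?_ hlow
    filter_upwards [self_mem_nhdsWithin] with w (hw : l j < w)
    have hw' (k) : l k < w := (hj k).trans_lt hw
    have hcube : l j ^ 3 / (l j - w) ^ 2 ≤ ∑ k, l k ^ 3 / (l k - w) ^ 2 :=
      Finset.single_le_sum (f := fun k => l k ^ 3 / (l k - w) ^ 2)
        (fun k _ => div_nonneg (pow_pos (hl k) 3).le (sq_nonneg _)) (Finset.mem_univ j)
    have hG := (expect_pos_of_forall_pos hl).trans (expect_lt_neg_mul_trRes_right hl hw')
    have hSq := trResSq_pos hl fun k => (hw' k).ne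
    rw [rightSlope, Fintype.expect_eq_sum_div_card, div_mul_eq_mul_div, ← div_eq_mul_inv]
    exact le_add_of_nonneg_of_le (by positivity) (by gcongr)
  refine (((tendsto_const_nhds (x := 𝔼 k, l k)).add_atBot
    (tendsto_neg_atTop_atBot.comp hslope)).const_mul_atBot hc).congr' ?_
  filter_upwards [self_mem_nhdsWithin] with w (hw : l j < w)
  rw [phiRealDeriv_eq_rightSlope fun k => ((hj k).trans_lt hw).ne, sub_eq_add_neg]
  rfl

theorem exists_phiRealDeriv_eq_zero_right [Nonempty ι] (hc : 0 < c) (hl : ∀ k, 0 < l k) :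
    ∃ w, (∀ k, l k < w) ∧ phiRealDeriv l c w = 0 := by
  obtain ⟨j, hj⟩ := Finite.exists_max l
  obtain ⟨w, hw, hw₀⟩ := isPreconnected_Ioi.intermediate_value_Iio (s := Set.Ioi (l j))
    (l₁ := 𝓝[>] l j) (l₂ := atTop) inf_le_right (le_principal_iff.2 (Ioi_mem_atTop _))
    (fun w hw => (continuousAt_phiRealDeriv (c := c) fun k =>
      ((hj k).trans_lt hw).ne).continuousWithinAt)
    (tendsto_phiRealDeriv_nhdsGT hc hl hj) (tendsto_phiRealDeriv_atTop l c)
    (mul_pos hc (expect_pos_of_forall_pos hl))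
  exact ⟨w, fun k => (hj k).trans_lt hw, hw₀⟩

theorem sq_lt_phiReal_right [Nonempty ι] (hc : 0 < c) (hl : ∀ k, 0 < l k) (h : ∀ k, l k < w) :
    (c * 𝔼 k, l k) ^ 2 < phiReal l c w ∧ (c * 𝔼 k, l k) * w < phiReal l c w := by
  have hG := mul_lt_mul_of_pos_left (expect_lt_neg_mul_trRes_right hl h) hc
  have hmean : 0 < c * 𝔼 k, l k := mul_pos hc (expect_pos_of_forall_pos hl)
  have hw : 0 < w := (hl (Classical.arbitrary ι)).trans (h _)
  rw [phiReal_eq]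
  constructor <;> nlinarith

section Minimum

variable [Nonempty ι] {v x : ℝ}

theorem phiReal_le_right (hc : 0 < c) (hl : ∀ k, 0 < l k) (hv : ∀ k, l k < v)
    (hv₀ : phiRealDeriv l c v = 0) (hw : ∀ k, l k < w) : phiReal l c v ≤ phiReal l c w := by
  have hmem (u) (hu : u ∈ Set.uIcc v w) (k) : l k < u := (lt_min (hv k) (hw k)).trans_le hu.1
  refine le_of_hasDerivAt_of_mul_sub_nonneg
    (fun u hu => hasDerivAt_phiReal fun k => (hmem u hu k).ne) fun u hu => ?_
  have hmono := (phiRealDeriv_strictMonoOn_right hc hl).monotoneOn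
  rcases le_total v u with huv | huv
  · exact mul_nonneg (hv₀ ▸ hmono hv (hmem u hu) huv) (sub_nonneg.2 huv)
  · exact mul_nonneg_of_nonpos_of_nonpos (hv₀ ▸ hmono (hmem u hu) hv huv) (sub_nonpos.2 huv)

theorem exists_phiReal_eq_right (hc : 0 < c) (hl : ∀ k, 0 < l k) (hv : ∀ k, l k < v)
    (hv₀ : phiRealDeriv l c v = 0) (hx : phiReal l c v < x) :
    ∃ w, (∀ k, l k < w) ∧ phiReal l c w = x ∧ 0 < phiRealDeriv l c w := by
  have hmean : 0 < c * 𝔼 k, l k := mul_pos hc (expect_pos_of_forall_pos hl)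
  have htop : Tendsto (phiReal l c) atTop atTop := by
    refine tendsto_atTop_mono' _ ?_ (tendsto_id.const_mul_atTop hmean)
    filter_upwards [eventually_all.2 fun k => eventually_gt_atTop (l k)] with w hw
    exact (sq_lt_phiReal_right hc hl hw).2.le
  obtain ⟨w, hvw, rfl⟩ := isPreconnected_Ici.intermediate_value_Ici (s := Set.Ici v) (a := v)
    (l := atTop) Set.self_mem_Ici (le_principal_iff.2 (Ici_mem_atTop _))
    (fun u hu => (hasDerivAt_phiReal fun k =>
      ((hv k).trans_le hu).ne).continuousAt.continuousWithinAt) htop hx.le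
  have hlt : v < w := lt_of_le_of_ne hvw fun h => hx.ne (h ▸ rfl)
  have hw (k) : l k < w := (hv k).trans hlt
  exact ⟨w, hw, rfl, hv₀ ▸ phiRealDeriv_strictMonoOn_right hc hl hv hw hlt⟩

theorem mul_trResSq_lt_one_right (hc : 0 < c) (hl : ∀ k, 0 < l k) (h : ∀ k, l k < w)
    (hd : 0 < phiRealDeriv l c w) : c * trResSq l w < 1 := by
  have hw : 0 < w := (hl (Classical.arbitrary ι)).trans (h _)
  have hfactor : 0 < 2 * c * trRes l w * trResSq l w - trRes l w - trResSq l w :=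
    pos_of_mul_pos_right hd (by positivity)
  by_contra! hge
  nlinarith [trRes_neg_right hl h, trResSq_pos hl fun k => (h k).ne]

end Minimum

end RightOfSpectrum

section LeftOfSpectrum

variable {ι : Type*} [Fintype ι] {l : ι → ℝ} {c v w : ℝ}

theorem trRes_zero [Nonempty ι] (hl : ∀ k, 0 < l k) : trRes l 0 = 1 := by
  simp only [trRes, sub_zero, div_self (hl _).ne', Fintype.expect_const]

theorem trResSq_zero [Nonempty ι] (hl : ∀ k, 0 < l k) : trResSq l 0 = 1 := by
  simp only [trResSq, sub_zero, div_self (hl _).ne', one_pow, Fintype.expect_const]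

theorem trRes_le_trResSq (hw : 0 ≤ w) (h : ∀ k, w < l k) : trRes l w ≤ trResSq l w :=
  Finset.expect_le_expect fun k _ =>
    le_self_pow₀ ((one_le_div (sub_pos.2 (h k))).2 (sub_le_self _ hw)) two_ne_zero

variable [Nonempty ι]

theorem trRes_pos_left (hl : ∀ k, 0 < l k) (h : ∀ k, w < l k) : 0 < trRes l w :=
  expect_pos_of_forall_pos fun k => div_pos (hl k) (sub_pos.2 (h k))

theorem trRes_strictMonoOn_left (hl : ∀ k, 0 < l k) :
    StrictMonoOn (trRes l) {w | ∀ k, w < l k} := fun _ _ _ hw hvw =>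
  expect_lt_expect_of_forall_lt fun k =>
    div_lt_div_of_pos_left (hl k) (sub_pos.2 (hw k)) (sub_lt_sub_left hvw _)

theorem trResSq_strictMonoOn_left (hl : ∀ k, 0 < l k) :
    StrictMonoOn (trResSq l) {w | ∀ k, w < l k} := fun _ hv _ hw hvw =>
  expect_lt_expect_of_forall_lt fun k => pow_lt_pow_left₀
    (div_lt_div_of_pos_left (hl k) (sub_pos.2 (hw k)) (sub_lt_sub_left hvw _))
    (div_pos (hl k) (sub_pos.2 (hv k))).le two_ne_zero

theorem trResSq_lt_trRes (hl : ∀ k, 0 < l k) (hw : w < 0) : trResSq l w < trRes l w := by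
  refine expect_lt_expect_of_forall_lt fun k => ?_
  have hpos : 0 < l k - w := sub_pos.2 (hw.trans (hl k))
  exact pow_lt_self_of_lt_one₀ (div_pos (hl k) hpos)
    ((div_lt_one hpos).2 (by linarith)) one_lt_two

theorem phiReal_nonpos_of_mul_trResSq_le_one (hc : 0 < c) (hl : ∀ k, 0 < l k) (hw : 0 ≤ w)
    (h : ∀ k, w < l k) (hratio : c * trResSq l w ≤ 1) : phiReal l c w ≤ 0 := by
  have hpos := trRes_pos_left hl h
  have hle := mul_le_mul_of_nonneg_left (trRes_le_trResSq hw h) hc.le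
  exact mul_nonpos_of_nonneg_of_nonpos (by positivity) (sub_nonpos.2 (hle.trans hratio))

theorem phiReal_neg_left (hc : 0 < c) (hc₁ : c ≤ 1) (hl : ∀ k, 0 < l k) (hw : w < 0) :
    phiReal l c w < 0 := by
  have hlt (k) : w < l k := hw.trans (hl k)
  have hpos := trRes_pos_left hl hlt
  have hlt_one : trRes l w < 1 := trRes_zero hl ▸ trRes_strictMonoOn_left hl hlt hl hw
  refine mul_neg_of_pos_of_neg ?_
    (sub_neg.2 ((mul_le_of_le_one_left hpos.le hc₁).trans_lt hlt_one))
  have := hw.ne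
  positivity

/-- On the negative half-line, the sign of `φ'` is that of `leftSlope l w - 2 * c`. -/
def leftSlope (l : ι → ℝ) (w : ℝ) : ℝ :=
  (trRes l w)⁻¹ + (trResSq l w)⁻¹

theorem phiRealDeriv_eq_leftSlope (hl : ∀ k, 0 < l k) (hw : w < 0) :
    phiRealDeriv l c w = c * -w * trRes l w * trResSq l w * (leftSlope l w - 2 * c) := by
  have := (trRes_pos_left hl fun k => hw.trans (hl k)).ne'
  have := (trResSq_pos hl fun k => (hw.trans (hl k)).ne').ne'
  rw [phiRealDeriv, leftSlope]
  field_simp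
  ring

theorem phiRealDeriv_left_factor_pos (hc : 0 < c) (hl : ∀ k, 0 < l k) (hw : w < 0) :
    0 < c * -w * trRes l w * trResSq l w := by
  have := trRes_pos_left hl fun k => hw.trans (hl k)
  have := trResSq_pos hl fun k => (hw.trans (hl k)).ne'
  have := neg_pos.2 hw
  positivity

theorem phiRealDeriv_pos_iff_left (hc : 0 < c) (hl : ∀ k, 0 < l k) (hw : w < 0) :
    0 < phiRealDeriv l c w ↔ 2 * c < leftSlope l w := by
  rw [phiRealDeriv_eq_leftSlope hl hw, mul_pos_iff_of_pos_left
    (phiRealDeriv_left_factor_pos hc hl hw), sub_pos]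

theorem phiRealDeriv_eq_zero_iff_left (hc : 0 < c) (hl : ∀ k, 0 < l k) (hw : w < 0) :
    phiRealDeriv l c w = 0 ↔ leftSlope l w = 2 * c := by
  rw [phiRealDeriv_eq_leftSlope hl hw, mul_eq_zero_iff_left
    (phiRealDeriv_left_factor_pos hc hl hw).ne', sub_eq_zero]

theorem leftSlope_strictAntiOn (hl : ∀ k, 0 < l k) : StrictAntiOn (leftSlope l) (Set.Iic 0) := by
  intro v (hv : v ≤ 0) w (hw : w ≤ 0) hvw
  have hv' (k) : v < l k := hv.trans_lt (hl k)
  have hw' (k) : w < l k := hw.trans_lt (hl k)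
  exact add_lt_add
    (inv_strictAnti₀ (trRes_pos_left hl hv') (trRes_strictMonoOn_left hl hv' hw' hvw))
    (inv_strictAnti₀ (trResSq_pos hl fun k => (hv' k).ne')
      (trResSq_strictMonoOn_left hl hv' hw' hvw))

theorem inv_trRes_lt_inv_trResSq (hl : ∀ k, 0 < l k) (hw : w < 0) :
    (trRes l w)⁻¹ < (trResSq l w)⁻¹ :=
  inv_strictAnti₀ (trResSq_pos hl fun k => (hw.trans (hl k)).ne') (trResSq_lt_trRes hl hw)

theorem phiRealDeriv_zero_unique_left (hc : 0 < c) (hl : ∀ k, 0 < l k) (hv : v < 0)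
    (hv₀ : phiRealDeriv l c v = 0) (hw : w < 0) (hw₀ : phiRealDeriv l c w = 0) : w = v := by
  rw [phiRealDeriv_eq_zero_iff_left hc hl hv] at hv₀
  rw [phiRealDeriv_eq_zero_iff_left hc hl hw] at hw₀
  exact (leftSlope_strictAntiOn hl).injOn hw.le hv.le (hw₀.trans hv₀.symm)

theorem exists_trRes_eq_one_div (hc : 1 < c) (hl : ∀ k, 0 < l k) :
    ∃ ω, ω < 0 ∧ trRes l ω = 1 / c := by
  have hc₀ : 0 < c := one_pos.trans hc
  have hmean : 0 < 𝔼 k, l k := expect_pos_of_forall_pos hl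
  have hlow : trRes l (-(c * 𝔼 k, l k)) < 1 / c := by
    calc trRes l (-(c * 𝔼 k, l k))
        < 𝔼 k, l k / (c * 𝔼 k, l k) := expect_lt_expect_of_forall_lt fun k =>
          div_lt_div_of_pos_left (hl k) (mul_pos hc₀ hmean) (by linarith [hl k])
      _ = 1 / c := by rw [← Finset.expect_div, div_mul_cancel_right₀ hmean.ne', one_div]
  have hzero : 1 / c < trRes l 0 := by rwa [trRes_zero hl, div_lt_one hc₀]
  obtain ⟨ω, hω, hω_eq⟩ := intermediate_value_Ioo (neg_nonpos.2 (mul_pos hc₀ hmean).le)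
    (fun w hw => (continuousAt_trRes fun k =>
      (hw.2.trans_lt (hl k)).ne').continuousWithinAt) ⟨hlow, hzero⟩
  exact ⟨ω, hω.2, hω_eq⟩

section Maximum

variable {ω x : ℝ}

theorem exists_phiRealDeriv_eq_zero_left (hc : 1 < c) (hl : ∀ k, 0 < l k) (hω : ω < 0)
    (hω_eq : trRes l ω = 1 / c) : ∃ w, ω < w ∧ w < 0 ∧ phiRealDeriv l c w = 0 := by
  have hc₀ : 0 < c := one_pos.trans hc
  have hω_slope : 2 * c < leftSlope l ω := by
    have hlt := inv_trRes_lt_inv_trResSq hl hω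
    rw [hω_eq, one_div, inv_inv] at hlt
    rw [leftSlope, hω_eq, one_div, inv_inv]
    linarith
  have hzero_slope : leftSlope l 0 < 2 * c := by
    rw [leftSlope, trRes_zero hl, trResSq_zero hl]
    linarith
  obtain ⟨w, hw, hw_eq⟩ := intermediate_value_Ioo' hω.le (f := leftSlope l) (fun w hw => by
    have hlt (k) : w < l k := hw.2.trans_lt (hl k)
    exact (((continuousAt_trRes fun k => (hlt k).ne').inv₀ (trRes_pos_left hl hlt).ne').add
      ((continuousAt_trResSq fun k => (hlt k).ne').inv₀
        (trResSq_pos hl fun k => (hlt k).ne').ne')).continuousWithinAt) ⟨hzero_slope, hω_slope⟩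
  exact ⟨w, hw.1, hw.2, (phiRealDeriv_eq_zero_iff_left hc₀ hl hw.2).2 hw_eq⟩

theorem phiReal_le_left (hc : 0 < c) (hl : ∀ k, 0 < l k) (hv : v < 0)
    (hv₀ : phiRealDeriv l c v = 0) (hw : w < 0) : phiReal l c w ≤ phiReal l c v := by
  have hneg (u) (hu : u ∈ Set.uIcc v w) : u < 0 := hu.2.trans_lt (max_lt hv hw)
  refine neg_le_neg_iff.1 (le_of_hasDerivAt_of_mul_sub_nonneg
    (f := fun u => -phiReal l c u) (p := v) (w := w)
    (fun u hu => (hasDerivAt_phiReal fun k => ((hneg u hu).trans (hl k)).ne').fun_neg)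
    fun u hu => ?_)
  have hanti := (leftSlope_strictAntiOn hl).antitoneOn
  have hfactor := phiRealDeriv_left_factor_pos hc hl (hneg u hu)
  rw [phiRealDeriv_eq_zero_iff_left hc hl hv] at hv₀
  rw [phiRealDeriv_eq_leftSlope hl (hneg u hu), ← mul_neg, mul_assoc]
  refine mul_nonneg hfactor.le ?_
  rcases le_total v u with huv | huv
  · have := hanti hv.le (hneg u hu).le huv
    exact mul_nonneg (by linarith) (sub_nonneg.2 huv)
  · have := hanti (hneg u hu).le hv.le huv
    exact mul_nonneg_of_nonpos_of_nonpos (by linarith) (sub_nonpos.2 huv)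

theorem phiReal_pos_left (hc : 0 < c) (hl : ∀ k, 0 < l k) (hω_eq : trRes l ω = 1 / c)
    (hωw : ω < w) (hw : w < 0) : 0 < phiReal l c w := by
  have hlt (k) : w < l k := hw.trans (hl k)
  have hpos := trRes_pos_left hl hlt
  have hgt : 1 / c < trRes l w :=
    hω_eq ▸ trRes_strictMonoOn_left hl (fun k => hωw.trans (hlt k)) hlt hωw
  rw [div_lt_iff₀' hc] at hgt
  have := hw.ne
  exact mul_pos (by positivity) (sub_pos.2 hgt)

theorem phiReal_lt_sq_left (hc : 0 < c) (hl : ∀ k, 0 < l k) (hw : w < 0) :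
    phiReal l c w < (c * 𝔼 k, l k) ^ 2 := by
  have hpos (k) : 0 < l k - w := sub_pos.2 (hw.trans (hl k))
  have hG_pos : 0 < c * -(w * trRes l w) :=
    mul_pos hc (neg_pos.2 (mul_neg_of_neg_of_pos hw
      (trRes_pos_left hl fun k => hw.trans (hl k))))
  have hG_lt : c * -(w * trRes l w) < c * 𝔼 k, l k := by
    refine mul_lt_mul_of_pos_left ?_ hc
    rw [mul_trRes_eq fun k => (hw.trans (hl k)).ne', ← Finset.expect_neg_distrib]
    exact expect_lt_expect_of_forall_lt fun k => by
      have := div_pos (pow_pos (hl k) 2) (hpos k)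
      linarith
  rw [phiReal_eq]
  nlinarith

theorem exists_phiReal_eq_left (hc : 0 < c) (hl : ∀ k, 0 < l k) (hω_eq : trRes l ω = 1 / c)
    (hωv : ω < v) (hv : v < 0) (hv₀ : phiRealDeriv l c v = 0) (hx : 0 < x)
    (hxv : x < phiReal l c v) :
    ∃ w, w < 0 ∧ phiReal l c w = x ∧ 0 < phiRealDeriv l c w := by
  have hω_zero : phiReal l c ω = 0 := by
    rw [phiReal, hω_eq, mul_one_div_cancel hc.ne', sub_self, mul_zero]
  obtain ⟨w, hw, rfl⟩ := intermediate_value_Ioo hωv.le (fun u hu => (hasDerivAt_phiReal fun k =>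
    (hu.2.trans_lt (hv.trans (hl k))).ne').continuousAt.continuousWithinAt)
    ⟨hω_zero.symm ▸ hx, hxv⟩
  have hw₀ : w < 0 := hw.2.trans hv
  refine ⟨w, hw₀, rfl, (phiRealDeriv_pos_iff_left hc hl hw₀).2 ?_⟩
  rw [← (phiRealDeriv_eq_zero_iff_left hc hl hv).1 hv₀]
  exact leftSlope_strictAntiOn hl hw₀.le hv.le hw.2

theorem mul_trResSq_lt_one_left (hc : 0 < c) (hl : ∀ k, 0 < l k) (hw : w < 0)
    (hd : 0 < phiRealDeriv l c w) : c * trResSq l w < 1 := by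
  have hslope := (phiRealDeriv_pos_iff_left hc hl hw).1 hd
  have hinv := inv_trRes_lt_inv_trResSq hl hw
  rw [leftSlope] at hslope
  rw [← lt_inv_mul_iff₀' (trResSq_pos hl fun k => (hw.trans (hl k)).ne'), mul_one]
  linarith

end Maximum

end LeftOfSpectrum

section Support

variable {ι : Type*} [Fintype ι] [Nonempty ι] {l : ι → ℝ} {c : ℝ}

theorem isWTransform_of_isScalarSolution (hc : 0 < c) (hl : ∀ k, 0 < l k) {μ : Measure ℝ}
    (hμ : ∀ z : ℂ, 0 < z.im → IsScalarSolution l c z (stieltjes μ z)) :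
    IsWTransform l c μ fun w => w * trResC l w where
  exists_eq z hz := by
    have h := hμ z hz
    have hz₀ : z ≠ 0 := fun h₀ => hz.ne' (by rw [h₀, Complex.zero_im])
    exact ⟨_, im_resolventPoint_pos hc h.1 h.2.1, h.contractionRatio_lt_one hc hz₀,
      h.phiComplex_resolventPoint hc hz₀, h.mul_eq hc hz₀⟩
  analyticAt w hw := analyticAt_id.fun_mul (analyticAt_trResC hw)
  map_conj w := by rw [trResC_conj, map_mul]
  im_pos w hw := by
    have hne (k) : (l k : ℂ) - w ≠ 0 := ofReal_sub_ne_zero _ hw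
    refine pos_of_mul_pos_right ?_ hc.le
    rw [im_mul_trResC c hne]
    exact mul_pos hw (contractionRatio_pos hc hl hne)

theorem isWTransform_of_expect_resolventEigenvalue (hc : 0 < c) (hl : ∀ k, 0 < l k)
    {μ ν : Measure ℝ} (hμ : ∀ z : ℂ, 0 < z.im → IsScalarSolution l c z (stieltjes μ z))
    (hν : ∀ z : ℂ, 0 < z.im →
      stieltjes ν z = 𝔼 k, resolventEigenvalue (l k) c z (stieltjes μ z)) :
    IsWTransform l c ν fun w => trResC l w - 1 where
  exists_eq z hz := by
    have h := hμ z hz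
    have hz₀ : z ≠ 0 := fun h₀ => hz.ne' (by rw [h₀, Complex.zero_im])
    refine ⟨_, im_resolventPoint_pos hc h.1 h.2.1, h.contractionRatio_lt_one hc hz₀,
      h.phiComplex_resolventPoint hc hz₀, ?_⟩
    rw [hν z hz, h.mul_expect_resolventEigenvalue hc hz₀]
  analyticAt w hw := (analyticAt_trResC hw).fun_sub analyticAt_const
  map_conj w := by rw [trResC_conj, map_sub, map_one]
  im_pos w hw := by
    rw [Complex.sub_im, Complex.one_im, sub_zero, im_trResC]
    exact mul_pos hw (expect_pos_of_forall_pos fun k =>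
      div_pos (hl k) (pow_pos (norm_pos_iff.2 (ofReal_sub_ne_zero _ hw)) 2))

/-- The support has no gap coming from between two eigenvalues: a real point with contraction ratio
at most `1` lies to the left or to the right of all the eigenvalues. -/
def NoInteriorGap (l : ι → ℝ) (c : ℝ) : Prop :=
  ∀ w : ℝ, (∀ k, l k ≠ w) → c * trResSq l w ≤ 1 → (∀ k, w < l k) ∨ (∀ k, l k < w)

theorem notMem_support_of_lt_zero {τ : Measure ℝ} (h : τ (Set.Iio 0) = 0) {x : ℝ} (hx : x < 0) :
    x ∉ τ.support :=
  Measure.notMem_support_iff_exists.2 ⟨_, Iio_mem_nhds hx, h⟩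

namespace IsWTransform

variable {τ : Measure ℝ} [IsFiniteMeasure τ] {F : ℂ → ℂ} {u v w x ω : ℝ}

theorem mem_support (hc : 0 < c) (hl : ∀ k, 0 < l k) (hgap : NoInteriorGap l c)
    (h : IsWTransform l c τ F) (hx : 0 < x) (hleft : ∀ w < 0, phiReal l c w < x)
    (hright : ∀ w, (∀ k, l k < w) → x < phiReal l c w) : x ∈ τ.support := by
  by_contra hmem
  obtain ⟨w, hne, hratio, hphi, -⟩ := h.exists_ofReal hc hl hmem
  rw [contractionRatio_ofReal] at hratio
  rw [phiComplex_ofReal, Complex.ofReal_inj] at hphi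
  rcases hgap w hne hratio with hw | hw
  · rcases lt_or_ge w 0 with hw₀ | hw₀
    · exact (hleft w hw₀).ne hphi
    · exact ((phiReal_nonpos_of_mul_trResSq_le_one hc hl hw₀ hw hratio).trans_lt hx).ne hphi
  · exact (hright w hw).ne' hphi

theorem phiReal_notMem_support (hc : 0 < c) (hl : ∀ k, 0 < l k) (h : IsWTransform l c τ F)
    (hne : ∀ k, l k ≠ w) (hratio : c * trResSq l w < 1) (hphi : phiReal l c w ≠ 0)
    (hd : 0 < phiRealDeriv l c w) : phiReal l c w ∉ τ.support :=
  h.notMem_support hc hl hne (by rwa [contractionRatio_ofReal]) (phiComplex_ofReal l c w) hphi hd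
    (hasDerivAt_phiComplex hne)

theorem notMem_support_of_phiReal_lt (hc : 0 < c) (hl : ∀ k, 0 < l k) (h : IsWTransform l c τ F)
    (hv : ∀ k, l k < v) (hv₀ : phiRealDeriv l c v = 0) (hx : phiReal l c v < x) :
    x ∉ τ.support := by
  obtain ⟨w, hw, rfl, hd⟩ := exists_phiReal_eq_right hc hl hv hv₀ hx
  exact h.phiReal_notMem_support hc hl (fun k => (hw k).ne)
    (mul_trResSq_lt_one_right hc hl hw hd)
    ((sq_nonneg _).trans_lt (sq_lt_phiReal_right hc hl hw).1).ne' hd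

theorem notMem_support_of_lt_phiReal (hc : 0 < c) (hl : ∀ k, 0 < l k) (h : IsWTransform l c τ F)
    (hω_eq : trRes l ω = 1 / c) (hωu : ω < u) (hu : u < 0) (hu₀ : phiRealDeriv l c u = 0)
    (hx : 0 < x) (hxu : x < phiReal l c u) : x ∉ τ.support := by
  obtain ⟨w, hw, rfl, hd⟩ := exists_phiReal_eq_left hc hl hω_eq hωu hu hu₀ hx hxu
  exact h.phiReal_notMem_support hc hl (fun k => (hw.trans (hl k)).ne')
    (mul_trResSq_lt_one_left hc hl hw hd) hx.ne' hd

theorem support_eq_Icc (hc : 0 < c) (hc₁ : c ≤ 1) (hl : ∀ k, 0 < l k) (hgap : NoInteriorGap l c)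
    (h : IsWTransform l c τ F) (hτ : τ (Set.Iio 0) = 0) (hv : ∀ k, l k < v)
    (hv₀ : phiRealDeriv l c v = 0) : τ.support = Set.Icc 0 (phiReal l c v) := by
  have hpos : 0 < phiReal l c v := (sq_nonneg _).trans_lt (sq_lt_phiReal_right hc hl hv).1
  refine Set.Subset.antisymm (fun x hx => ⟨not_lt.1 fun hneg => ?_, not_lt.1 fun hgt => ?_⟩) ?_
  · exact notMem_support_of_lt_zero hτ hneg hx
  · exact h.notMem_support_of_phiReal_lt hc hl hv hv₀ hgt hx
  · rw [← closure_Ioo hpos.ne]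
    refine closure_minimal (fun x hx => ?_) Measure.isClosed_support
    exact h.mem_support hc hl hgap hx.1 (fun w hw => (phiReal_neg_left hc hc₁ hl hw).trans hx.1)
      fun w hw => hx.2.trans_le (phiReal_le_right hc hl hv hv₀ hw)

theorem support_eq_union (hc : 0 < c) (hl : ∀ k, 0 < l k) (hgap : NoInteriorGap l c)
    (h : IsWTransform l c τ F) (hτ : τ (Set.Iio 0) = 0) (hzero : 0 ∈ τ.support)
    (hω_eq : trRes l ω = 1 / c) (hωu : ω < u) (hu : u < 0) (hu₀ : phiRealDeriv l c u = 0)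
    (hv : ∀ k, l k < v) (hv₀ : phiRealDeriv l c v = 0) :
    τ.support = {0} ∪ Set.Icc (phiReal l c u) (phiReal l c v) := by
  have hpos := phiReal_pos_left hc hl hω_eq hωu hu
  have hlt := (phiReal_lt_sq_left hc hl hu).trans (sq_lt_phiReal_right hc hl hv).1
  refine Set.Subset.antisymm (fun x hx => ?_)
    (Set.union_subset (Set.singleton_subset_iff.2 hzero) ?_)
  · rcases lt_trichotomy x 0 with hneg | rfl | hx₀
    · exact absurd hx (notMem_support_of_lt_zero hτ hneg)
    · exact Or.inl rfl
    · refine Or.inr ⟨not_lt.1 fun hxu => ?_, not_lt.1 fun hvx => ?_⟩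
      · exact h.notMem_support_of_lt_phiReal hc hl hω_eq hωu hu hu₀ hx₀ hxu hx
      · exact h.notMem_support_of_phiReal_lt hc hl hv hv₀ hvx hx
  · rw [← closure_Ioo hlt.ne]
    refine closure_minimal (fun x hx => ?_) Measure.isClosed_support
    exact h.mem_support hc hl hgap (hpos.trans hx.1)
      (fun w hw => (phiReal_le_left hc hl hu hu₀ hw).trans_lt hx.1)
      fun w hw => hx.2.trans_le (phiReal_le_right hc hl hv hv₀ hw)

theorem zero_mem_support_of_mul_trResC (hc : 1 < c) (hl : ∀ k, 0 < l k) (hgap : NoInteriorGap l c)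
    (h : IsWTransform l c τ fun w => w * trResC l w) : 0 ∈ τ.support := by
  by_contra hmem
  obtain ⟨w, hne, hratio, -, hF⟩ := h.exists_ofReal (one_pos.trans hc) hl hmem
  rw [contractionRatio_ofReal] at hratio
  rw [Complex.ofReal_zero, zero_mul, trResC_ofReal, ← Complex.ofReal_mul,
    Complex.ofReal_eq_zero] at hF
  rcases mul_eq_zero.1 hF with rfl | htr
  · rw [trResSq_zero hl, mul_one] at hratio
    exact hc.not_ge hratio
  · rcases hgap w hne hratio with hw | hw
    · exact (trRes_pos_left hl hw).ne' htr
    · exact (trRes_neg_right hl hw).ne htr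

theorem zero_mem_support_of_trResC_sub_one (hc : 1 < c) (hl : ∀ k, 0 < l k)
    (h : IsWTransform l c τ fun w => trResC l w - 1) : 0 ∈ τ.support := by
  by_contra hmem
  have hc₀ : 0 < c := one_pos.trans hc
  obtain ⟨w, -, hratio, hphi, hF⟩ := h.exists_ofReal hc₀ hl hmem
  rw [contractionRatio_ofReal] at hratio
  rw [Complex.ofReal_zero, zero_mul, trResC_ofReal, ← Complex.ofReal_one, ← Complex.ofReal_sub,
    Complex.ofReal_eq_zero, sub_eq_zero] at hF
  rw [phiComplex_ofReal, Complex.ofReal_inj, phiReal, hF, mul_one, mul_one] at hphi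
  have hw : w = 0 := by
    simpa only [mul_eq_zero, hc₀.ne', (sub_pos.2 hc).ne', or_false, false_or,
      pow_eq_zero_iff two_ne_zero] using hphi
  rw [hw, trResSq_zero hl, mul_one] at hratio
  exact hc.not_ge hratio

end IsWTransform

end Support

section Spacing

theorem exists_lt_iff_of_antitone {n : ℕ} {e : Fin n → ℝ} (he : Antitone e) {w : ℝ}
    (hne : ∀ k, e k ≠ w) (hlt : ∃ k, e k < w) : ∃ p < n, ∀ k : Fin n, (k : ℕ) < p ↔ w < e k := by
  classical
  have hex : ∃ p, ∃ hp : p < n, e ⟨p, hp⟩ < w := hlt.elim fun k hk => ⟨k, k.2, hk⟩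
  obtain ⟨hp, hpw⟩ := Nat.find_spec hex
  refine ⟨Nat.find hex, hp, fun k => ⟨fun hk => ?_, fun hk => not_le.1 fun hle => ?_⟩⟩
  · exact (not_lt.1 fun hkw => Nat.find_min hex hk ⟨k.2, hkw⟩).lt_of_ne (hne k).symm
  · exact hk.not_gt ((he (Fin.le_def.2 hle)).trans_lt hpw)

theorem mul_one_div_le_one_div_sq_of_spacing {n : ℕ} {e : Fin n → ℝ} {κ : ℝ} (hκ : 0 < κ)
    (hspacing : ∀ k m : Fin n, k ≤ m →
      |e k - e m| ≤ κ * (|((k : ℕ) : ℝ) - ((m : ℕ) : ℝ)| / n) ^ (1 / 2 : ℝ))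
    {k m : Fin n} (hkm : k < m) {d : ℝ} (hd : 0 < d) (hle : d ≤ e k - e m) :
    n / κ ^ 2 * (1 / ((m : ℕ) - (k : ℕ) : ℝ)) ≤ 1 / d ^ 2 := by
  have hn : (0 : ℝ) < n := by exact_mod_cast k.pos
  have hr : (0 : ℝ) < (m : ℕ) - (k : ℕ) := sub_pos.2 (by exact_mod_cast hkm)
  have hdκ : d ≤ κ * √(((m : ℕ) - (k : ℕ)) / n) := by
    have h := hspacing k m hkm.le
    rw [abs_sub_comm (k : ℝ), abs_of_pos hr, ← Real.sqrt_eq_rpow] at h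
    exact hle.trans ((le_abs_self _).trans h)
  calc n / κ ^ 2 * (1 / ((m : ℕ) - (k : ℕ) : ℝ))
      = 1 / (κ * √(((m : ℕ) - (k : ℕ)) / n)) ^ 2 := by
        rw [mul_pow, Real.sq_sqrt (div_pos hr hn).le]
        field_simp
    _ ≤ 1 / d ^ 2 := by gcongr

theorem mul_sum_add_sum_le_of_spacing {p q : ℕ} {e : Fin (p + q) → ℝ} {κ w : ℝ} (hp : 0 < p)
    (hq : 0 < q) (hκ : 0 < κ)
    (hspacing : ∀ k m : Fin (p + q), k ≤ m →
      |e k - e m| ≤ κ * (|((k : ℕ) : ℝ) - ((m : ℕ) : ℝ)| / (p + q : ℕ)) ^ (1 / 2 : ℝ))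
    (hleft : ∀ i, w < e (Fin.castAdd q i)) (hright : ∀ i, e (Fin.natAdd p i) < w) :
    (p + q : ℕ) / κ ^ 2 * (∑ i ∈ Finset.range p, 1 / ((i : ℝ) + 1) +
      ∑ i ∈ Finset.range q, 1 / ((i : ℝ) + 1)) ≤ ∑ k, 1 / (e k - w) ^ 2 := by
  have hterm {k m : Fin (p + q)} (hkm : k < m) {d : ℝ} :=
    mul_one_div_le_one_div_sq_of_spacing hκ hspacing hkm (d := d)
  -- From either side, the distance to `w` is less than that to the first eigenvalue beyond `w`.
  have hleft_term (i : Fin p) : (p + q : ℕ) / κ ^ 2 * (1 / (((i.rev : ℕ) : ℝ) + 1)) ≤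
      1 / (e (Fin.castAdd q i) - w) ^ 2 := by
    have hlt : Fin.castAdd q i < Fin.natAdd p ⟨0, hq⟩ := Fin.lt_def.2 i.2
    convert hterm hlt (sub_pos.2 (hleft i)) (sub_le_sub_left (hright _).le _) using 3
    rw [Fin.val_rev, Nat.cast_sub i.2, Fin.val_natAdd, Fin.val_castAdd]
    push_cast
    ring
  have hright_term (i : Fin q) : (p + q : ℕ) / κ ^ 2 * (1 / (((i : ℕ) : ℝ) + 1)) ≤
      1 / (e (Fin.natAdd p i) - w) ^ 2 := by
    have hlt : Fin.castAdd q ⟨p - 1, Nat.sub_one_lt hp.ne'⟩ < Fin.natAdd p i :=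
      Fin.lt_def.2 ((Nat.sub_one_lt hp.ne').trans_le (Nat.le_add_right p i))
    rw [← neg_sub w, neg_sq]
    convert hterm hlt (sub_pos.2 (hright i)) (sub_le_sub_right (hleft _).le _) using 3
    rw [Fin.val_natAdd, Fin.val_castAdd, Nat.cast_sub hp]
    push_cast
    ring
  rw [Fin.sum_univ_add, mul_add, Finset.mul_sum, Finset.mul_sum,
    ← Fin.sum_univ_eq_sum_range (fun i => (p + q : ℕ) / κ ^ 2 * (1 / ((i : ℝ) + 1))),
    ← Fin.sum_univ_eq_sum_range (fun i => (p + q : ℕ) / κ ^ 2 * (1 / ((i : ℝ) + 1))),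
    ← Equiv.sum_comp Fin.revPerm]
  exact add_le_add (Finset.sum_le_sum fun i _ => hleft_term i)
    (Finset.sum_le_sum fun i _ => hright_term i)

theorem mul_sum_le_sum_one_div_sq_of_spacing {n : ℕ} {e : Fin n → ℝ} (he : Antitone e) {κ w : ℝ}
    (hκ : 0 < κ) (hspacing : ∀ k m : Fin n, k ≤ m →
      |e k - e m| ≤ κ * (|((k : ℕ) : ℝ) - ((m : ℕ) : ℝ)| / n) ^ (1 / 2 : ℝ))
    (hne : ∀ k, e k ≠ w) (hgt : ∃ k, w < e k) (hlt : ∃ k, e k < w) :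
    n / κ ^ 2 * ∑ i ∈ Finset.range (n / 2), 1 / ((i : ℝ) + 1) ≤ ∑ k, 1 / (e k - w) ^ 2 := by
  obtain ⟨p, hpn, hp⟩ := exists_lt_iff_of_antitone he hne hlt
  obtain ⟨q, rfl⟩ := exists_add_of_le hpn.le
  have hq₀ : 0 < q := (Nat.lt_add_right_iff_pos).1 hpn
  have hp₀ : 0 < p := hgt.elim fun k hk => (Nat.zero_le _).trans_lt ((hp k).2 hk)
  refine le_trans ?_ (mul_sum_add_sum_le_of_spacing hp₀ hq₀ hκ hspacing
    (fun i => (hp _).1 i.2)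
    fun i => (not_lt.1 fun hw => ((hp _).2 hw).not_ge (Nat.le_add_right p i)).lt_of_ne (hne _))
  have hmono : Monotone fun k => ∑ i ∈ Finset.range k, 1 / ((i : ℝ) + 1) := fun a b hab =>
    Finset.sum_le_sum_of_subset_of_nonneg (Finset.range_mono hab) fun i _ _ => by positivity
  have hnonneg (k : ℕ) : 0 ≤ ∑ i ∈ Finset.range k, 1 / ((i : ℝ) + 1) :=
    Finset.sum_nonneg fun i _ => by positivity
  gcongr
  rcases le_total p q with hpq | hqp
  · exact (hmono (by omega)).trans (le_add_of_nonneg_left (hnonneg p))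
  · exact (hmono (by omega)).trans (le_add_of_nonneg_right (hnonneg q))

end Spacing

section Trace

variable {n : Type*} [Fintype n] [DecidableEq n]

theorem le_eigenvalues_of_posSemidef_sub {𝕜 : Type*} [RCLike 𝕜] {A : Matrix n n 𝕜} {a : ℝ}
    (hA : A.IsHermitian) (h : (A - (a : 𝕜) • (1 : Matrix n n 𝕜)).PosSemidef) (k : n) :
    a ≤ hA.eigenvalues k := by
  have hquad := h.re_dotProduct_nonneg (hA.eigenvectorBasis k : n → 𝕜)
  have hnorm : star (hA.eigenvectorBasis k : n → 𝕜) ⬝ᵥ (hA.eigenvectorBasis k : n → 𝕜) = 1 := by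
    rw [dotProduct_comm, ← EuclideanSpace.inner_eq_star_dotProduct, inner_self_eq_norm_sq_to_K,
      hA.eigenvectorBasis.orthonormal.1 k, RCLike.ofReal_one, one_pow]
  rwa [Matrix.sub_mulVec, dotProduct_sub, Matrix.smul_mulVec, Matrix.one_mulVec, dotProduct_smul,
    hnorm, map_sub, ← hA.eigenvalues_eq, smul_eq_mul, mul_one, RCLike.ofReal_re, sub_nonneg]
    at hquad

theorem inv_smul_one_add_smul {A : Matrix n n ℂ} (hA : A.IsHermitian) {α β : ℂ}
    (h : ∀ k, α + β * hA.eigenvalues k ≠ 0) :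
    (α • (1 : Matrix n n ℂ) + β • A)⁻¹ = Unitary.conjStarAlgAut ℂ _ hA.eigenvectorUnitary
      (Matrix.diagonal fun k => (α + β * hA.eigenvalues k)⁻¹) := by
  have hdiag : α • (1 : Matrix n n ℂ) + β • A = Unitary.conjStarAlgAut ℂ _ hA.eigenvectorUnitary
      (Matrix.diagonal fun k => α + β * hA.eigenvalues k) := by
    conv_lhs => rw [hA.spectral_theorem]
    rw [← map_one (Unitary.conjStarAlgAut ℂ _ hA.eigenvectorUnitary), ← map_smul, ← map_smul,
      ← map_add, ← Matrix.diagonal_one, ← Matrix.diagonal_smul, ← Matrix.diagonal_smul,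
      Matrix.diagonal_add]
    simp only [Pi.smul_apply, Function.comp_apply, smul_eq_mul, mul_one,
      RCLike.ofReal_eq_complex_ofReal]
  rw [hdiag]
  refine Matrix.inv_eq_right_inv ?_
  rw [← map_mul, Matrix.diagonal_mul_diagonal]
  simp only [mul_inv_cancel₀ (h _), Matrix.diagonal_one, map_one]

variable {M : ℕ} {R : Matrix (Fin M) (Fin M) ℂ} {α β : ℂ}

theorem ntr_conjStarAlgAut_diagonal (U : unitary (Matrix (Fin M) (Fin M) ℂ)) (d : Fin M → ℂ) :
    ntr (Unitary.conjStarAlgAut ℂ _ U (Matrix.diagonal d)) = 𝔼 k, d k := by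
  rw [ntr, Unitary.conjStarAlgAut_apply, Matrix.trace_mul_cycle, Unitary.coe_star_mul_self,
    one_mul, Matrix.trace_diagonal, Fintype.expect_eq_sum_div_card, Fintype.card_fin,
    one_div_mul_eq_div]

theorem ntr_inv (hR : R.IsHermitian) (h : ∀ k, α + β * hR.eigenvalues k ≠ 0) :
    ntr (α • (1 : Matrix (Fin M) (Fin M) ℂ) + β • R)⁻¹ =
      𝔼 k, (α + β * hR.eigenvalues k)⁻¹ := by
  rw [inv_smul_one_add_smul hR h, ntr_conjStarAlgAut_diagonal]

theorem ntr_mul_inv (hR : R.IsHermitian) (h : ∀ k, α + β * hR.eigenvalues k ≠ 0) :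
    ntr (R * (α • (1 : Matrix (Fin M) (Fin M) ℂ) + β • R)⁻¹) =
      𝔼 k, hR.eigenvalues k * (α + β * hR.eigenvalues k)⁻¹ := by
  rw [inv_smul_one_add_smul hR h]
  conv_lhs => enter [1, 1]; rw [hR.spectral_theorem]
  rw [← map_mul, Matrix.diagonal_mul_diagonal, ntr_conjStarAlgAut_diagonal]
  rfl

end Trace

section Matrix

variable {M : ℕ} {c : ℝ} {R : Matrix (Fin M) (Fin M) ℂ} {z t : ℂ} {w : ℝ}

theorem resolventEigenvalue_ne_zero (l : ℝ) (hc : 0 < c) (hz : z ≠ 0) (ht : 0 < t.im)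
    (hzt : 0 < (z * t).im) : resolventEigenvalue l c z t ≠ 0 := by
  have him := im_resolventPoint_pos hc ht hzt
  have hw : resolventPoint c z t ≠ 0 := fun h => him.ne' (by rw [h, Complex.zero_im])
  have ht₀ : t ≠ 0 := fun h => ht.ne' (by rw [h, Complex.zero_im])
  rw [resolventEigenvalue_eq l hc.ne' ht₀ hw]
  exact mul_ne_zero (div_ne_zero hw hz) (inv_ne_zero (ofReal_sub_ne_zero l him))

theorem resolventT_eq (R : Matrix (Fin M) (Fin M) ℂ) (c : ℝ) (z t : ℂ) :
    resolventT R c z t = ((-z) • (1 : Matrix (Fin M) (Fin M) ℂ) +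
      (-(z * c * t / (1 - z * c ^ 2 * t ^ 2))) • R)⁻¹ := by
  rw [resolventT, neg_smul, neg_smul, sub_eq_add_neg]

theorem resolventEigenvalue_eq_inv (l c : ℝ) (z t : ℂ) :
    resolventEigenvalue l c z t = (-z + -(z * c * t / (1 - z * c ^ 2 * t ^ 2)) * l)⁻¹ := by
  rw [resolventEigenvalue, neg_mul, ← sub_eq_add_neg]

theorem ntr_resolventT (hc : 0 < c) (hR : R.IsHermitian) (hz : z ≠ 0) (ht : 0 < t.im)
    (hzt : 0 < (z * t).im) :
    ntr (resolventT R c z t) = 𝔼 k, resolventEigenvalue (hR.eigenvalues k) c z t := by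
  have hne (k) := resolventEigenvalue_ne_zero (hR.eigenvalues k) hc hz ht hzt
  simp only [resolventEigenvalue_eq_inv, ne_eq, inv_eq_zero] at hne ⊢
  rw [resolventT_eq, ntr_inv hR hne]

theorem ntr_mul_resolventT (hc : 0 < c) (hR : R.IsHermitian) (hz : z ≠ 0) (ht : 0 < t.im)
    (hzt : 0 < (z * t).im) :
    ntr (R * resolventT R c z t) =
      𝔼 k, hR.eigenvalues k * resolventEigenvalue (hR.eigenvalues k) c z t := by
  have hne (k) := resolventEigenvalue_ne_zero (hR.eigenvalues k) hc hz ht hzt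
  simp only [resolventEigenvalue_eq_inv, ne_eq, inv_eq_zero] at hne ⊢
  rw [resolventT_eq, ntr_mul_inv hR hne]

theorem isCanonicalSolution_iff (hc : 0 < c) (hR : R.IsHermitian) (hz : 0 < z.im) :
    IsCanonicalSolution R c z t ↔ IsScalarSolution hR.eigenvalues c z t := by
  have hz₀ : z ≠ 0 := fun h => hz.ne' (by rw [h, Complex.zero_im])
  exact and_congr_right fun ht => and_congr_right fun hzt => by
    rw [ntr_mul_resolventT hc hR hz₀ ht hzt]

theorem isMu_mu [NeZero M] (hc : 0 < c) (hR : R.IsHermitian) (hl : ∀ k, 0 < hR.eigenvalues k) :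
    IsMu R c (mu R c) := by
  have hex : ∃ μ, IsMu R c μ := by
    obtain ⟨μ, _, hμ, -, hsol⟩ := exists_scalar_measures hc hl
    exact ⟨μ, hμ.1, hμ.2, fun z hz => (isCanonicalSolution_iff hc hR hz).2 (hsol z hz).1⟩
  rw [mu, dif_pos hex]
  exact hex.choose_spec

theorem isScalarSolution_stieltjes_mu [NeZero M] (hc : 0 < c) (hR : R.IsHermitian)
    (hl : ∀ k, 0 < hR.eigenvalues k) (hz : 0 < z.im) :
    IsScalarSolution hR.eigenvalues c z (stieltjes (mu R c) z) :=
  (isCanonicalSolution_iff hc hR hz).1 ((isMu_mu hc hR hl).2.2 z hz)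

theorem ntr_resolventT_tfun [NeZero M] (hc : 0 < c) (hR : R.IsHermitian)
    (hl : ∀ k, 0 < hR.eigenvalues k) (hz : 0 < z.im) :
    ntr (resolventT R c z (tfun R c z)) =
      𝔼 k, resolventEigenvalue (hR.eigenvalues k) c z (stieltjes (mu R c) z) := by
  have hsol := isScalarSolution_stieltjes_mu hc hR hl hz
  exact ntr_resolventT hc hR (fun h => hz.ne' (by rw [h, Complex.zero_im])) hsol.1 hsol.2.1

theorem isNu_nu [NeZero M] (hc : 0 < c) (hR : R.IsHermitian) (hl : ∀ k, 0 < hR.eigenvalues k) :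
    IsNu R c (nu R c) := by
  have hex : ∃ ν, IsNu R c ν := by
    obtain ⟨μ, ν, -, hν, hsol⟩ := exists_scalar_measures hc hl
    refine ⟨ν, hν.1, hν.2, fun z hz => ?_⟩
    rw [ntr_resolventT_tfun hc hR hl hz, (hsol z hz).2,
      (isScalarSolution_stieltjes_mu hc hR hl hz).unique hc hl hz (hsol z hz).1]
  rw [nu, dif_pos hex]
  exact hex.choose_spec

theorem rtr_eq (hR : R.IsHermitian) (h : ∀ k, hR.eigenvalues k ≠ w) :
    rtr R w = trRes hR.eigenvalues w := by
  have hsub (k) : -(w : ℂ) + 1 * hR.eigenvalues k = hR.eigenvalues k - w := by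
    rw [one_mul, neg_add_eq_sub]
  have hne (k) : -(w : ℂ) + 1 * hR.eigenvalues k ≠ 0 := by
    rw [hsub, sub_ne_zero, Ne, Complex.ofReal_inj]
    exact h k
  have hlin : R - (w : ℂ) • (1 : Matrix (Fin M) (Fin M) ℂ) =
      (-(w : ℂ)) • (1 : Matrix (Fin M) (Fin M) ℂ) + (1 : ℂ) • R := by
    rw [neg_smul, one_smul, neg_add_eq_sub]
  rw [rtr, hlin, ntr_mul_inv hR hne]
  simp only [hsub, ← div_eq_mul_inv]
  rw [← trResC, trResC_ofReal, Complex.ofReal_re]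

theorem phi_eq (c : ℝ) (hR : R.IsHermitian) (h : ∀ k, hR.eigenvalues k ≠ w) :
    phi R c w = phiReal hR.eigenvalues c w := by
  rw [phi, rtr_eq hR h, phiReal]

theorem deriv_phi (c : ℝ) (hR : R.IsHermitian) (h : ∀ k, hR.eigenvalues k ≠ w) :
    deriv (phi R c) w = phiRealDeriv hR.eigenvalues c w := by
  have heq : phi R c =ᶠ[𝓝 w] phiReal hR.eigenvalues c := by
    filter_upwards [eventually_all.2 fun k => eventually_ne_nhds (h k).symm] with v hv
    exact phi_eq c hR fun k => (hv k).symm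
  rw [heq.deriv_eq, (hasDerivAt_phiReal h).deriv]

theorem isWPlus_iff (hR : R.IsHermitian) : IsWPlus hR c w ↔
    (∀ k, hR.eigenvalues k < w) ∧ phiRealDeriv hR.eigenvalues c w = 0 := by
  have hindex : (∀ k, hR.eigenvalues₀ k < w) ↔ ∀ k, hR.eigenvalues k < w :=
    (Fintype.equivOfCardEq (Fintype.card_fin _)).forall_congr_left
  rw [IsWPlus, hindex]
  exact and_congr_right fun h => by rw [deriv_phi c hR fun k => (h k).ne]

theorem isXPlus_phiReal [NeZero M] (hc : 0 < c) (hR : R.IsHermitian)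
    (hl : ∀ k, 0 < hR.eigenvalues k) (hw : ∀ k, hR.eigenvalues k < w)
    (hw₀ : phiRealDeriv hR.eigenvalues c w = 0) :
    IsXPlus hR c (phiReal hR.eigenvalues c w) := by
  refine ⟨w, (isWPlus_iff hR).2 ⟨hw, hw₀⟩, fun v hv => ?_, (phi_eq c hR fun k => (hw k).ne).symm⟩
  obtain ⟨hv, hv₀⟩ := (isWPlus_iff hR).1 hv
  exact (phiRealDeriv_strictMonoOn_right hc hl).injOn hv hw (hv₀.trans hw₀.symm)

theorem isLeast_rtr_eq_one_div [NeZero M] (hR : R.IsHermitian) (hl : ∀ k, 0 < hR.eigenvalues k)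
    {ω : ℝ} (hω : ω < 0) (hω_eq : trRes hR.eigenvalues ω = 1 / c) :
    IsLeast {v | rtr R v = 1 / c} ω := by
  have hlt {v : ℝ} (hv : v ≤ ω) (k) : v < hR.eigenvalues k := hv.trans_lt (hω.trans (hl k))
  refine ⟨(rtr_eq hR fun k => (hlt le_rfl k).ne').trans hω_eq, fun v hv => not_lt.1 fun hvω => ?_⟩
  have htr := trRes_strictMonoOn_left hl (hlt hvω.le) (hlt le_rfl) hvω
  rw [← rtr_eq hR fun k => (hlt hvω.le k).ne', hω_eq] at htr
  exact htr.ne hv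

theorem isXMinus_phiReal [NeZero M] (hc : 0 < c) (hR : R.IsHermitian)
    (hl : ∀ k, 0 < hR.eigenvalues k) {ω : ℝ} (hω_eq : trRes hR.eigenvalues ω = 1 / c)
    (hωw : ω < w) (hw : w < 0) (hw₀ : phiRealDeriv hR.eigenvalues c w = 0) :
    IsXMinus R c (phiReal hR.eigenvalues c w) := by
  have hne {v : ℝ} (hv : v < 0) (k) : hR.eigenvalues k ≠ v := (hv.trans (hl k)).ne'
  refine ⟨w, ⟨⟨ω, isLeast_rtr_eq_one_div hR hl (hωw.trans hw) hω_eq, hωw⟩, hw, ?_⟩,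
    fun v hv => ?_, (phi_eq c hR (hne hw)).symm⟩
  · rw [deriv_phi c hR (hne hw), hw₀]
  · obtain ⟨-, hv, hv₀⟩ := hv
    rw [deriv_phi c hR (hne hv)] at hv₀
    exact phiRealDeriv_zero_unique_left hc hl hw hw₀ hv hv₀

theorem isWTransform_mu [NeZero M] (hc : 0 < c) (hR : R.IsHermitian)
    (hl : ∀ k, 0 < hR.eigenvalues k) :
    IsWTransform hR.eigenvalues c (mu R c) fun w => w * trResC hR.eigenvalues w :=
  isWTransform_of_isScalarSolution hc hl fun _ hz => isScalarSolution_stieltjes_mu hc hR hl hz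

theorem isWTransform_nu [NeZero M] (hc : 0 < c) (hR : R.IsHermitian)
    (hl : ∀ k, 0 < hR.eigenvalues k) :
    IsWTransform hR.eigenvalues c (nu R c) fun w => trResC hR.eigenvalues w - 1 :=
  isWTransform_of_expect_resolventEigenvalue hc hl
    (fun _ hz => isScalarSolution_stieltjes_mu hc hR hl hz)
    fun z hz => ((isNu_nu hc hR hl).2.2 z hz).trans (ntr_resolventT_tfun hc hR hl hz)

theorem exists_isXPlus_isXMinus_support_eq [NeZero M] (hc : 0 < c) (hR : R.IsHermitian)
    (hl : ∀ k, 0 < hR.eigenvalues k) (hgap : NoInteriorGap hR.eigenvalues c) :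
    ∃ xplus, IsXPlus hR c xplus ∧
      (c ≤ 1 → (mu R c).support = Set.Icc 0 xplus ∧ (nu R c).support = Set.Icc 0 xplus) ∧
      (1 < c → ∃ xminus, IsXMinus R c xminus ∧ 0 < xminus ∧ xminus < xplus ∧
        (mu R c).support = {0} ∪ Set.Icc xminus xplus ∧
        (nu R c).support = {0} ∪ Set.Icc xminus xplus) := by
  obtain ⟨_, hμ, -⟩ := isMu_mu hc hR hl
  obtain ⟨_, hν, -⟩ := isNu_nu hc hR hl
  have hWμ := isWTransform_mu hc hR hl
  have hWν := isWTransform_nu hc hR hl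
  obtain ⟨v, hv, hv₀⟩ := exists_phiRealDeriv_eq_zero_right hc hl
  refine ⟨_, isXPlus_phiReal hc hR hl hv hv₀, fun hc₁ => ⟨?_, ?_⟩, fun hc₁ => ?_⟩
  · exact hWμ.support_eq_Icc hc hc₁ hl hgap hμ hv hv₀
  · exact hWν.support_eq_Icc hc hc₁ hl hgap hν hv hv₀
  obtain ⟨ω, hω, hω_eq⟩ := exists_trRes_eq_one_div hc₁ hl
  obtain ⟨u, hωu, hu, hu₀⟩ := exists_phiRealDeriv_eq_zero_left hc₁ hl hω hω_eq
  refine ⟨_, isXMinus_phiReal hc hR hl hω_eq hωu hu hu₀, phiReal_pos_left hc hl hω_eq hωu hu,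
    (phiReal_lt_sq_left hc hl hu).trans (sq_lt_phiReal_right hc hl hv).1, ?_, ?_⟩
  · exact hWμ.support_eq_union hc hl hgap hμ
      (hWμ.zero_mem_support_of_mul_trResC hc₁ hl hgap) hω_eq hωu hu hu₀ hv hv₀
  · exact hWν.support_eq_union hc hl hgap hν
      (hWν.zero_mem_support_of_trResC_sub_one hc₁ hl) hω_eq hωu hu hu₀ hv hv₀

end Matrix

section InteriorGap

variable {M : ℕ} {c a κ : ℝ} {R : Matrix (Fin M) (Fin M) ℂ}

theorem sum_eigenvalues₀ {n : Type*} [Fintype n] [DecidableEq n] {A : Matrix n n ℂ}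
    (hA : A.IsHermitian) (f : ℝ → ℝ) : ∑ k, f (hA.eigenvalues₀ k) = ∑ k, f (hA.eigenvalues k) :=
  (Equiv.sum_comp (Fintype.equivOfCardEq (Fintype.card_fin _)).symm
    fun k => f (hA.eigenvalues₀ k)).symm

theorem le_trResSq_of_spacing [NeZero M] (hR : R.IsHermitian) (ha : 0 ≤ a)
    (hle : ∀ k, a ≤ hR.eigenvalues k) (hκ : 0 < κ)
    (hspacing : ∀ k m : Fin (Fintype.card (Fin M)), k ≤ m →
      |hR.eigenvalues₀ k - hR.eigenvalues₀ m|
        ≤ κ * (|((k : ℕ) : ℝ) - ((m : ℕ) : ℝ)| / (M : ℝ)) ^ (1 / 2 : ℝ))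
    {w : ℝ} (hne : ∀ k, hR.eigenvalues k ≠ w) (hgt : ∃ k, w < hR.eigenvalues k)
    (hlt : ∃ k, hR.eigenvalues k < w) :
    a ^ 2 / κ ^ 2 * ∑ i ∈ Finset.range (M / 2), 1 / ((i : ℝ) + 1) ≤
      trResSq hR.eigenvalues w := by
  have hM : (0 : ℝ) < M := by exact_mod_cast NeZero.pos M
  have hindex (P : ℝ → Prop) := ((Fintype.equivOfCardEq (Fintype.card_fin _)).forall_congr_left :
    (∀ k, P (hR.eigenvalues₀ k)) ↔ ∀ k, P (hR.eigenvalues k))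
  have hsum := mul_sum_le_sum_one_div_sq_of_spacing hR.eigenvalues₀_antitone hκ
    (by simpa only [Fintype.card_fin] using hspacing) ((hindex (· ≠ w)).2 hne)
    (hgt.imp' _ fun _ => id) (hlt.imp' _ fun _ => id)
  rw [sum_eigenvalues₀ hR fun x => 1 / (x - w) ^ 2, Fintype.card_fin] at hsum
  calc a ^ 2 / κ ^ 2 * ∑ i ∈ Finset.range (M / 2), 1 / ((i : ℝ) + 1)
      = a ^ 2 * (M / κ ^ 2 * ∑ i ∈ Finset.range (M / 2), 1 / ((i : ℝ) + 1)) / M := by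
        field_simp
    _ ≤ a ^ 2 * (∑ k, 1 / (hR.eigenvalues k - w) ^ 2) / M := by gcongr
    _ = 𝔼 k, a ^ 2 * (1 / (hR.eigenvalues k - w) ^ 2) := by
        rw [Fintype.expect_eq_sum_div_card, Fintype.card_fin, Finset.mul_sum]
    _ ≤ trResSq hR.eigenvalues w := by
        refine Finset.expect_le_expect fun k _ => ?_
        rw [div_pow, mul_one_div]
        have := hle k
        gcongr

theorem noInteriorGap_of_spacing [NeZero M] (hc : 0 < c) (hR : R.IsHermitian) (ha : 0 ≤ a)
    (hle : ∀ k, a ≤ hR.eigenvalues k) (hκ : 0 < κ)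
    (hspacing : ∀ k m : Fin (Fintype.card (Fin M)), k ≤ m →
      |hR.eigenvalues₀ k - hR.eigenvalues₀ m|
        ≤ κ * (|((k : ℕ) : ℝ) - ((m : ℕ) : ℝ)| / (M : ℝ)) ^ (1 / 2 : ℝ))
    (hlarge : 1 < c * (a ^ 2 / κ ^ 2 * ∑ i ∈ Finset.range (M / 2), 1 / ((i : ℝ) + 1))) :
    NoInteriorGap hR.eigenvalues c := by
  intro w hne hratio
  by_contra! hinterior
  obtain ⟨⟨k, hk⟩, m, hm⟩ := hinterior
  have hle := le_trResSq_of_spacing hR ha hle hκ hspacing hne ⟨m, hm.lt_of_ne (hne m).symm⟩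
    ⟨k, hk.lt_of_ne (hne k)⟩
  exact (hlarge.trans_le (mul_le_mul_of_nonneg_left hle hc.le)).not_ge hratio

theorem tendsto_atTop_of_tendsto_mul_div {M : ℕ → ℕ} {L x : ℝ} (hx : 0 < x)
    (h : Tendsto (fun N => (M N : ℝ) * L / (N : ℝ)) atTop (𝓝 x)) : Tendsto M atTop atTop := by
  have hmul : Tendsto (fun N => (M N : ℝ) * L) atTop atTop := by
    refine (h.pos_mul_atTop hx tendsto_natCast_atTop_atTop).congr' ?_
    filter_upwards [eventually_ne_atTop 0] with N hN
    exact div_mul_cancel₀ _ (Nat.cast_ne_zero.2 hN)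
  have hL : 0 < L := by
    obtain ⟨N, hN⟩ := (hmul.eventually_gt_atTop 0).exists
    exact pos_of_mul_pos_right hN (Nat.cast_nonneg _)
  exact tendsto_natCast_atTop_iff.1 ((tendsto_mul_const_atTop_of_pos hL).1 hmul)

end InteriorGap
end AutocovSupport
end

theorem mainTheorem10_general {α : Type*} {F : Filter α} (M : α → ℕ) (c : α → ℝ) {c₀ a : ℝ}
    (R : (i : α) → Matrix (Fin (M i)) (Fin (M i)) ℂ) (hM : Tendsto M F atTop)
    (hc₀ : 0 < c₀) (hc : ∀ᶠ i in F, c₀ ≤ c i) (ha : 0 < a)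
    (hherm : ∀ i, (R i).IsHermitian)
    (hlow : ∀ᶠ i in F, (R i - (a : ℂ) • (1 : Matrix (Fin (M i)) (Fin (M i)) ℂ)).PosSemidef)
    (hcond : ∃ κ : ℝ, 0 < κ ∧ ∀ᶠ i in F, ∀ k l : Fin (Fintype.card (Fin (M i))), k ≤ l →
      |(hherm i).eigenvalues₀ k - (hherm i).eigenvalues₀ l|
        ≤ κ * (|((k : ℕ) : ℝ) - ((l : ℕ) : ℝ)| / (M i : ℝ)) ^ (1 / 2 : ℝ)) :
    ∀ᶠ i in F, ∃ xplus : ℝ, AutocovSupport.IsXPlus (hherm i) (c i) xplus ∧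
      (c i ≤ 1 →
        (AutocovSupport.mu (R i) (c i)).support = Set.Icc 0 xplus ∧
        (AutocovSupport.nu (R i) (c i)).support = Set.Icc 0 xplus) ∧
      (1 < c i →
        ∃ xminus : ℝ, AutocovSupport.IsXMinus (R i) (c i) xminus ∧
          0 < xminus ∧ xminus < xplus ∧
          (AutocovSupport.mu (R i) (c i)).support = {0} ∪ Set.Icc xminus xplus ∧
          (AutocovSupport.nu (R i) (c i)).support = {0} ∪ Set.Icc xminus xplus) := by
  obtain ⟨κ, hκ, hcond⟩ := hcond
  have hharmonic : Tendsto (fun i => c₀ * (a ^ 2 / κ ^ 2 *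
      ∑ j ∈ Finset.range (M i / 2), 1 / ((j : ℝ) + 1))) F atTop :=
    ((Real.tendsto_sum_range_one_div_nat_succ_atTop.comp
      ((Nat.tendsto_div_const_atTop two_ne_zero).comp hM)).const_mul_atTop
        (by positivity)).const_mul_atTop hc₀
  filter_upwards [hc, hlow, hcond, hM.eventually_ne_atTop 0, hharmonic.eventually_gt_atTop 1]
    with i hci hlow hspacing hMi hlarge
  have : NeZero (M i) := ⟨hMi⟩
  have hle := AutocovSupport.le_eigenvalues_of_posSemidef_sub (hherm i) hlow
  refine AutocovSupport.exists_isXPlus_isXMinus_support_eq (hc₀.trans_le hci) (hherm i)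
    (fun k => ha.trans_le (hle k)) (AutocovSupport.noInteriorGap_of_spacing (hc₀.trans_le hci)
      (hherm i) ha.le hle hκ hspacing (hlarge.trans_le ?_))
  have hnonneg : 0 ≤ ∑ j ∈ Finset.range (M i / 2), 1 / ((j : ℝ) + 1) :=
    Finset.sum_nonneg fun j _ => by positivity
  gcongr

theorem mainTheorem10
    (L : ℕ) (M : ℕ → ℕ) (c : ℕ → ℝ) (cstar a b : ℝ)
    (R : (N : ℕ) → Matrix (Fin (M N)) (Fin (M N)) ℂ)
    (hc : ∀ N : ℕ, c N = ((M N : ℝ) * (L : ℝ)) / (N : ℝ))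
    (hcstar : 0 < cstar) (hlim : Tendsto c atTop (𝓝 cstar))
    (ha : 0 < a) (hb : 0 < b)
    (hherm : ∀ N : ℕ, (R N).IsHermitian)
    (hlow : ∀ N : ℕ, 1 ≤ N →
      (R N - (a : ℂ) • (1 : Matrix (Fin (M N)) (Fin (M N)) ℂ)).PosSemidef)
    (hupp : ∀ N : ℕ, 1 ≤ N →
      ((b : ℂ) • (1 : Matrix (Fin (M N)) (Fin (M N)) ℂ) - R N).PosDef)
    (hcond : ∃ κ : ℝ, 0 < κ ∧ ∀ᶠ N : ℕ in atTop,
      ∀ k l : Fin (Fintype.card (Fin (M N))), k ≤ l →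
        |(hherm N).eigenvalues₀ k - (hherm N).eigenvalues₀ l|
          ≤ κ * (|((k : ℕ) : ℝ) - ((l : ℕ) : ℝ)| / (M N : ℝ)) ^ (1 / 2 : ℝ)) :
    ∀ᶠ N : ℕ in atTop,
      ∃ xplus : ℝ, AutocovSupport.IsXPlus (hherm N) (c N) xplus ∧
        (c N ≤ 1 →
          (AutocovSupport.mu (R N) (c N)).support = Set.Icc 0 xplus ∧
          (AutocovSupport.nu (R N) (c N)).support = Set.Icc 0 xplus) ∧
        (1 < c N →
          ∃ xminus : ℝ, AutocovSupport.IsXMinus (R N) (c N) xminus ∧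
            0 < xminus ∧ xminus < xplus ∧
            (AutocovSupport.mu (R N) (c N)).support = {0} ∪ Set.Icc xminus xplus ∧
            (AutocovSupport.nu (R N) (c N)).support = {0} ∪ Set.Icc xminus xplus) := by
  have hM : Tendsto M atTop atTop :=
    AutocovSupport.tendsto_atTop_of_tendsto_mul_div hcstar (hlim.congr hc)
  exact mainTheorem10_general M c R hM (half_pos hcstar)
    (hlim.eventually_const_le (half_lt_self hcstar)) ha hherm
    (eventually_atTop.2 ⟨1, hlow⟩) hcond
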